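/- Let $X$ be a smooth manifold of dimension $n$ (Hausdorff, second countable) and $Y\subset X$ a closed submanifold of codimension $m$. A nonnegative Morse–Bott function with zero set $Y$ is a smooth function $\mu\colon X\to\mathbb R_{\ge 0}$ that vanishes exactly on $Y$ and whose Hessian has rank $m$ at all points of $Y$; let $\mathit{MB}$ be the set of these functions. Differential forms have real (or complex) coefficients. For $\mu\in\mathit{MB}$ let $\mathcal A_{X,\mu}$ be the sheaf of differential graded algebras (DGAs) on $X$ whose sections over $U$ are the smooth differential forms $\omega$ on $U\smallsetminus Y$ such that, locally on $U$, $\mu^N\omega$ extends to a smooth form for some $N\ge 0$. An affine $p$-simplex in $\mathit{MB}$ is an affine map from $\Delta_p=\{t\in\mathbb R^{p+1}_{\ge0}\colon \sum t_i=1\}$ to $\mathit{MB}$; it is determined by its vertices $\mu_0,\dots,\mu_p$. Let $S(\mathit{MB})$ be the category of simplices of the affine singular set of $\mathit{MB}$: the objects are the affine simplices and the morphisms are compositions of face and degeneracy maps. For an affine simplex $\sigma$ with vertices $\mu_0,\dots,\mu_p$ let $$F(\sigma)=p_*\mathcal A_{X\times\Delta_p,\ \sum_i t_i\mu_i},\qquad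 p\colon X\times\Delta_p\to X,$$ where $\mathcal A_{X\times\Delta_p,\ \sum t_i\mu_i}$ is the sheaf of smooth forms on $(X\smallsetminus Y)\times\Delta_p$ which locally on $X\times\Delta_p$ extend smoothly (up to the boundary of $\Delta_p$) after multiplication by some power of $\sum t_i\mu_i$; and let $F$ send face and degeneracy maps to the pull-backs along the corresponding maps of geometric simplices. Then the following holds. 1. $\mathit{MB}$ is a convex cone, and $F$ is a functor from $S(\mathit{MB})$ to the category of sheaves of differential graded algebras on $X$. 2. On vertices, $F(\mu)=\mathcal A_{X,\mu}$: for each $0$-simplex $\mu$ the pull-back along $X\cong X\times\Delta_0$ is an isomorphism $F(\mu)\to\mathcal A_{X,\mu}$ of sheaves of DGAs. 3. $F$ sends all morphisms of $S(\mathit{MB})$ (in particular all face and degeneracy maps) to quasi-isomorphisms, that is, to morphisms inducing isomorphisms of cohomology sheaves. 4. In each degree $k$ there are canonical isomorphisms of cohomology sheaves $$I(\mu_0,\mu_1)\colon \mathcal H^k(\mathcal A_{X,\mu_0})\to\mathcal H^k(\mathcal A_{X,\mu_1}),\qquad \mu_0,\mu_1\in\mathit{MB},$$ such that for each affine simplex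 $\sigma$ and all vertices $\mu_i,\mu_j$ of $\sigma$ one has $I(\mu_i,\mu_j)\circ \mathrm{ev}_i=\mathrm{ev}_j$, where $\mathrm{ev}_i\colon\mathcal H^k(F(\sigma))\to\mathcal H^k(\mathcal A_{X,\mu_i})$ is induced by the restriction of forms from $X\times\Delta_p$ to the $i$-th vertex of $\Delta_p$. They satisfy $$I(\mu_1,\mu_2)\circ I(\mu_0,\mu_1)=I(\mu_0,\mu_2)\qquad\text{for all }\mu_0,\mu_1,\mu_2\in\mathit{MB},$$ and the family $I$ is the only one with $I(\mu_i,\mu_j)\circ \mathrm{ev}_i=\mathrm{ev}_j$ for all affine $1$-simplices. -/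

import Mathlib

open Set Topology TopologicalSpace CategoryTheory Opposite
open scoped Manifold ContDiff

noncomputable section

set_option linter.unusedSectionVars false

namespace MorseBottForms

section Pointwise

variable (𝕜 : Type) [RCLike 𝕜]
variable {V : Type} [NormedAddCommGroup V] [NormedSpace ℝ V] [FiniteDimensional ℝ V]
variable {W : Type} [NormedAddCommGroup W] [NormedSpace ℝ W] [FiniteDimensional ℝ W]
variable {Z : Type} [NormedAddCommGroup Z] [NormedSpace ℝ Z] [FiniteDimensional ℝ Z]

/-- The algebra of `𝕜`-valued alternating forms (of all degrees) on a finite-dimensional real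
vector space `V`, as the exterior algebra over `𝕜` of the space of `ℝ`-linear maps `V → 𝕜`.
The product is the wedge product. -/
abbrev Cov (V : Type) [NormedAddCommGroup V] [NormedSpace ℝ V] : Type :=
  ExteriorAlgebra 𝕜 (V →ₗ[ℝ] 𝕜)

/-- The pull-back of covectors along a linear map. -/
def covMap (A : V →L[ℝ] W) : Cov 𝕜 W →ₐ[𝕜] Cov 𝕜 V :=
  ExteriorAlgebra.map (LinearMap.lcomp 𝕜 𝕜 A.toLinearMap)

instance covFiniteDimensional : FiniteDimensional 𝕜 (Cov 𝕜 V) :=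
  .of_basis (Module.finBasis 𝕜 (V →ₗ[ℝ] 𝕜)).ExteriorAlgebra

/- The finite-dimensional space `Cov 𝕜 V` gets its (unique) vector space topology, through some
norm: which one is irrelevant, since all norms are equivalent. -/
instance covNormedAddCommGroup : NormedAddCommGroup (Cov 𝕜 V) :=
  NormedAddCommGroup.induced (Cov 𝕜 V) (Fin (Module.finrank 𝕜 (Cov 𝕜 V)) → 𝕜)
    (Module.finBasis 𝕜 (Cov 𝕜 V)).equivFun (LinearEquiv.injective _)

instance covNormedSpace : NormedSpace ℝ (Cov 𝕜 V) :=
  NormedSpace.induced ℝ (Cov 𝕜 V) (Fin (Module.finrank 𝕜 (Cov 𝕜 V)) → 𝕜)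
    ((Module.finBasis 𝕜 (Cov 𝕜 V)).equivFun.toLinearMap.restrictScalars ℝ)

instance covFiniteDimensionalReal : FiniteDimensional ℝ (Cov 𝕜 V) :=
  Module.Finite.trans 𝕜 (Cov 𝕜 V)

/-- A real covector, as a form of degree one. -/
def covOne (l : V →ₗ[ℝ] ℝ) : Cov 𝕜 V :=
  ExteriorAlgebra.ι 𝕜 ((Algebra.linearMap ℝ 𝕜) ∘ₗ l)

/-- `∑ i, eⁱ ∧ L eᵢ` for a basis `e` of `V` with dual basis `eⁱ`. -/
def wedgeUp (L : V →ₗ[ℝ] Cov 𝕜 V) : Cov 𝕜 V :=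
  ∑ i, covOne 𝕜 ((Module.finBasis ℝ V).coord i) * L (Module.finBasis ℝ V i)

/-- The exterior derivative `∑ i, eⁱ ∧ ∂η/∂xᵢ` of a form `η` on a subset `D` of the vector
space `V`. -/
def extD (η : V → Cov 𝕜 V) (D : Set V) (x : V) : Cov 𝕜 V :=
  wedgeUp 𝕜 (fderivWithin ℝ η D x).toLinearMap

variable {𝕜}

lemma covMap_id (w : Cov 𝕜 V) : covMap 𝕜 (ContinuousLinearMap.id ℝ V) w = w := by
  have : covMap 𝕜 (ContinuousLinearMap.id ℝ V) = AlgHom.id 𝕜 (Cov 𝕜 V) := by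
    rw [covMap, ← ExteriorAlgebra.map_id]; rfl
  rw [this]; rfl

lemma covMap_comp (B : W →L[ℝ] Z) (A : V →L[ℝ] W) (w : Cov 𝕜 Z) :
    covMap 𝕜 (B.comp A) w = covMap 𝕜 A (covMap 𝕜 B w) := by
  have : covMap 𝕜 (B.comp A) = (covMap 𝕜 A).comp (covMap 𝕜 B) := by
    rw [covMap, covMap, covMap, ExteriorAlgebra.map_comp_map]; rfl
  rw [this]; rfl

lemma covMap_ι (A : V →L[ℝ] W) (l : W →ₗ[ℝ] 𝕜) :
    covMap 𝕜 A (ExteriorAlgebra.ι 𝕜 l) = ExteriorAlgebra.ι 𝕜 (l ∘ₗ A.toLinearMap) := by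
  rw [covMap, ExteriorAlgebra.map_apply_ι]; rfl

lemma covMap_covOne (A : V →L[ℝ] W) (l : W →ₗ[ℝ] ℝ) :
    covMap 𝕜 A (covOne 𝕜 l) = covOne 𝕜 (l ∘ₗ A.toLinearMap) := by
  simp [covOne, covMap_ι, LinearMap.comp_assoc]

lemma covMap_mem (A : V →L[ℝ] W) {k : ℕ} {w : Cov 𝕜 W} (hw : w ∈ ⋀[𝕜]^k (W →ₗ[ℝ] 𝕜)) :
    covMap 𝕜 A w ∈ ⋀[𝕜]^k (V →ₗ[ℝ] 𝕜) := by
  have h := Submodule.mem_map_of_mem (f := (covMap 𝕜 A).toLinearMap) hw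
  have h1 : ((LinearMap.range (ExteriorAlgebra.ι 𝕜 (M := W →ₗ[ℝ] 𝕜))).map
      (covMap 𝕜 A).toLinearMap) ≤ LinearMap.range (ExteriorAlgebra.ι 𝕜 (M := V →ₗ[ℝ] 𝕜)) := by
    rintro _ ⟨_, ⟨l, rfl⟩, rfl⟩
    exact ⟨_, (covMap_ι A l).symm⟩
  rw [Submodule.map_pow] at h
  exact pow_le_pow_left' h1 k h

lemma covOne_mem (l : V →ₗ[ℝ] ℝ) : covOne 𝕜 l ∈ ⋀[𝕜]^1 (V →ₗ[ℝ] 𝕜) := by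
  change _ ∈ (LinearMap.range (ExteriorAlgebra.ι 𝕜 (M := V →ₗ[ℝ] 𝕜))) ^ 1
  rw [pow_one]; exact ⟨_, rfl⟩

/-- Multiplication as a continuous bilinear map. -/
def covMul : Cov 𝕜 V →L[ℝ] Cov 𝕜 V →L[ℝ] Cov 𝕜 V :=
  LinearMap.toContinuousBilinearMap (LinearMap.mul ℝ (Cov 𝕜 V))

lemma covMul_apply (a b : Cov 𝕜 V) : covMul a b = a * b := rfl

lemma contDiffWithinAt_mul {f g : W → Cov 𝕜 V} {D : Set W} {x : W} {n : WithTop ℕ∞}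
    (hf : ContDiffWithinAt ℝ n f D x) (hg : ContDiffWithinAt ℝ n g D x) :
    ContDiffWithinAt ℝ n (fun y => f y * g y) D x := by
  have := (covMul (𝕜 := 𝕜) (V := V)).isBoundedBilinearMap.contDiff (n := n)
    |>.comp_contDiffWithinAt (hf.prodMk hg)
  exact this

lemma contDiff_covMap (w : Cov 𝕜 W) :
    ContDiff ℝ ∞ (fun A : V →L[ℝ] W => covMap 𝕜 A w) := by
  induction w using ExteriorAlgebra.induction with
  | algebraMap r => simpa using contDiff_const
  | ι l =>
    let T : (V →L[ℝ] W) →ₗ[ℝ] Cov 𝕜 V :=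
      { toFun := fun A => ExteriorAlgebra.ι 𝕜 (l ∘ₗ A.toLinearMap)
        map_add' := fun A B => by
          rw [← map_add]; congr 1; ext v; simp
        map_smul' := fun c A => by
          have : (l ∘ₗ (c • A).toLinearMap) = (c : 𝕜) • (l ∘ₗ A.toLinearMap) := by
            ext v; simp [RCLike.real_smul_eq_coe_mul]
          rw [this, map_smul]; exact algebraMap_smul 𝕜 c _ }
    have : (fun A : V →L[ℝ] W => covMap 𝕜 A (ExteriorAlgebra.ι 𝕜 l)) = T := by
      funext A; rw [covMap_ι]; rfl
    rw [this]
    exact (LinearMap.toContinuousLinearMap T).contDiff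
  | mul a b ha hb =>
    simp only [map_mul]
    rw [← contDiffOn_univ] at *
    exact fun x hx => contDiffWithinAt_mul (ha x hx) (hb x hx)
  | add a b ha hb => simpa using ha.add hb

lemma contDiffWithinAt_covMap {P : Type} [NormedAddCommGroup P] [NormedSpace ℝ P]
    {A : P → V →L[ℝ] W} {η : P → Cov 𝕜 W} {D : Set P} {x : P}
    (hA : ContDiffWithinAt ℝ ∞ A D x) (hη : ContDiffWithinAt ℝ ∞ η D x) :
    ContDiffWithinAt ℝ ∞ (fun y => covMap 𝕜 (A y) (η y)) D x := by
  let b := Module.finBasis ℝ (Cov 𝕜 W)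
  have h : (fun y => covMap 𝕜 (A y) (η y)) = fun y => ∑ i,
      (b.repr (η y) i) • covMap 𝕜 (A y) (b i) := by
    funext y
    conv_lhs => rw [← b.sum_repr (η y)]
    rw [map_sum]
    refine Finset.sum_congr rfl fun i _ => ?_
    exact ((covMap 𝕜 (A y)).toLinearMap.restrictScalars ℝ).map_smul _ _
  rw [h]
  refine ContDiffWithinAt.sum fun i _ => ContDiffWithinAt.fun_smul ?_ ?_
  · exact (LinearMap.toContinuousLinearMap (b.coord i)).contDiff.comp_contDiffWithinAt hη
  · exact (contDiff_covMap (b i)).comp_contDiffWithinAt hA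

lemma covOne_add (l l' : V →ₗ[ℝ] ℝ) : covOne 𝕜 (l + l') = covOne 𝕜 l + covOne 𝕜 l' := by
  simp [covOne, LinearMap.comp_add]

/-- `covOne` as a linear map. -/
def covOneL : (V →ₗ[ℝ] ℝ) →ₗ[ℝ] Cov 𝕜 V where
  toFun := covOne 𝕜
  map_add' := covOne_add
  map_smul' c l := by
    have : (Algebra.linearMap ℝ 𝕜) ∘ₗ (c • l) = (c : 𝕜) • ((Algebra.linearMap ℝ 𝕜) ∘ₗ l) := by
      ext v; simp
    rw [covOne, this, map_smul]; exact algebraMap_smul 𝕜 c _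

lemma wedgeUp_pull (A : V →L[ℝ] W) (L : W →ₗ[ℝ] Cov 𝕜 V) :
    wedgeUp 𝕜 (L ∘ₗ A.toLinearMap) =
      ∑ i, covOne 𝕜 ((Module.finBasis ℝ W).coord i ∘ₗ A.toLinearMap) *
        L (Module.finBasis ℝ W i) := by
  set b := Module.finBasis ℝ W
  set c := Module.finBasis ℝ V
  have h1 : ∀ j, L (A (c j)) = ∑ i, (b.coord i (A (c j))) • L (b i) := fun j => by
    conv_lhs => rw [← b.sum_repr (A (c j)), map_sum]
    simp
  have h2 : ∀ i, b.coord i ∘ₗ A.toLinearMap = ∑ j, (b.coord i (A (c j))) • c.coord j := fun i => by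
    refine c.ext fun k => ?_
    simp [Finsupp.single_apply]
  have h3 : ∀ i, covOne 𝕜 (b.coord i ∘ₗ A.toLinearMap) =
      ∑ j, (b.coord i (A (c j))) • covOne 𝕜 (c.coord j) := fun i => by
    rw [h2 i]
    change covOneL _ = _
    rw [map_sum]
    simp only [map_smul]; rfl
  simp only [wedgeUp, LinearMap.comp_apply, ContinuousLinearMap.coe_coe]
  simp_rw [h3, Finset.sum_mul, smul_mul_assoc]
  rw [Finset.sum_comm]
  refine Finset.sum_congr rfl fun j _ => ?_
  rw [h1 j, Finset.mul_sum]
  refine Finset.sum_congr rfl fun i _ => ?_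
  rw [mul_smul_comm]

lemma wedgeUp_covMap (A : V →L[ℝ] W) (L : W →ₗ[ℝ] Cov 𝕜 W) :
    wedgeUp 𝕜 ((((covMap 𝕜 A).toLinearMap.restrictScalars ℝ) ∘ₗ L) ∘ₗ A.toLinearMap) =
      covMap 𝕜 A (wedgeUp 𝕜 L) := by
  rw [wedgeUp_pull, wedgeUp, map_sum]
  simp [covMap_covOne]

lemma ι_mul_comm (l : V →ₗ[ℝ] 𝕜) (a : Cov 𝕜 V) :
    ExteriorAlgebra.ι 𝕜 l * a = CliffordAlgebra.involute a * ExteriorAlgebra.ι 𝕜 l := by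
  induction a using ExteriorAlgebra.induction with
  | algebraMap r =>
    rw [AlgHom.commutes]; exact (Algebra.commutes r _).symm
  | ι l' =>
    have h := ExteriorAlgebra.ι_add_mul_swap (R := 𝕜) l l'
    have : (CliffordAlgebra.involute (ExteriorAlgebra.ι 𝕜 l') : Cov 𝕜 V) =
      - ExteriorAlgebra.ι 𝕜 l' := CliffordAlgebra.involute_ι (Q := 0) l'
    rw [this, neg_mul]
    exact eq_neg_of_add_eq_zero_left h
  | mul a b ha hb => rw [← mul_assoc, ha, mul_assoc, hb, ← mul_assoc, map_mul]
  | add a b ha hb => rw [mul_add, ha, hb, map_add, add_mul]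

lemma involute_mem {k : ℕ} {a : Cov 𝕜 V} (ha : a ∈ ⋀[𝕜]^k (V →ₗ[ℝ] 𝕜)) :
    (CliffordAlgebra.involute a : Cov 𝕜 V) = (-1) ^ k * a := by
  induction ha using Submodule.pow_induction_on_left' with
  | algebraMap r => simp
  | add x y i hx hy h1 h2 => rw [map_add, h1, h2, mul_add]
  | mem_mul m hm i x hx ih =>
    obtain ⟨l, rfl⟩ := hm
    have : (CliffordAlgebra.involute (ExteriorAlgebra.ι 𝕜 l) : Cov 𝕜 V) =
      - ExteriorAlgebra.ι 𝕜 l := CliffordAlgebra.involute_ι (Q := 0) l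
    rw [map_mul, this, ih, pow_succ]
    rcases neg_one_pow_eq_or (Cov 𝕜 V) i with h | h <;> rw [h] <;> simp

lemma extD_mul {f g : V → Cov 𝕜 V} {D : Set V} {x : V} (hD : UniqueDiffWithinAt ℝ D x)
    (hf : DifferentiableWithinAt ℝ f D x) (hg : DifferentiableWithinAt ℝ g D x) :
    extD 𝕜 (fun y => f y * g y) D x =
      extD 𝕜 f D x * g x + CliffordAlgebra.involute (f x) * extD 𝕜 g D x := by
  have h := ((covMul (𝕜 := 𝕜) (V := V)).hasFDerivWithinAt_of_bilinear hf.hasFDerivWithinAt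
    hg.hasFDerivWithinAt).fderivWithin hD
  have h' : fderivWithin ℝ (fun y => f y * g y) D x = _ := h
  have hv : ∀ v, fderivWithin ℝ (fun y => f y * g y) D x v =
      f x * fderivWithin ℝ g D x v + fderivWithin ℝ f D x v * g x := fun v => by
    rw [h']; rfl
  simp only [extD, wedgeUp, Finset.sum_mul, Finset.mul_sum, ← Finset.sum_add_distrib]
  refine Finset.sum_congr rfl fun i _ => ?_
  simp only [ContinuousLinearMap.coe_coe, hv]
  rw [mul_add, ← mul_assoc, covOne, ι_mul_comm, mul_assoc, add_comm, mul_assoc]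

lemma extD_congr {f g : V → Cov 𝕜 V} {D D' : Set V} {x : V} (hD : D =ᶠ[𝓝 x] D')
    (h : f =ᶠ[𝓝[D'] x] g) (hx : f x = g x) : extD 𝕜 f D x = extD 𝕜 g D' x := by
  rw [extD, extD, fderivWithin_congr_set hD, h.fderivWithin_eq hx]

lemma extD_const (w : Cov 𝕜 V) (D : Set V) (x : V) : extD 𝕜 (fun _ => w) D x = 0 := by
  simp [extD, wedgeUp]

lemma extD_add {f g : V → Cov 𝕜 V} {D : Set V} {x : V} (hD : UniqueDiffWithinAt ℝ D x)
    (hf : DifferentiableWithinAt ℝ f D x) (hg : DifferentiableWithinAt ℝ g D x) :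
    extD 𝕜 (fun y => f y + g y) D x = extD 𝕜 f D x + extD 𝕜 g D x := by
  simp [extD, wedgeUp, fderivWithin_fun_add hD hf hg, mul_add, Finset.sum_add_distrib]

/-- Linear maps commute with derivatives within a set. -/
lemma fderivWithin_lin {P Q R : Type} [NormedAddCommGroup P] [NormedSpace ℝ P]
    [NormedAddCommGroup Q] [NormedSpace ℝ Q] [FiniteDimensional ℝ Q]
    [NormedAddCommGroup R] [NormedSpace ℝ R] (T : Q →ₗ[ℝ] R) {f : P → Q} {D : Set P} {x : P}
    (hD : UniqueDiffWithinAt ℝ D x) (hf : DifferentiableWithinAt ℝ f D x) (v : P) :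
    fderivWithin ℝ (fun y => T (f y)) D x v = T (fderivWithin ℝ f D x v) := by
  have := ((LinearMap.toContinuousLinearMap T).hasFDerivAt.comp_hasFDerivWithinAt x
    hf.hasFDerivWithinAt).fderivWithin hD
  have h' : fderivWithin ℝ (fun y => T (f y)) D x = _ := this
  rw [h']; rfl

lemma sum_alt {ι : Type} [Fintype ι] (e : ι → Cov 𝕜 V) (he : ∀ i j, e i * e j = - (e j * e i))
    (c : ι → ι → Cov 𝕜 V) (hc : ∀ i j, c i j = c j i) : ∑ i, ∑ j, e i * (e j * c i j) = 0 := by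
  have h : ∑ i, ∑ j, e i * (e j * c i j) = - ∑ i, ∑ j, e i * (e j * c i j) := by
    conv_lhs => rw [Finset.sum_comm]
    rw [← Finset.sum_neg_distrib]
    refine Finset.sum_congr rfl fun i _ => ?_
    rw [← Finset.sum_neg_distrib]
    refine Finset.sum_congr rfl fun j _ => ?_
    rw [← mul_assoc, he, hc, neg_mul, mul_assoc]
  have h2 : (2 : ℝ) • ∑ i, ∑ j, e i * (e j * c i j) = 0 := by
    rw [two_smul]; nth_rewrite 1 [h]; exact neg_add_cancel _
  exact (smul_eq_zero.1 h2).resolve_left two_ne_zero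

lemma covOne_mul_comm (l l' : V →ₗ[ℝ] ℝ) :
    covOne 𝕜 l * covOne 𝕜 l' = - (covOne 𝕜 l' * covOne 𝕜 l) :=
  eq_neg_of_add_eq_zero_left (ExteriorAlgebra.ι_add_mul_swap (R := 𝕜) _ _)

lemma extD_extD {f : V → Cov 𝕜 V} {D : Set V} {x : V} (hD : UniqueDiffOn ℝ D)
    (hx : x ∈ D) (hx' : x ∈ closure (interior D)) (hf : ContDiffWithinAt ℝ ∞ f D x) :
    extD 𝕜 (fun y => extD 𝕜 f D y) D x = 0 := by
  have hs := hf.isSymmSndFDerivWithinAt (by simp; norm_cast) hD hx' hx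
  have hd : DifferentiableWithinAt ℝ (fderivWithin ℝ f D) D x :=
    (hf.fderivWithin_right hD (m := 1) (by norm_cast) hx).differentiableWithinAt one_ne_zero
  let b := Module.finBasis ℝ V
  let T : (V →L[ℝ] Cov 𝕜 V) →ₗ[ℝ] Cov 𝕜 V :=
    ∑ i, (LinearMap.mulLeft ℝ (covOne 𝕜 (b.coord i))) ∘ₗ
      (ContinuousLinearMap.apply ℝ (Cov 𝕜 V) (b i)).toLinearMap
  have hT : ∀ L : V →L[ℝ] Cov 𝕜 V, T L = wedgeUp 𝕜 L.toLinearMap := fun L => by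
    simp [T, wedgeUp, b]
  have h1 : ∀ v, fderivWithin ℝ (fun y => extD 𝕜 f D y) D x v =
      T (fderivWithin ℝ (fderivWithin ℝ f D) D x v) := fun v => by
    simp only [extD, ← hT]
    exact fderivWithin_lin T (hD x hx) hd v
  rw [extD, wedgeUp]
  simp only [ContinuousLinearMap.coe_coe, h1, hT]
  simp only [wedgeUp, Finset.mul_sum, ContinuousLinearMap.coe_coe]
  exact sum_alt (fun i => covOne 𝕜 (b.coord i)) (fun i j => covOne_mul_comm _ _) _
    (fun i j => hs _ _)

lemma contDiffOn_extD {f : V → Cov 𝕜 V} {D : Set V} (hD : UniqueDiffOn ℝ D)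
    (hf : ContDiffOn ℝ ∞ f D) : ContDiffOn ℝ ∞ (extD 𝕜 f D) D := by
  have h := hf.fderivWithin hD (m := ∞) (by simp)
  have : extD 𝕜 f D = fun x => ∑ i, (LinearMap.toContinuousLinearMap
      (LinearMap.mulLeft ℝ (covOne 𝕜 ((Module.finBasis ℝ V).coord i))))
      (fderivWithin ℝ f D x (Module.finBasis ℝ V i)) := by
    funext x; simp [extD, wedgeUp]
  rw [this]
  refine ContDiffOn.sum fun i _ => ContDiff.comp_contDiffOn (ContinuousLinearMap.contDiff _) ?_
  exact h.clm_apply contDiffOn_const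

/-- The pull-back of a form with constant coefficients is closed. -/
lemma extD_covMap_fderiv {g : V → W} {x : V} (hg : ContDiffAt ℝ ∞ g x) (w : Cov 𝕜 W) :
    extD 𝕜 (fun y => covMap 𝕜 (fderiv ℝ g y) w) univ x = 0 := by
  have hdg : ContDiffAt ℝ ∞ (fderiv ℝ g) x := hg.fderiv_right (m := ∞) (by simp)
  have hdw : ∀ w : Cov 𝕜 W,
      DifferentiableWithinAt ℝ (fun y => covMap 𝕜 (fderiv ℝ g y) w) univ x := fun w =>
    ((ContDiffAt.comp x (contDiff_covMap w).contDiffAt hdg).differentiableAt (by simp)).differentiableWithinAt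
  induction w using ExteriorAlgebra.induction with
  | algebraMap r => simp only [AlgHom.commutes]; exact extD_const _ _ _
  | ι l =>
    let c := Module.finBasis ℝ V
    have hs : IsSymmSndFDerivAt ℝ g x := hg.isSymmSndFDerivAt (by simp; norm_cast)
    have key : ∀ v, fderivWithin ℝ (fun y => covMap 𝕜 (fderiv ℝ g y) (ExteriorAlgebra.ι 𝕜 l))
        univ x v = ∑ j, covOne 𝕜 (c.coord j) *
          algebraMap 𝕜 _ (l (fderiv ℝ (fderiv ℝ g) x v (c j))) := fun v => by
      let T : (V →L[ℝ] W) →ₗ[ℝ] Cov 𝕜 V := ∑ j, (LinearMap.mulLeft ℝ (covOne 𝕜 (c.coord j))) ∘ₗ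
        ((Algebra.linearMap 𝕜 (Cov 𝕜 V)).restrictScalars ℝ) ∘ₗ l ∘ₗ
        (ContinuousLinearMap.apply ℝ W (c j)).toLinearMap
      have hT : ∀ A : V →L[ℝ] W, covMap 𝕜 A (ExteriorAlgebra.ι 𝕜 l) = T A := fun A => by
        rw [covMap_ι]
        have : l ∘ₗ A.toLinearMap =
            ∑ j, (l (A (c j))) • ((Algebra.linearMap ℝ 𝕜) ∘ₗ c.coord j) := by
          refine c.ext fun k => ?_
          simp [Finsupp.single_apply]
        rw [this, map_sum]
        simp only [T, LinearMap.sum_apply]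
        refine Finset.sum_congr rfl fun j _ => ?_
        rw [map_smul, Algebra.smul_def]
        exact Algebra.commutes _ _
      simp only [hT]
      rw [fderivWithin_lin T uniqueDiffWithinAt_univ
        (hdg.differentiableAt (by simp)).differentiableWithinAt]
      rw [fderivWithin_univ]
      simp [T]
    rw [extD, wedgeUp]
    simp only [ContinuousLinearMap.coe_coe, key, Finset.mul_sum]
    exact sum_alt (fun i => covOne 𝕜 (c.coord i)) (fun i j => covOne_mul_comm _ _) _
      (fun i j => by rw [hs _ _])
  | mul a b ha hb =>
    simp only [map_mul]
    rw [extD_mul uniqueDiffWithinAt_univ (hdw a) (hdw b), ha, hb]; simp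
  | add a b ha hb =>
    simp only [map_add]
    rw [extD_add uniqueDiffWithinAt_univ (hdw a) (hdw b), ha, hb]; simp

/-- The exterior derivative commutes with pull-backs. -/
lemma extD_pullback {g : V → W} {x : V} {D : Set V} {D' : Set W} {η : W → Cov 𝕜 W}
    (hg : ContDiffAt ℝ ∞ g x) (hD : UniqueDiffWithinAt ℝ D x) (hm : ∀ᶠ y in 𝓝[D] x, g y ∈ D')
    (hη : DifferentiableWithinAt ℝ η D' (g x)) :
    extD 𝕜 (fun y => covMap 𝕜 (fderiv ℝ g y) (η (g y))) D x =
      covMap 𝕜 (fderiv ℝ g x) (extD 𝕜 η D' (g x)) := by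
  let b := Module.finBasis ℝ (Cov 𝕜 W)
  have hdg : ContDiffAt ℝ ∞ (fderiv ℝ g) x := hg.fderiv_right (m := ∞) (by simp)
  have hA : ∀ w : Cov 𝕜 W, DifferentiableAt ℝ (fun y => covMap 𝕜 (fderiv ℝ g y) w) x := fun w =>
    (ContDiffAt.comp x (contDiff_covMap w).contDiffAt hdg).differentiableAt (by simp)
  have hsum : ∀ (A : V →L[ℝ] W) (w : Cov 𝕜 W), covMap 𝕜 A w =
      ∑ i, (b.coord i w) • covMap 𝕜 A (b i) := fun A w => by
    conv_lhs => rw [← b.sum_repr w]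
    rw [map_sum]
    refine Finset.sum_congr rfl fun i _ => ?_
    exact ((covMap 𝕜 A).toLinearMap.restrictScalars ℝ).map_smul _ _
  -- restrict `D` so that it is mapped into `D'`
  have hgD : HasFDerivWithinAt g (fderiv ℝ g x) D x :=
    (hg.differentiableAt (by simp)).hasFDerivAt.hasFDerivWithinAt
  have hηg : HasFDerivWithinAt (fun y => η (g y)) ((fderivWithin ℝ η D' (g x)).comp
      (fderiv ℝ g x)) D x :=
    HasFDerivWithinAt.comp_of_tendsto x hη.hasFDerivWithinAt hgD
      (tendsto_nhdsWithin_iff.2 ⟨hgD.continuousWithinAt, hm⟩)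
  have hco : ∀ i, HasFDerivWithinAt (fun y => b.coord i (η (g y)))
      ((LinearMap.toContinuousLinearMap (b.coord i)).comp ((fderivWithin ℝ η D' (g x)).comp
      (fderiv ℝ g x))) D x := fun i =>
    (LinearMap.toContinuousLinearMap (b.coord i)).hasFDerivAt.comp_hasFDerivWithinAt x hηg
  have hAw : ∀ w, HasFDerivWithinAt (fun y => covMap 𝕜 (fderiv ℝ g y) w)
      (fderiv ℝ (fun y => covMap 𝕜 (fderiv ℝ g y) w) x) D x := fun w =>
    (hA w).hasFDerivAt.hasFDerivWithinAt
  have htot := (HasFDerivWithinAt.fun_sum (u := Finset.univ)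
    fun i _ => (hco i).smul (hAw (b i))).fderivWithin hD
  have hfun : (fun y => covMap 𝕜 (fderiv ℝ g y) (η (g y))) =
      fun y => ∑ i, (b.coord i (η (g y))) • covMap 𝕜 (fderiv ℝ g y) (b i) :=
    funext fun y => hsum _ _
  have hv : ∀ v, fderivWithin ℝ (fun y => covMap 𝕜 (fderiv ℝ g y) (η (g y))) D x v =
      (∑ i, (b.coord i (η (g x))) • fderiv ℝ (fun y => covMap 𝕜 (fderiv ℝ g y) (b i)) x v) +
      covMap 𝕜 (fderiv ℝ g x) (fderivWithin ℝ η D' (g x) (fderiv ℝ g x v)) := fun v => by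
    rw [hsum (fderiv ℝ g x) (fderivWithin ℝ η D' (g x) (fderiv ℝ g x v)),
      ← Finset.sum_add_distrib, hfun]
    erw [htot]
    rw [sum_apply]
    rfl
  have hclosed : ∀ w, wedgeUp 𝕜 (fderiv ℝ (fun y => covMap 𝕜 (fderiv ℝ g y) w) x).toLinearMap
      = 0 := fun w => by
    have := extD_covMap_fderiv hg w
    rwa [extD, fderivWithin_univ] at this
  have hlin : (fderivWithin ℝ (fun y => covMap 𝕜 (fderiv ℝ g y) (η (g y))) D x).toLinearMap =
      (∑ i, (b.coord i (η (g x))) •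
        (fderiv ℝ (fun y => covMap 𝕜 (fderiv ℝ g y) (b i)) x).toLinearMap) +
      (((covMap 𝕜 (fderiv ℝ g x)).toLinearMap.restrictScalars ℝ) ∘ₗ
        (fderivWithin ℝ η D' (g x)).toLinearMap) ∘ₗ (fderiv ℝ g x).toLinearMap := by
    ext v
    simp [hv]
  have hadd : ∀ L L' : V →ₗ[ℝ] Cov 𝕜 V, wedgeUp 𝕜 (L + L') = wedgeUp 𝕜 L + wedgeUp 𝕜 L' :=
    fun L L' => by simp [wedgeUp, mul_add, Finset.sum_add_distrib]
  rw [extD, hlin, hadd, wedgeUp_covMap]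
  have hz : wedgeUp 𝕜 (∑ i, (b.coord i (η (g x))) •
        (fderiv ℝ (fun y => covMap 𝕜 (fderiv ℝ g y) (b i)) x).toLinearMap) = 0 := by
    have : ∀ i, ∑ j, covOne 𝕜 ((Module.finBasis ℝ V).coord j) *
        (fderiv ℝ (fun y => covMap 𝕜 (fderiv ℝ g y) (b i)) x) (Module.finBasis ℝ V j) = 0 :=
      fun i => hclosed (b i)
    simp only [wedgeUp, LinearMap.sum_apply, LinearMap.smul_apply, Finset.mul_sum,
      mul_smul_comm, ContinuousLinearMap.coe_coe]
    rw [Finset.sum_comm]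
    simp only [← Finset.smul_sum, this, smul_zero, Finset.sum_const_zero]
  rw [hz, zero_add]; rfl

end Pointwise

section Manifold

universe u v

variable (𝕜 : Type) [RCLike 𝕜]
variable {V : Type} [NormedAddCommGroup V] [NormedSpace ℝ V] [FiniteDimensional ℝ V]
  {H : Type} [TopologicalSpace H] (I : ModelWithCorners ℝ V H) [I.Boundaryless]
  {M : Type u} [TopologicalSpace M] [ChartedSpace H M] [IsManifold I ∞ M]
variable {W : Type} [NormedAddCommGroup W] [NormedSpace ℝ W] [FiniteDimensional ℝ W]
  {G : Type} [TopologicalSpace G] (J : ModelWithCorners ℝ W G) [J.Boundaryless]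
  {N : Type v} [TopologicalSpace N] [ChartedSpace G N] [IsManifold J ∞ N]

/-- A field of covectors assigns to `x : M` an element of the exterior algebra of the cotangent
space of `M` at `x`. In Mathlib `TangentSpace I x` is the model space `V`, the identification being
the differential of the preferred chart `extChartAt I x` at `x`. -/
abbrev CovField (V : Type) [NormedAddCommGroup V] [NormedSpace ℝ V] (M : Type u) : Type u :=
  M → Cov 𝕜 V

/-- The differential of `g : M → N` at `x`, as a linear map between the model spaces, which are the
tangent spaces. -/
def mder (g : M → N) (x : M) : V →L[ℝ] W := mfderiv I J g x

/-- The pull-back of a field of covectors on `N` along a map `g : M → N`. -/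
def pullField (g : M → N) (η : CovField 𝕜 W N) : CovField 𝕜 V M := fun x =>
  covMap 𝕜 (mder I J g x) (η (g x))

/-- The expression of a field of covectors in the chart at `x₀`: its pull-back along the inverse
of that chart. -/
def chartRep (x₀ : M) (η : CovField 𝕜 V M) : V → Cov 𝕜 V := fun z =>
  covMap 𝕜 (mder 𝓘(ℝ, V) I (extChartAt I x₀).symm z)
    (η ((extChartAt I x₀).symm z))

/-- The part of a subset `D` of `M` that is visible in the chart at `x₀`. -/
def chartSet (D : Set M) (x₀ : M) : Set V :=
  (extChartAt I x₀).target ∩ (extChartAt I x₀).symm ⁻¹' D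

/-- A field of covectors is a smooth differential form on `D` (up to the boundary of `D`) if it is
smooth in all charts. -/
def SmoothForm (D : Set M) (η : CovField 𝕜 V M) : Prop :=
  ∀ x₀ : M, ContDiffOn ℝ ∞ (chartRep 𝕜 I x₀ η) (chartSet I D x₀)

/-- The exterior derivative of a differential form on `D`: at the point `x` it is computed in the
chart at `x`. -/
def dForm (D : Set M) (η : CovField 𝕜 V M) : CovField 𝕜 V M := fun x =>
  covMap 𝕜 (mder I 𝓘(ℝ, V) (extChartAt I x) x)
    (extD 𝕜 (chartRep 𝕜 I x η) (chartSet I D x) (extChartAt I x x))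

/-- The subsets of `M` on which differential forms make sense (for instance open sets, or
domains with corners): tangent directions are determined by the set, and every point is a limit
of interior points. -/
structure RegularDomain (D : Set M) : Prop where
  unique : UniqueMDiffOn I D
  closure_interior : D ⊆ closure (interior D)

variable {𝕜 I J}

lemma mfderiv_symm_comp {x₀ m : M} (hm : m ∈ (extChartAt I x₀).source) :
    (mder 𝓘(ℝ, V) I (extChartAt I x₀).symm (extChartAt I x₀ m)) ∘L
      (mder I 𝓘(ℝ, V) (extChartAt I x₀) m) = ContinuousLinearMap.id ℝ V := by
  have : IsManifold I 1 M := IsManifold.of_le (n := ∞) (by norm_cast)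
  have h := mfderivWithin_extChartAt_symm_comp_mfderiv_extChartAt' hm
  rw [I.range_eq_univ, mfderivWithin_univ] at h
  exact h

lemma mdiff_symm {x₀ : M} {z : V} (hz : z ∈ (extChartAt I x₀).target) :
    MDifferentiableAt 𝓘(ℝ, V) I (extChartAt I x₀).symm z := by
  have : IsManifold I 1 M := IsManifold.of_le (n := ∞) (by norm_cast)
  have h := mdifferentiableWithinAt_extChartAt_symm hz
  rwa [I.range_eq_univ, mdifferentiableWithinAt_univ] at h

lemma mdiff_ext {x₀ m : M} (hm : m ∈ (extChartAt I x₀).source) :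
    MDifferentiableAt I 𝓘(ℝ, V) (extChartAt I x₀) m := by
  have : IsManifold I 1 M := IsManifold.of_le (n := ∞) (by norm_cast)
  exact mdifferentiableAt_extChartAt (by rwa [extChartAt_source] at hm)

/-- The expression of a map in charts. -/
def inCharts (I : ModelWithCorners ℝ V H) (J : ModelWithCorners ℝ W G) (g : M → N) (x₀ : M)
    (y₀ : N) : V → W :=
  fun z => extChartAt J y₀ (g ((extChartAt I x₀).symm z))

lemma chartRep_pull {g : M → N} {x₀ : M} {y₀ : N} {z : V}
    (hz : z ∈ (extChartAt I x₀).target)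
    (hy : g ((extChartAt I x₀).symm z) ∈ (extChartAt J y₀).source)
    (hg : MDifferentiableAt I J g ((extChartAt I x₀).symm z)) (η : CovField 𝕜 W N) :
    chartRep 𝕜 I x₀ (pullField 𝕜 I J g η) z =
      covMap 𝕜 (fderiv ℝ (inCharts I J g x₀ y₀) z)
        (chartRep 𝕜 J y₀ η (inCharts I J g x₀ y₀ z)) := by
  set m := (extChartAt I x₀).symm z with hm
  have h1 : (fderiv ℝ (inCharts I J g x₀ y₀) z : V →L[ℝ] W) =
      (mder J 𝓘(ℝ, W) (extChartAt J y₀) (g m)) ∘L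
        ((mder I J g m) ∘L
          (mder 𝓘(ℝ, V) I (extChartAt I x₀).symm z)) := by
    have h2 := ((mdiff_ext hy).hasMFDerivAt.comp m hg.hasMFDerivAt).comp z
      (mdiff_symm hz).hasMFDerivAt
    have h3 : HasFDerivAt (inCharts I J g x₀ y₀) ((mder J 𝓘(ℝ, W) (extChartAt J y₀) (g m)) ∘L
        ((mder I J g m) ∘L (mder 𝓘(ℝ, V) I (extChartAt I x₀).symm z))) z :=
      hasMFDerivAt_iff_hasFDerivAt.1 h2
    exact h3.fderiv
  rw [inCharts, ← hm, chartRep, chartRep, pullField, ← covMap_comp, ← covMap_comp, h1,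
    (extChartAt J y₀).left_inv hy, ← hm, ← ContinuousLinearMap.comp_assoc, mfderiv_symm_comp hy,
    ContinuousLinearMap.id_comp]

lemma contDiffAt_inCharts {g : M → N} {x₀ : M} {y₀ : N} {z : V}
    (hz : z ∈ (extChartAt I x₀).target)
    (hy : g ((extChartAt I x₀).symm z) ∈ (extChartAt J y₀).source)
    (hg : ContMDiffAt I J ∞ g ((extChartAt I x₀).symm z)) :
    ContDiffAt ℝ ∞ (inCharts I J g x₀ y₀) z := by
  rw [← contMDiffAt_iff_contDiffAt]
  have h1 : ContMDiffAt 𝓘(ℝ, V) I ∞ (extChartAt I x₀).symm z :=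
    (contMDiffOn_extChartAt_symm x₀).contMDiffAt ((isOpen_extChartAt_target x₀).mem_nhds hz)
  have h2 : ContMDiffAt J 𝓘(ℝ, W) ∞ (extChartAt J y₀) (g ((extChartAt I x₀).symm z)) :=
    contMDiffAt_extChartAt' (by rwa [extChartAt_source] at hy)
  exact h2.comp z (hg.comp z h1)

lemma pullField_id (η : CovField 𝕜 V M) : pullField 𝕜 I I (id : M → M) η = η := by
  funext x
  have : mder I I (id : M → M) x = ContinuousLinearMap.id ℝ V := mfderiv_id
  rw [pullField, this, covMap_id]; rfl

/-- The form can be recovered from its expression in a chart. -/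
lemma eq_of_chartRep {x₀ m : M} (hm : m ∈ (extChartAt I x₀).source) (η : CovField 𝕜 V M) :
    η m = covMap 𝕜 (mder I 𝓘(ℝ, V) (extChartAt I x₀) m)
      (chartRep 𝕜 I x₀ η (extChartAt I x₀ m)) := by
  rw [chartRep, ← covMap_comp, mfderiv_symm_comp hm, (extChartAt I x₀).left_inv hm, covMap_id]

lemma RegularDomain.chart {D : Set M} (hD : RegularDomain I D) (x₀ : M) :
    UniqueDiffOn ℝ (chartSet I D x₀) := by
  have : IsManifold I 1 M := IsManifold.of_le (n := ∞) (by norm_cast)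
  exact hD.unique.uniqueDiffOn_target_inter x₀

lemma RegularDomain.chart' {D : Set M} (hD : RegularDomain I D) {x₀ : M} {z : V}
    (hz : z ∈ chartSet I D x₀) : z ∈ closure (interior (chartSet I D x₀)) := by
  have hcont : ContinuousOn (extChartAt I x₀).symm (extChartAt I x₀).target :=
    continuousOn_extChartAt_symm x₀
  rw [mem_closure_iff]
  intro o ho hzo
  -- transport to the manifold
  have h1 : (extChartAt I x₀).source ∩ extChartAt I x₀ ⁻¹' o ∈ 𝓝 ((extChartAt I x₀).symm z) := by
    have hs := (extChartAt I x₀).map_target hz.1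
    refine Filter.inter_mem ((isOpen_extChartAt_source x₀).mem_nhds hs) ?_
    refine (continuousAt_extChartAt' hs).preimage_mem_nhds (ho.mem_nhds ?_)
    rwa [(extChartAt I x₀).right_inv hz.1]
  obtain ⟨m, hm, hmD⟩ := mem_closure_iff_nhds.1 (hD.closure_interior hz.2) _ h1
  refine ⟨extChartAt I x₀ m, hm.2, ?_⟩
  have h2 : (extChartAt I x₀).target ∩ (extChartAt I x₀).symm ⁻¹' (interior D) ⊆
      interior (chartSet I D x₀) :=
    interior_maximal (inter_subset_inter_right _ (preimage_mono interior_subset))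
      (hcont.isOpen_inter_preimage (isOpen_extChartAt_target x₀) isOpen_interior)
  exact h2 ⟨(extChartAt I x₀).map_source hm.1, by
    rw [mem_preimage, (extChartAt I x₀).left_inv hm.1]; exact hmD⟩

lemma mem_chartSet {D : Set M} {x₀ m : M} (hm : m ∈ (extChartAt I x₀).source) (hD : m ∈ D) :
    extChartAt I x₀ m ∈ chartSet I D x₀ :=
  ⟨(extChartAt I x₀).map_source hm, by rwa [mem_preimage, (extChartAt I x₀).left_inv hm]⟩

/-- Near a point, pulling back is done in charts. -/
lemma eventually_chart {g : M → N} {x₀ : M} {y₀ : N} {z : V} (hg : Continuous g)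
    (hz : z ∈ (extChartAt I x₀).target)
    (hy : g ((extChartAt I x₀).symm z) ∈ (extChartAt J y₀).source) :
    ∀ᶠ z' in 𝓝 z, z' ∈ (extChartAt I x₀).target ∧
      g ((extChartAt I x₀).symm z') ∈ (extChartAt J y₀).source := by
  have ht := (isOpen_extChartAt_target (I := I) x₀).mem_nhds hz
  have h1 : ContinuousAt (fun z' => g ((extChartAt I x₀).symm z')) z :=
    hg.continuousAt.comp ((continuousOn_extChartAt_symm x₀).continuousAt ht)
  exact Filter.Eventually.and ht
    (h1.preimage_mem_nhds ((isOpen_extChartAt_source y₀).mem_nhds hy))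

/-- The pull-back of a smooth form is smooth. -/
lemma SmoothForm.pull {g : M → N} (hg : ContMDiff I J ∞ g) {D : Set M} {D' : Set N}
    (hD : MapsTo g D D') {η : CovField 𝕜 W N} (hη : SmoothForm 𝕜 J D' η) :
    SmoothForm 𝕜 I D (pullField 𝕜 I J g η) := by
  intro x₀ z hz
  set n := g ((extChartAt I x₀).symm z) with hn
  have hy : n ∈ (extChartAt J n).source := mem_extChartAt_source n
  have hev := eventually_chart hg.continuous hz.1 hy
  have hgc := contDiffAt_inCharts hz.1 hy (hg _)
  have h1 : ContDiffWithinAt ℝ ∞ (chartRep 𝕜 J n η) (chartSet J D' n)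
      (inCharts I J g x₀ n z) := hη n _ (mem_chartSet hy (hD hz.2))
  have h2 : ContDiffWithinAt ℝ ∞ (fun z => covMap 𝕜 (fderiv ℝ (inCharts I J g x₀ n) z)
      (chartRep 𝕜 J n η (inCharts I J g x₀ n z))) (chartSet I D x₀) z := by
    refine contDiffWithinAt_covMap (hgc.fderiv_right (m := ∞) (by simp)).contDiffWithinAt ?_
    refine h1.comp_of_preimage_mem_nhdsWithin z hgc.contDiffWithinAt ?_
    filter_upwards [nhdsWithin_le_nhds hev, self_mem_nhdsWithin] with z' h3 h4
    exact mem_chartSet h3.2 (hD h4.2)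
  refine h2.congr_of_eventuallyEq (Filter.EventuallyEq.filter_mono ?_ nhdsWithin_le_nhds) ?_
  · filter_upwards [hev] with z' hz'
    exact chartRep_pull hz'.1 hz'.2 (hg.mdifferentiable (by simp) _) η
  · exact chartRep_pull hz.1 hy (hg.mdifferentiable (by simp) _) η

/-- The exterior derivative of a pull-back, in charts. -/
lemma extD_chartRep_pull {g : M → N} (hg : ContMDiff I J ∞ g) {D : Set M} {D' : Set N}
    (hr : RegularDomain I D)
    (hD : MapsTo g D D') {η : CovField 𝕜 W N} (hη : SmoothForm 𝕜 J D' η) {x₀ : M} {y₀ : N} {z : V}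
    (hz : z ∈ chartSet I D x₀)
    (hy : g ((extChartAt I x₀).symm z) ∈ (extChartAt J y₀).source) :
    extD 𝕜 (chartRep 𝕜 I x₀ (pullField 𝕜 I J g η)) (chartSet I D x₀) z =
      covMap 𝕜 (fderiv ℝ (inCharts I J g x₀ y₀) z)
        (extD 𝕜 (chartRep 𝕜 J y₀ η) (chartSet J D' y₀) (inCharts I J g x₀ y₀ z)) := by
  have hev := eventually_chart hg.continuous hz.1 hy
  have hgc := contDiffAt_inCharts hz.1 hy (hg _)
  have hm : inCharts I J g x₀ y₀ z ∈ chartSet J D' y₀ := mem_chartSet hy (hD hz.2)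
  rw [← extD_pullback hgc (hr.chart x₀ z hz) ?_
    ((hη y₀ _ hm).differentiableWithinAt (by simp))]
  · refine extD_congr Filter.EventuallyEq.rfl (Filter.EventuallyEq.filter_mono ?_ nhdsWithin_le_nhds) ?_
    · filter_upwards [hev] with z' hz'
      exact chartRep_pull hz'.1 hz'.2 (hg.mdifferentiable (by simp) _) η
    · exact chartRep_pull hz.1 hy (hg.mdifferentiable (by simp) _) η
  · filter_upwards [nhdsWithin_le_nhds hev, self_mem_nhdsWithin] with z' h1 h2
    exact mem_chartSet h1.2 (hD h2.2)

lemma chartRep_dForm {D : Set M} (hr : RegularDomain I D) {η : CovField 𝕜 V M}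
    (hη : SmoothForm 𝕜 I D η) {x₀ : M} {z : V} (hz : z ∈ chartSet I D x₀) :
    chartRep 𝕜 I x₀ (dForm 𝕜 I D η) z = extD 𝕜 (chartRep 𝕜 I x₀ η) (chartSet I D x₀) z := by
  set m := (extChartAt I x₀).symm z with hm
  have hs : m ∈ (extChartAt I m).source := mem_extChartAt_source m
  have h := extD_chartRep_pull (g := (id : M → M)) contMDiff_id hr (mapsTo_id D) hη
    (y₀ := m) hz hs
  rw [pullField_id] at h
  rw [h, chartRep, dForm, ← covMap_comp, ← hm]
  have h1 : (fderiv ℝ (inCharts I I id x₀ m) z : V →L[ℝ] V) =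
      (mder I 𝓘(ℝ, V) (extChartAt I m) m) ∘L
          (mder 𝓘(ℝ, V) I (extChartAt I x₀).symm z) := by
    have h2 := (mdiff_ext hs).hasMFDerivAt.comp z (mdiff_symm hz.1).hasMFDerivAt
    have h3 : HasFDerivAt (inCharts I I id x₀ m) ((mder I 𝓘(ℝ, V) (extChartAt I m) m) ∘L
          (mder 𝓘(ℝ, V) I (extChartAt I x₀).symm z)) z := hasMFDerivAt_iff_hasFDerivAt.1 h2
    exact h3.fderiv
  rw [h1]; rfl

lemma SmoothForm.d {D : Set M} (hr : RegularDomain I D) {η : CovField 𝕜 V M}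
    (hη : SmoothForm 𝕜 I D η) : SmoothForm 𝕜 I D (dForm 𝕜 I D η) := fun x₀ =>
  (contDiffOn_extD (hr.chart x₀) (hη x₀)).congr fun _ hz => chartRep_dForm hr hη hz

lemma dForm_pull {g : M → N} (hg : ContMDiff I J ∞ g) {D : Set M} {D' : Set N}
    (hr : RegularDomain I D) (hr' : RegularDomain J D')
    (hD : MapsTo g D D') {η : CovField 𝕜 W N} (hη : SmoothForm 𝕜 J D' η) {m : M} (hm : m ∈ D) :
    dForm 𝕜 I D (pullField 𝕜 I J g η) m = pullField 𝕜 I J g (dForm 𝕜 J D' η) m := by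
  have hs : m ∈ (extChartAt I m).source := mem_extChartAt_source m
  have hz := mem_chartSet hs hm
  have hl := (extChartAt I m).left_inv hs
  have hy : g ((extChartAt I m).symm (extChartAt I m m)) ∈ (extChartAt J (g m)).source := by
    rw [hl]; exact mem_extChartAt_source _
  have hm' : inCharts I J g m (g m) (extChartAt I m m) ∈ chartSet J D' (g m) :=
    mem_chartSet hy (hD hz.2)
  rw [eq_of_chartRep hs (pullField 𝕜 I J g (dForm 𝕜 J D' η)), dForm,
    extD_chartRep_pull hg hr hD hη hz hy,
    chartRep_pull hz.1 hy (hg.mdifferentiable (by simp) _), chartRep_dForm hr' hη hm']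

lemma dForm_dForm {D : Set M} (hr : RegularDomain I D) {η : CovField 𝕜 V M}
    (hη : SmoothForm 𝕜 I D η) {m : M} (hm : m ∈ D) :
    dForm 𝕜 I D (dForm 𝕜 I D η) m = 0 := by
  have hs : m ∈ (extChartAt I m).source := mem_extChartAt_source m
  have hz := mem_chartSet hs hm
  have h : extD 𝕜 (chartRep 𝕜 I m (dForm 𝕜 I D η)) (chartSet I D m) (extChartAt I m m) =
      extD 𝕜 (fun z => extD 𝕜 (chartRep 𝕜 I m η) (chartSet I D m) z) (chartSet I D m)
        (extChartAt I m m) := by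
    refine extD_congr Filter.EventuallyEq.rfl ?_ (chartRep_dForm hr hη hz)
    filter_upwards [self_mem_nhdsWithin] with z hz using chartRep_dForm hr hη hz
  rw [dForm, h, extD_extD (hr.chart m) hz (hr.chart' hz) (hη m _ hz), map_zero]

lemma chartRep_mul (x₀ : M) (η θ : CovField 𝕜 V M) :
    chartRep 𝕜 I x₀ (fun x => η x * θ x) =
      fun z => chartRep 𝕜 I x₀ η z * chartRep 𝕜 I x₀ θ z := by
  funext z; simp [chartRep]

lemma chartRep_add (x₀ : M) (η θ : CovField 𝕜 V M) :
    chartRep 𝕜 I x₀ (fun x => η x + θ x) =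
      fun z => chartRep 𝕜 I x₀ η z + chartRep 𝕜 I x₀ θ z := by
  funext z; simp [chartRep]

lemma SmoothForm.mul {D : Set M} {η θ : CovField 𝕜 V M} (hη : SmoothForm 𝕜 I D η)
    (hθ : SmoothForm 𝕜 I D θ) : SmoothForm 𝕜 I D (fun x => η x * θ x) := fun x₀ => by
  rw [chartRep_mul]
  exact fun z hz => contDiffWithinAt_mul (hη x₀ z hz) (hθ x₀ z hz)

lemma SmoothForm.add {D : Set M} {η θ : CovField 𝕜 V M} (hη : SmoothForm 𝕜 I D η)
    (hθ : SmoothForm 𝕜 I D θ) : SmoothForm 𝕜 I D (fun x => η x + θ x) := fun x₀ => by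
  rw [chartRep_add]
  exact fun z hz => (hη x₀ z hz).add (hθ x₀ z hz)

lemma SmoothForm.const {D : Set M} (r : 𝕜) :
    SmoothForm 𝕜 I D (fun _ : M => algebraMap 𝕜 (Cov 𝕜 V) r) := fun x₀ => by
  have : chartRep 𝕜 I x₀ (fun _ : M => algebraMap 𝕜 (Cov 𝕜 V) r) =
      fun _ => algebraMap 𝕜 (Cov 𝕜 V) r := by
    funext z; rw [chartRep, AlgHom.commutes]
  rw [this]; exact contDiffOn_const

lemma SmoothForm.mono {D D' : Set M} (h : D ⊆ D') {η : CovField 𝕜 V M}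
    (hη : SmoothForm 𝕜 I D' η) : SmoothForm 𝕜 I D η := fun x₀ =>
  (hη x₀).mono (inter_subset_inter_right _ (preimage_mono h))

lemma chartRep_congr_on {D : Set M} {η θ : CovField 𝕜 V M} (h : EqOn η θ D) (x₀ : M) :
    EqOn (chartRep 𝕜 I x₀ η) (chartRep 𝕜 I x₀ θ) (chartSet I D x₀) := fun z hz => by
  rw [chartRep, chartRep, h hz.2]

lemma SmoothForm.congr {D : Set M} {η θ : CovField 𝕜 V M} (h : EqOn η θ D)
    (hη : SmoothForm 𝕜 I D η) : SmoothForm 𝕜 I D θ := fun x₀ =>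
  (hη x₀).congr fun _ hz => (chartRep_congr_on h x₀ hz).symm

/-- Smoothness is a local property. -/
lemma SmoothForm.of_local {D : Set M} {η : CovField 𝕜 V M}
    (h : ∀ m ∈ D, ∃ O : Set M, IsOpen O ∧ m ∈ O ∧ SmoothForm 𝕜 I (O ∩ D) η) :
    SmoothForm 𝕜 I D η := fun x₀ z hz => by
  obtain ⟨O, hO, hm, hs⟩ := h _ hz.2
  refine (hs x₀ z ⟨hz.1, hm, hz.2⟩).mono_of_mem_nhdsWithin ?_
  have h1 : (extChartAt I x₀).symm ⁻¹' O ∈ 𝓝 z :=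
    ((continuousOn_extChartAt_symm x₀).continuousAt
      ((isOpen_extChartAt_target x₀).mem_nhds hz.1)).preimage_mem_nhds (hO.mem_nhds hm)
  filter_upwards [nhdsWithin_le_nhds h1, self_mem_nhdsWithin] with z' h1 h2
  exact ⟨h2.1, h1, h2.2⟩

/-- The exterior derivative is a local operation. -/
lemma dForm_local {D D' O : Set M} {η θ : CovField 𝕜 V M} (hO : IsOpen O) {m : M} (hm : m ∈ O)
    (hmD : m ∈ D) (hD : D ∩ O = D' ∩ O) (h : EqOn η θ (D ∩ O)) :
    dForm 𝕜 I D η m = dForm 𝕜 I D' θ m := by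
  have hs : m ∈ (extChartAt I m).source := mem_extChartAt_source m
  have hz := mem_chartSet hs hmD
  have h1 : (extChartAt I m).symm ⁻¹' O ∈ 𝓝 (extChartAt I m m) :=
    ((continuousOn_extChartAt_symm m).continuousAt
      ((isOpen_extChartAt_target m).mem_nhds hz.1)).preimage_mem_nhds
      (by rw [(extChartAt I m).left_inv hs]; exact hO.mem_nhds hm)
  rw [dForm, dForm]
  congr 1
  have hev : chartSet I D m =ᶠ[𝓝 (extChartAt I m m)] chartSet I D' m := by
    filter_upwards [h1] with z hz
    have := Set.ext_iff.1 hD ((extChartAt I m).symm z)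
    simp only [mem_inter_iff, mem_preimage.1 hz, and_true] at this
    exact propext (and_congr_right fun _ => this)
  refine extD_congr hev ?_ ?_
  · filter_upwards [nhdsWithin_le_nhds h1, self_mem_nhdsWithin] with z h2 h3
    refine chartRep_congr_on h m ⟨h3.1, ?_, h2⟩
    have := Set.ext_iff.1 hD ((extChartAt I m).symm z)
    exact (this.2 ⟨h3.2, h2⟩).1
  · exact chartRep_congr_on h m (mem_chartSet hs ⟨hmD, hm⟩)

lemma dForm_add {D : Set M} (hr : RegularDomain I D) {η θ : CovField 𝕜 V M}
    (hη : SmoothForm 𝕜 I D η) (hθ : SmoothForm 𝕜 I D θ) {m : M} (hm : m ∈ D) :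
    dForm 𝕜 I D (fun x => η x + θ x) m = dForm 𝕜 I D η m + dForm 𝕜 I D θ m := by
  have hz := mem_chartSet (mem_extChartAt_source (I := I) m) hm
  rw [dForm, chartRep_add, extD_add (hr.chart m _ hz)
    ((hη m _ hz).differentiableWithinAt (by simp)) ((hθ m _ hz).differentiableWithinAt (by simp)),
    map_add]
  rfl

lemma dForm_mul {D : Set M} (hr : RegularDomain I D) {η θ : CovField 𝕜 V M}
    (hη : SmoothForm 𝕜 I D η) (hθ : SmoothForm 𝕜 I D θ) {m : M} (hm : m ∈ D) {k : ℕ}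
    (hk : η m ∈ ⋀[𝕜]^k (V →ₗ[ℝ] 𝕜)) :
    dForm 𝕜 I D (fun x => η x * θ x) m =
      dForm 𝕜 I D η m * θ m + (-1) ^ k * (η m * dForm 𝕜 I D θ m) := by
  have hs := mem_extChartAt_source (I := I) m
  have hz := mem_chartSet hs hm
  have h1 : chartRep 𝕜 I m η (extChartAt I m m) ∈ ⋀[𝕜]^k (V →ₗ[ℝ] 𝕜) := by
    rw [chartRep, (extChartAt I m).left_inv hs]; exact covMap_mem _ hk
  rw [dForm, chartRep_mul, extD_mul (hr.chart m _ hz)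
    ((hη m _ hz).differentiableWithinAt (by simp)) ((hθ m _ hz).differentiableWithinAt (by simp)),
    involute_mem h1, map_add, map_mul, map_mul, map_mul, map_pow, map_neg, map_one,
    ← eq_of_chartRep hs, ← eq_of_chartRep hs, mul_assoc]
  rfl

lemma dForm_const {D : Set M} (r : 𝕜) (m : M) :
    dForm 𝕜 I D (fun _ => algebraMap 𝕜 (Cov 𝕜 V) r) m = 0 := by
  have : chartRep 𝕜 I m (fun _ : M => algebraMap 𝕜 (Cov 𝕜 V) r) =
      fun _ => algebraMap 𝕜 (Cov 𝕜 V) r := by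
    funext z; rw [chartRep, AlgHom.commutes]
  rw [dForm, this, extD_const, map_zero]

end Manifold

section Algebra

universe u

/-- A differential graded algebra over `𝕜` (in degrees `≥ 0`): a graded algebra with a differential
of degree one satisfying the graded Leibniz rule. -/
structure DGAlg (𝕜 : Type) [Field 𝕜] where
  carrier : Type u
  [ring : Ring carrier]
  [algebra : Algebra 𝕜 carrier]
  deg : ℕ → Submodule 𝕜 carrier
  gradedMonoid : SetLike.GradedMonoid deg
  isInternal : DirectSum.IsInternal deg
  d : carrier →ₗ[𝕜] carrier
  d_mem : ∀ {k : ℕ} {a : carrier}, a ∈ deg k → d a ∈ deg (k + 1)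
  d_d : ∀ a, d (d a) = 0
  d_mul : ∀ {k : ℕ} {a : carrier}, a ∈ deg k → ∀ b, d (a * b) = d a * b + (-1) ^ k * (a * d b)

attribute [instance] DGAlg.ring DGAlg.algebra

variable {𝕜 : Type} [Field 𝕜]

/-- A morphism of differential graded algebras. -/
@[ext]
structure DGAlg.Hom (A B : DGAlg.{u} 𝕜) where
  toAlgHom : A.carrier →ₐ[𝕜] B.carrier
  map_deg : ∀ {k : ℕ} {a : A.carrier}, a ∈ A.deg k → toAlgHom a ∈ B.deg k
  map_d : ∀ a, toAlgHom (A.d a) = B.d (toAlgHom a)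

instance : Category (DGAlg.{u} 𝕜) where
  Hom := DGAlg.Hom
  id A := ⟨AlgHom.id 𝕜 A.carrier, fun h => h, fun _ => rfl⟩
  comp f g := ⟨g.toAlgHom.comp f.toAlgHom, fun h => g.map_deg (f.map_deg h), fun a => by
    simp [f.map_d, g.map_d]⟩

lemma DGAlg.hom_ext {A B : DGAlg.{u} 𝕜} {f g : A ⟶ B}
    (h : ∀ a, f.toAlgHom a = g.toAlgHom a) : f = g :=
  DGAlg.Hom.ext (AlgHom.ext h)

variable (𝕜)

/-- The functor sending a differential graded algebra to its component of degree `k`. -/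
def degFunctor (k : ℕ) : DGAlg.{u} 𝕜 ⥤ ModuleCat.{u} 𝕜 where
  obj A := ModuleCat.of 𝕜 (A.deg k)
  map f := ModuleCat.ofHom (f.toAlgHom.toLinearMap.restrict fun _ h => f.map_deg h)

/-- The differential, as a natural transformation between the components of two consecutive
degrees. -/
def degD (k : ℕ) : degFunctor 𝕜 k ⟶ degFunctor.{u} 𝕜 (k + 1) where
  app A := ModuleCat.ofHom (A.d.restrict fun _ h => A.d_mem h)
  naturality A B f := by
    ext a
    exact Subtype.ext (f.map_d a.1).symm

lemma degD_degD (k : ℕ) : degD.{u} 𝕜 k ≫ degD 𝕜 (k + 1) = 0 := by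
  ext A a
  exact Subtype.ext (A.d_d _)

instance preservesFilteredColimitsForgetModule :
    Limits.PreservesFilteredColimits (forget (ModuleCat.{u} 𝕜)) := by
  have : Limits.PreservesFilteredColimitsOfSize.{u, u}
    (forget₂ (ModuleCat.{u} 𝕜) AddCommGrpCat.{u}) := ⟨fun _ _ _ => inferInstance⟩
  exact (inferInstance : Limits.PreservesFilteredColimitsOfSize.{u, u}
    (forget₂ (ModuleCat.{u} 𝕜) AddCommGrpCat.{u} ⋙ forget AddCommGrpCat.{u}))

variable (X : Type u) [TopologicalSpace X]

/-- A presheaf of differential graded algebras is a sheaf if its components of all degrees are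
sheaves. -/
def IsDGSheaf : ObjectProperty ((Opens (TopCat.of X))ᵒᵖ ⥤ DGAlg.{u} 𝕜) := fun F =>
  ∀ k, TopCat.Presheaf.IsSheaf (F ⋙ degFunctor 𝕜 k)

/-- The category of sheaves of differential graded algebras over `𝕜` on `X`. -/
abbrev ShDGA : Type (u + 1) := (IsDGSheaf 𝕜 X).FullSubcategory

variable {𝕜 X}

/-- The sheaf of vector spaces of elements of degree `k`. -/
def ShDGA.degSheaf (F : ShDGA 𝕜 X) (k : ℕ) :
    TopCat.Sheaf (ModuleCat.{u} 𝕜) (TopCat.of X) :=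
  ⟨F.obj ⋙ degFunctor 𝕜 k, F.property k⟩

/-- The differential between two consecutive degrees. -/
def ShDGA.degSheafD (F : ShDGA 𝕜 X) (k : ℕ) : F.degSheaf k ⟶ F.degSheaf (k + 1) :=
  ObjectProperty.homMk (Functor.whiskerLeft F.obj (degD 𝕜 k))

/-- The component of degree `k` of a morphism. -/
def ShDGA.degSheafMap {F F' : ShDGA 𝕜 X} (f : F ⟶ F') (k : ℕ) : F.degSheaf k ⟶ F'.degSheaf k :=
  ObjectProperty.homMk (Functor.whiskerRight f.hom (degFunctor 𝕜 k))

lemma ShDGA.degSheafD_comp (F : ShDGA 𝕜 X) (k : ℕ) :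
    F.degSheafD k ≫ F.degSheafD (k + 1) = 0 := by
  refine Sheaf.hom_ext ?_
  exact (Functor.whiskerLeft_comp _ _ _).symm.trans (by rw [degD_degD]; rfl)

lemma ShDGA.degSheafMap_comm {F F' : ShDGA 𝕜 X} (f : F ⟶ F') (k : ℕ) :
    degSheafMap f k ≫ F'.degSheafD k = F.degSheafD k ≫ degSheafMap f (k + 1) := by
  refine Sheaf.hom_ext ?_
  ext U a
  exact Subtype.ext ((f.hom.app U).map_d _).symm

variable (𝕜 X)

/-- The complex of sheaves of vector spaces underlying a sheaf of differential graded algebras. -/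
def ShDGA.toComplex : ShDGA 𝕜 X ⥤
    CochainComplex (TopCat.Sheaf (ModuleCat.{u} 𝕜) (TopCat.of X)) ℕ where
  obj F := CochainComplex.of F.degSheaf F.degSheafD F.degSheafD_comp
  map {F F'} f := CochainComplex.ofHom (degSheafMap f) (fun k => by
      dsimp only
      rw [CochainComplex.of_d, CochainComplex.of_d]
      exact degSheafMap_comm f k)
  map_id F := by
    ext k
    rfl
  map_comp f g := by
    ext k
    rfl

/-- The cohomology sheaf of degree `k` of a sheaf of differential graded algebras. -/
def ShDGA.cohomology (k : ℕ) : ShDGA 𝕜 X ⥤ TopCat.Sheaf (ModuleCat.{u} 𝕜) (TopCat.of X) :=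
  ShDGA.toComplex 𝕜 X ⋙ HomologicalComplex.homologyFunctor _ _ k

variable {𝕜 X}

/-- A morphism of sheaves of differential graded algebras is a quasi-isomorphism if it induces
isomorphisms of cohomology sheaves. -/
def ShDGA.IsQuasiIso {F F' : ShDGA 𝕜 X} (f : F ⟶ F') : Prop :=
  QuasiIso ((ShDGA.toComplex 𝕜 X).map f)

end Algebra

section Poles

universe u

variable (𝕜 : Type) [RCLike 𝕜]
variable {V : Type} [NormedAddCommGroup V] [NormedSpace ℝ V] [FiniteDimensional ℝ V]
  {H : Type} [TopologicalSpace H] {I : ModelWithCorners ℝ V H} [I.Boundaryless]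
  {M : Type u} [TopologicalSpace M] [ChartedSpace H M] [IsManifold I ∞ M]
variable {W : Type} [NormedAddCommGroup W] [NormedSpace ℝ W] [FiniteDimensional ℝ W]
  {G : Type} [TopologicalSpace G] {J : ModelWithCorners ℝ W G} [J.Boundaryless]
  {N : Type u} [TopologicalSpace N] [ChartedSpace G N] [IsManifold J ∞ N]
variable {V₃ : Type} [NormedAddCommGroup V₃] [NormedSpace ℝ V₃] [FiniteDimensional ℝ V₃]
  {G₃ : Type} [TopologicalSpace G₃] {I₃ : ModelWithCorners ℝ V₃ G₃} [I₃.Boundaryless]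
  {M₃ : Type u} [TopologicalSpace M₃] [ChartedSpace G₃ M₃] [IsManifold I₃ ∞ M₃]
variable {X : Type u} [TopologicalSpace X] {Y : Set X}

/-- The data from which a sheaf of differential forms with poles is built: a regular domain `S` in
a manifold `M`, a continuous map `proj : M → X`, a closed subset `Y` of `X` and a smooth function
`μ` on `M`. The forms live on `S`, are singular along `S ∩ proj ⁻¹' Y`, and are pushed forward to
`X` along `proj`. -/
structure PoleDatum (I : ModelWithCorners ℝ V H) (M : Type u) [TopologicalSpace M]
    [ChartedSpace H M] (Y : Set X) where
  S : Set M
  proj : M → X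
  μ : M → ℝ
  regular : RegularDomain I S
  continuous_proj : Continuous proj
  smooth_μ : ContMDiff I 𝓘(ℝ, ℝ) ∞ μ
  closed : IsClosed Y

/-- The part of `S` over `U ∖ Y`. -/
def PoleDatum.offY (P : PoleDatum I M Y) (U : Set X) : Set M :=
  {m | m ∈ P.S ∧ P.proj m ∈ U ∧ P.proj m ∉ Y}

/-- `η` is a smooth form on the part of `S` over `U ∖ Y` and, locally on the part of `S` over `U`,
some `μ ^ N • η` extends to a smooth form. -/
def PoleDatum.HasPoles (P : PoleDatum I M Y) (U : Set X) (η : CovField 𝕜 V M) : Prop :=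
  SmoothForm 𝕜 I (P.offY U) η ∧
    ∀ m ∈ P.S, P.proj m ∈ U → ∃ (n : ℕ) (O : Set M) (θ : CovField 𝕜 V M), IsOpen O ∧ m ∈ O ∧
      SmoothForm 𝕜 I (O ∩ P.S) θ ∧ ∀ m' ∈ O ∩ P.offY U, θ m' = (P.μ m') ^ n • η m'

/-- Extension by zero of a field of covectors defined on `D` only. -/
def zeroExt {D : Set M} (η : D → Cov 𝕜 V) : CovField 𝕜 V M :=
  Function.extend Subtype.val η 0

variable {𝕜}

lemma zeroExt_apply {D : Set M} (η : D → Cov 𝕜 V) {m : M} (hm : m ∈ D) :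
    zeroExt 𝕜 η m = η ⟨m, hm⟩ :=
  Subtype.val_injective.extend_apply η 0 ⟨m, hm⟩

lemma zeroExt_eqOn {D : Set M} (η : CovField 𝕜 V M) :
    EqOn η (zeroExt 𝕜 (fun m : D => η m)) D := fun _ hm =>
  (zeroExt_apply (fun m : D => η m) hm).symm

lemma PoleDatum.HasPoles.congr {P : PoleDatum I M Y} {U : Set X} {η θ : CovField 𝕜 V M}
    (hη : P.HasPoles 𝕜 U η) (h : EqOn η θ (P.offY U)) : P.HasPoles 𝕜 U θ := by
  refine ⟨hη.1.congr h, fun m hm hU => ?_⟩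
  obtain ⟨n, O, θ', hO, hmO, hs, he⟩ := hη.2 m hm hU
  exact ⟨n, O, θ', hO, hmO, hs, fun m' hm' => by rw [he m' hm', h hm'.2]⟩

/-- A smooth function, as a form of degree zero. -/
def zeroForm (𝕜 : Type) [RCLike 𝕜] (V : Type) [NormedAddCommGroup V] [NormedSpace ℝ V]
    (f : M → ℝ) : CovField 𝕜 V M := fun m => algebraMap 𝕜 (Cov 𝕜 V) (f m : 𝕜)

lemma zeroForm_mul (f : M → ℝ) (m : M) (w : Cov 𝕜 V) : zeroForm 𝕜 V f m * w = f m • w := by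
  rw [zeroForm, ← Algebra.smul_def]
  exact algebraMap_smul 𝕜 (f m) w

lemma smoothForm_zeroForm {f : M → ℝ} (hf : ContMDiff I 𝓘(ℝ, ℝ) ∞ f) (D : Set M) :
    SmoothForm 𝕜 I D (zeroForm 𝕜 V f) := fun x₀ => by
  have h1 : chartRep 𝕜 I x₀ (zeroForm 𝕜 V f) = fun z =>
      (((Algebra.linearMap 𝕜 (Cov 𝕜 V)).restrictScalars ℝ) ∘ₗ (Algebra.linearMap ℝ 𝕜))
        (f ((extChartAt I x₀).symm z)) := by
    funext z; rw [chartRep, zeroForm, AlgHom.commutes]; rfl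
  rw [h1]
  refine ((LinearMap.toContinuousLinearMap
    (((Algebra.linearMap 𝕜 (Cov 𝕜 V)).restrictScalars ℝ) ∘ₗ
      (Algebra.linearMap ℝ 𝕜))).contDiff.comp_contDiffOn ?_).mono inter_subset_left
  exact contMDiffOn_iff_contDiffOn.1
    (hf.comp_contMDiffOn (contMDiffOn_extChartAt_symm x₀))

lemma SmoothForm.smul_fun {f : M → ℝ} (hf : ContMDiff I 𝓘(ℝ, ℝ) ∞ f) {D : Set M}
    {η : CovField 𝕜 V M} (hη : SmoothForm 𝕜 I D η) : SmoothForm 𝕜 I D (fun m => f m • η m) := by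
  refine SmoothForm.congr (fun m _ => zeroForm_mul f m (η m)) ((smoothForm_zeroForm hf D).mul hη)

lemma zeroForm_mem (f : M → ℝ) (m : M) : zeroForm 𝕜 V f m ∈ ⋀[𝕜]^0 (V →ₗ[ℝ] 𝕜) :=
  SetLike.GradedMonoid.toGradedOne.one_mem |> fun h => by
    rw [zeroForm, Algebra.algebraMap_eq_smul_one]
    exact Submodule.smul_mem _ _ h

/-- The Leibniz rule for functions. -/
lemma dForm_zeroForm_mul {f : M → ℝ} (hf : ContMDiff I 𝓘(ℝ, ℝ) ∞ f) {D : Set M}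
    (hr : RegularDomain I D) {η : CovField 𝕜 V M} (hη : SmoothForm 𝕜 I D η) {m : M} (hm : m ∈ D) :
    dForm 𝕜 I D (fun x => f x • η x) m =
      dForm 𝕜 I D (zeroForm 𝕜 V f) m * η m + f m • dForm 𝕜 I D η m := by
  have h := dForm_mul hr (smoothForm_zeroForm hf D) hη hm (zeroForm_mem f m)
  simp only [zeroForm_mul, pow_zero, one_mul] at h
  exact h

lemma dForm_zeroForm_pow {f : M → ℝ} (hf : ContMDiff I 𝓘(ℝ, ℝ) ∞ f) {D : Set M}
    (hr : RegularDomain I D) {η : CovField 𝕜 V M} (hη : SmoothForm 𝕜 I D η) {m : M} (hm : m ∈ D)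
    (n : ℕ) :
    f m • dForm 𝕜 I D (fun x => f x ^ n • η x) m =
      (n : ℝ) • (dForm 𝕜 I D (zeroForm 𝕜 V f) m * (f m ^ n • η m)) +
        f m ^ (n + 1) • dForm 𝕜 I D η m := by
  induction n with
  | zero => simp
  | succ n ih =>
    have h0 : SmoothForm 𝕜 I D (fun x => f x ^ n • η x) := hη.smul_fun (hf.pow n)
    have h1 := dForm_zeroForm_mul hf hr h0 hm
    simp only [smul_smul, ← pow_succ'] at h1
    rw [h1, smul_add, ih, pow_succ' (f m) n, mul_smul (f m) (f m ^ n) (η m), mul_smul_comm (f m)]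
    rw [pow_succ' (f m) (n + 1), mul_smul (f m) (f m ^ (n + 1))]
    push_cast
    module

lemma RegularDomain.inter_open {D O : Set M} (hD : RegularDomain I D) (hO : IsOpen O) :
    RegularDomain I (O ∩ D) where
  unique := by rw [inter_comm]; exact hD.unique.inter hO
  closure_interior := by
    rintro m ⟨hmO, hmD⟩
    rw [interior_inter, hO.interior_eq]
    exact hO.inter_closure ⟨hmO, hD.closure_interior hmD⟩

lemma PoleDatum.offY_eq (P : PoleDatum I M Y) (U : Set X) :
    P.offY U = P.proj ⁻¹' (U \ Y) ∩ P.S := by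
  ext m; simp [PoleDatum.offY]; tauto

lemma PoleDatum.isOpen_pre (P : PoleDatum I M Y) {U : Set X} (hU : IsOpen U) :
    IsOpen (P.proj ⁻¹' (U \ Y)) := (hU.sdiff P.closed).preimage P.continuous_proj

lemma PoleDatum.regular_offY (P : PoleDatum I M Y) {U : Set X} (hU : IsOpen U) :
    RegularDomain I (P.offY U) := by
  rw [P.offY_eq]; exact P.regular.inter_open (P.isOpen_pre hU)

lemma PoleDatum.HasPoles.mul {P : PoleDatum I M Y} {U : Set X} {η θ : CovField 𝕜 V M}
    (hη : P.HasPoles 𝕜 U η) (hθ : P.HasPoles 𝕜 U θ) :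
    P.HasPoles 𝕜 U (fun m => η m * θ m) := by
  refine ⟨hη.1.mul hθ.1, fun m hm hU => ?_⟩
  obtain ⟨n, O, η', hO, hmO, hs, he⟩ := hη.2 m hm hU
  obtain ⟨n', O', θ', hO', hmO', hs', he'⟩ := hθ.2 m hm hU
  refine ⟨n + n', O ∩ O', fun m => η' m * θ' m, hO.inter hO', ⟨hmO, hmO'⟩,
    (hs.mono ?_).mul (hs'.mono ?_), fun m' hm' => ?_⟩
  · exact inter_subset_inter_left _ inter_subset_left
  · exact inter_subset_inter_left _ inter_subset_right
  · beta_reduce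
    rw [he m' ⟨hm'.1.1, hm'.2⟩, he' m' ⟨hm'.1.2, hm'.2⟩, smul_mul_smul_comm, pow_add]

lemma PoleDatum.HasPoles.add {P : PoleDatum I M Y} {U : Set X} {η θ : CovField 𝕜 V M}
    (hη : P.HasPoles 𝕜 U η) (hθ : P.HasPoles 𝕜 U θ) :
    P.HasPoles 𝕜 U (fun m => η m + θ m) := by
  refine ⟨hη.1.add hθ.1, fun m hm hU => ?_⟩
  obtain ⟨n, O, η', hO, hmO, hs, he⟩ := hη.2 m hm hU
  obtain ⟨n', O', θ', hO', hmO', hs', he'⟩ := hθ.2 m hm hU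
  refine ⟨n + n', O ∩ O', fun m => P.μ m ^ n' • η' m + P.μ m ^ n • θ' m, hO.inter hO',
    ⟨hmO, hmO'⟩, ((hs.mono ?_).smul_fun (P.smooth_μ.pow n')).add
      ((hs'.mono ?_).smul_fun (P.smooth_μ.pow n)), fun m' hm' => ?_⟩
  · exact inter_subset_inter_left _ inter_subset_left
  · exact inter_subset_inter_left _ inter_subset_right
  · beta_reduce
    rw [he m' ⟨hm'.1.1, hm'.2⟩, he' m' ⟨hm'.1.2, hm'.2⟩, smul_smul, smul_smul, smul_add,
      pow_add, mul_comm (P.μ m' ^ n')]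

lemma PoleDatum.HasPoles.const (P : PoleDatum I M Y) (U : Set X) (r : 𝕜) :
    P.HasPoles 𝕜 U (fun _ => algebraMap 𝕜 (Cov 𝕜 V) r) :=
  ⟨SmoothForm.const r, fun _ _ _ => ⟨0, univ, fun _ => algebraMap 𝕜 (Cov 𝕜 V) r, isOpen_univ,
    mem_univ _, SmoothForm.const r, fun _ _ => by simp⟩⟩

lemma PoleDatum.HasPoles.d {P : PoleDatum I M Y} {U : Set X} (hUo : IsOpen U)
    {η : CovField 𝕜 V M} (hη : P.HasPoles 𝕜 U η) :
    P.HasPoles 𝕜 U (dForm 𝕜 I (P.offY U) η) := by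
  refine ⟨hη.1.d (P.regular_offY hUo), fun m hm hU => ?_⟩
  obtain ⟨n, O, θ, hO, hmO, hs, he⟩ := hη.2 m hm hU
  have hrS := P.regular.inter_open hO
  refine ⟨n + 1, O, fun x => P.μ x • dForm 𝕜 I (O ∩ P.S) θ x +
    (algebraMap 𝕜 (Cov 𝕜 V) (-(n : 𝕜))) * (dForm 𝕜 I (O ∩ P.S) (zeroForm 𝕜 V P.μ) x * θ x),
    hO, hmO, ?_, fun x hx => ?_⟩
  · exact ((hs.d hrS).smul_fun P.smooth_μ).add ((SmoothForm.const _).mul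
      (((smoothForm_zeroForm P.smooth_μ _).d hrS).mul hs))
  · have hxS : x ∈ O ∩ P.S := ⟨hx.1, hx.2.1⟩
    have hopen : IsOpen (O ∩ P.proj ⁻¹' (U \ Y)) := hO.inter (P.isOpen_pre hUo)
    have hxo : x ∈ O ∩ P.proj ⁻¹' (U \ Y) := ⟨hx.1, hx.2.2⟩
    have hset : O ∩ P.S ∩ (O ∩ P.proj ⁻¹' (U \ Y)) =
        P.offY U ∩ (O ∩ P.proj ⁻¹' (U \ Y)) := by
      rw [P.offY_eq]; ext y; simp only [mem_inter_iff]; tauto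
    have h1 : dForm 𝕜 I (O ∩ P.S) θ x =
        dForm 𝕜 I (P.offY U) (fun y => P.μ y ^ n • η y) x := by
      refine dForm_local hopen hxo hxS hset fun y hy => ?_
      rw [hset] at hy
      exact he y ⟨hy.2.1, hy.1⟩
    have h2 : dForm 𝕜 I (O ∩ P.S) (zeroForm 𝕜 V P.μ) x =
        dForm 𝕜 I (P.offY U) (zeroForm 𝕜 V P.μ) x :=
      dForm_local hopen hxo hxS hset fun y _ => rfl
    beta_reduce
    rw [h1, h2, dForm_zeroForm_pow P.smooth_μ (P.regular_offY hUo) hη.1 hx.2 n, he x hx,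
      map_neg, map_natCast, Nat.cast_smul_eq_nsmul, nsmul_eq_mul, neg_mul]
    abel

lemma PoleDatum.HasPoles.mono {P : PoleDatum I M Y} {U U' : Set X} (h : U' ⊆ U)
    {η : CovField 𝕜 V M} (hη : P.HasPoles 𝕜 U η) : P.HasPoles 𝕜 U' η := by
  have hs : P.offY U' ⊆ P.offY U := fun m hm => ⟨hm.1, h hm.2.1, hm.2.2⟩
  refine ⟨hη.1.mono hs, fun m hm hU => ?_⟩
  obtain ⟨n, O, θ, hO, hmO, hs', he⟩ := hη.2 m hm (h hU)
  exact ⟨n, O, θ, hO, hmO, hs', fun m' hm' => he m' ⟨hm'.1, hs hm'.2⟩⟩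

/-- Having poles is a local property. -/
lemma PoleDatum.HasPoles.of_local {P : PoleDatum I M Y} {U : Set X} {η : CovField 𝕜 V M}
    (h : ∀ x ∈ U, ∃ O : Set X, IsOpen O ∧ x ∈ O ∧ O ⊆ U ∧ P.HasPoles 𝕜 O η) :
    P.HasPoles 𝕜 U η := by
  refine ⟨SmoothForm.of_local fun m hm => ?_, fun m hm hU => ?_⟩
  · obtain ⟨O, hO, hx, _, hP⟩ := h _ hm.2.1
    refine ⟨P.proj ⁻¹' O, hO.preimage P.continuous_proj, hx, hP.1.mono ?_⟩
    rintro m' ⟨h1, h2⟩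
    exact ⟨h2.1, h1, h2.2.2⟩
  · obtain ⟨O, hO, hx, _, hP⟩ := h _ hU
    obtain ⟨n, O', θ, hO', hmO, hs', he⟩ := hP.2 m hm hx
    refine ⟨n, O' ∩ P.proj ⁻¹' O, θ, hO'.inter (hO.preimage P.continuous_proj), ⟨hmO, hx⟩,
      hs'.mono (inter_subset_inter_left _ inter_subset_left), fun m' hm' => ?_⟩
    exact he m' ⟨hm'.1.1, hm'.2.1, hm'.1.2, hm'.2.2.2⟩

/-- A smooth map between two data, over `X` and compatible with the functions `μ`. -/
structure PoleDatum.Hom (P : PoleDatum I M Y) (Q : PoleDatum J N Y) where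
  toFun : M → N
  smooth : ContMDiff I J ∞ toFun
  mapsTo : MapsTo toFun P.S Q.S
  proj_comp : ∀ m, Q.proj (toFun m) = P.proj m
  μ_comp : ∀ m, Q.μ (toFun m) = P.μ m

lemma PoleDatum.Hom.mem_offY {P : PoleDatum I M Y} {Q : PoleDatum J N Y} (g : P.Hom Q)
    {U : Set X} {m : M} (hm : m ∈ P.offY U) : g.toFun m ∈ Q.offY U :=
  ⟨g.mapsTo hm.1, by rw [g.proj_comp]; exact hm.2⟩

lemma PoleDatum.HasPoles.pull {P : PoleDatum I M Y} {Q : PoleDatum J N Y} (g : P.Hom Q)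
    {U : Set X} {η : CovField 𝕜 W N} (hη : Q.HasPoles 𝕜 U η) :
    P.HasPoles 𝕜 U (pullField 𝕜 I J g.toFun η) := by
  refine ⟨hη.1.pull g.smooth fun m hm => g.mem_offY hm, fun m hm hU => ?_⟩
  obtain ⟨n, O, θ, hO, hmO, hs, he⟩ := hη.2 (g.toFun m) (g.mapsTo hm) (by rwa [g.proj_comp])
  refine ⟨n, g.toFun ⁻¹' O, pullField 𝕜 I J g.toFun θ, hO.preimage g.smooth.continuous, hmO,
    hs.pull g.smooth (fun m hm => (⟨hm.1, g.mapsTo hm.2⟩ : g.toFun m ∈ O ∩ Q.S)),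
    fun m' hm' => ?_⟩
  rw [pullField, he _ ⟨hm'.1, g.mem_offY hm'.2⟩, pullField, ← g.μ_comp]
  exact ((covMap 𝕜 (mder I J g.toFun m')).toLinearMap.restrictScalars ℝ).map_smul _ _

end Poles

section Sections

universe u

variable (𝕜 : Type) [RCLike 𝕜]
variable {V : Type} [NormedAddCommGroup V] [NormedSpace ℝ V] [FiniteDimensional ℝ V]
  {H : Type} [TopologicalSpace H] {I : ModelWithCorners ℝ V H} [I.Boundaryless]
  {M : Type u} [TopologicalSpace M] [ChartedSpace H M] [IsManifold I ∞ M]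
variable {W : Type} [NormedAddCommGroup W] [NormedSpace ℝ W] [FiniteDimensional ℝ W]
  {G : Type} [TopologicalSpace G] {J : ModelWithCorners ℝ W G} [J.Boundaryless]
  {N : Type u} [TopologicalSpace N] [ChartedSpace G N] [IsManifold J ∞ N]
variable {V₃ : Type} [NormedAddCommGroup V₃] [NormedSpace ℝ V₃] [FiniteDimensional ℝ V₃]
  {G₃ : Type} [TopologicalSpace G₃] {I₃ : ModelWithCorners ℝ V₃ G₃} [I₃.Boundaryless]
  {M₃ : Type u} [TopologicalSpace M₃] [ChartedSpace G₃ M₃] [IsManifold I₃ ∞ M₃]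
variable {X : Type u} [TopologicalSpace X] {Y : Set X}

variable (V) in
/-- The projection to the component of degree `k`. -/
def degProj (k : ℕ) : Cov 𝕜 V →ₗ[𝕜] Cov 𝕜 V :=
  GradedAlgebra.proj (fun i : ℕ => ⋀[𝕜]^i (V →ₗ[ℝ] 𝕜)) k

variable {𝕜}

lemma degProj_mem (k : ℕ) (w : Cov 𝕜 V) : degProj 𝕜 V k w ∈ ⋀[𝕜]^k (V →ₗ[ℝ] 𝕜) := by
  rw [degProj, GradedAlgebra.proj_apply]; exact SetLike.coe_mem _

lemma degProj_same {k : ℕ} {w : Cov 𝕜 V} (hw : w ∈ ⋀[𝕜]^k (V →ₗ[ℝ] 𝕜)) :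
    degProj 𝕜 V k w = w := by
  rw [degProj, GradedAlgebra.proj_apply]; exact DirectSum.decompose_of_mem_same _ hw

lemma degProj_ne {k l : ℕ} {w : Cov 𝕜 V} (hw : w ∈ ⋀[𝕜]^k (V →ₗ[ℝ] 𝕜)) (h : k ≠ l) :
    degProj 𝕜 V l w = 0 := by
  rw [degProj, GradedAlgebra.proj_apply]; exact DirectSum.decompose_of_mem_ne _ hw h

lemma degProj_covMap (A : V →L[ℝ] W) (k : ℕ) (w : Cov 𝕜 W) :
    degProj 𝕜 V k (covMap 𝕜 A w) = covMap 𝕜 A (degProj 𝕜 W k w) := by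
  induction w using DirectSum.Decomposition.inductionOn
    (fun i : ℕ => ⋀[𝕜]^i (W →ₗ[ℝ] 𝕜)) with
  | zero => simp
  | @homogeneous i w =>
    by_cases h : i = k
    · subst h
      rw [degProj_same w.2, degProj_same (covMap_mem A w.2)]
    · rw [degProj_ne w.2 h, degProj_ne (covMap_mem A w.2) h, map_zero]
  | add a b ha hb => simp only [map_add, ha, hb]

variable (𝕜 V) in
lemma exists_degProj_sum : ∃ F : Finset ℕ, ∀ w : Cov 𝕜 V, ∑ k ∈ F, degProj 𝕜 V k w = w := by
  have hfin : {k : ℕ | (⋀[𝕜]^k (V →ₗ[ℝ] 𝕜)) ≠ ⊥}.Finite :=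
    WellFoundedGT.finite_ne_bot_of_iSupIndep
      (DirectSum.Decomposition.isInternal (fun i : ℕ => ⋀[𝕜]^i (V →ₗ[ℝ] 𝕜))).submodule_iSupIndep
  refine ⟨hfin.toFinset, fun w => ?_⟩
  induction w using DirectSum.Decomposition.inductionOn
    (fun i : ℕ => ⋀[𝕜]^i (V →ₗ[ℝ] 𝕜)) with
  | zero => simp
  | @homogeneous i w =>
    by_cases hw : w = 0
    · simp [hw]
    · rw [Finset.sum_eq_single i]
      · exact degProj_same w.2
      · exact fun k _ hk => degProj_ne w.2 hk.symm
      · intro hi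
        refine absurd (Subtype.ext ?_) hw
        have h1 : (⋀[𝕜]^i (V →ₗ[ℝ] 𝕜)) = ⊥ := by simpa using hi
        exact (Submodule.mem_bot 𝕜).1 (h1.le w.2)
  | add a b ha hb => simp only [map_add, Finset.sum_add_distrib, ha, hb]

lemma SmoothForm.degProj {D : Set M} {η : CovField 𝕜 V M} (hη : SmoothForm 𝕜 I D η) (k : ℕ) :
    SmoothForm 𝕜 I D (fun m => degProj 𝕜 V k (η m)) := fun x₀ => by
  have : chartRep 𝕜 I x₀ (fun m => MorseBottForms.degProj 𝕜 V k (η m)) =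
      fun z => ((MorseBottForms.degProj 𝕜 V k).restrictScalars ℝ) (chartRep 𝕜 I x₀ η z) := by
    funext z; exact (degProj_covMap _ _ _).symm
  rw [this]
  exact (LinearMap.toContinuousLinearMap
    ((MorseBottForms.degProj 𝕜 V k).restrictScalars ℝ)).contDiff.comp_contDiffOn (hη x₀)

lemma PoleDatum.HasPoles.degProj {P : PoleDatum I M Y} {U : Set X} {η : CovField 𝕜 V M}
    (hη : P.HasPoles 𝕜 U η) (k : ℕ) : P.HasPoles 𝕜 U (fun m => degProj 𝕜 V k (η m)) := by
  refine ⟨hη.1.degProj k, fun m hm hU => ?_⟩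
  obtain ⟨n, O, θ, hO, hmO, hs, he⟩ := hη.2 m hm hU
  refine ⟨n, O, _, hO, hmO, hs.degProj k, fun m' hm' => ?_⟩
  beta_reduce
  rw [he m' hm']
  exact ((MorseBottForms.degProj 𝕜 V k).restrictScalars ℝ).map_smul _ _

lemma dForm_mem {D : Set M} (hr : RegularDomain I D) {η : CovField 𝕜 V M}
    (hη : SmoothForm 𝕜 I D η) {k : ℕ} (hk : ∀ m ∈ D, η m ∈ ⋀[𝕜]^k (V →ₗ[ℝ] 𝕜)) {m : M}
    (hm : m ∈ D) : dForm 𝕜 I D η m ∈ ⋀[𝕜]^(k + 1) (V →ₗ[ℝ] 𝕜) := by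
  have hz := mem_chartSet (mem_extChartAt_source (I := I) m) hm
  refine covMap_mem _ ?_
  rw [extD, wedgeUp]
  refine Submodule.sum_mem _ fun i _ => ?_
  rw [add_comm]
  refine SetLike.GradedMul.mul_mem (A := fun i : ℕ => ⋀[𝕜]^i (V →ₗ[ℝ] 𝕜)) (covOne_mem _) ?_
  set f := chartRep 𝕜 I m η
  set z := extChartAt I m m
  have h1 : ∀ y ∈ chartSet I D m, f y = ((degProj 𝕜 V k).restrictScalars ℝ) (f y) := fun y hy =>
    (degProj_same (covMap_mem _ (hk _ hy.2))).symm
  have h2 : fderivWithin ℝ f (chartSet I D m) z =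
      fderivWithin ℝ (fun y => ((degProj 𝕜 V k).restrictScalars ℝ) (f y)) (chartSet I D m) z :=
    fderivWithin_congr h1 (h1 z hz)
  rw [h2, ContinuousLinearMap.coe_coe, fderivWithin_lin _ (hr.chart m z hz)
    ((hη m z hz).differentiableWithinAt (by simp))]
  exact degProj_mem _ _

lemma dForm_congr {D : Set M} {η θ : CovField 𝕜 V M} (h : EqOn η θ D) {m : M} (hm : m ∈ D) :
    dForm 𝕜 I D η m = dForm 𝕜 I D θ m :=
  dForm_local isOpen_univ (mem_univ m) hm rfl (h.mono inter_subset_left)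

variable (𝕜) in
/-- The algebra of forms with poles over `U`. -/
def PoleDatum.sections (P : PoleDatum I M Y) (U : Set X) :
    Subalgebra 𝕜 (P.offY U → Cov 𝕜 V) where
  carrier := {s | P.HasPoles 𝕜 U (zeroExt 𝕜 s)}
  mul_mem' {a b} ha hb := (ha.mul hb).congr fun m hm => by
    simp only [zeroExt_apply _ hm]; rfl
  add_mem' {a b} ha hb := (ha.add hb).congr fun m hm => by
    simp only [zeroExt_apply _ hm]; rfl
  algebraMap_mem' r := (HasPoles.const P U r).congr fun m hm => by
    simp only [zeroExt_apply _ hm]; rfl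

lemma PoleDatum.mem_sections {P : PoleDatum I M Y} {U : Set X} {η : CovField 𝕜 V M}
    (hη : P.HasPoles 𝕜 U η) : (fun m : P.offY U => η m) ∈ P.sections 𝕜 U :=
  hη.congr (zeroExt_eqOn η)

variable (𝕜) in
/-- The forms of degree `k`. -/
def PoleDatum.sectionsDeg (P : PoleDatum I M Y) (U : Set X) (k : ℕ) :
    Submodule 𝕜 (P.sections 𝕜 U) where
  carrier := {s | ∀ m, s.1 m ∈ ⋀[𝕜]^k (V →ₗ[ℝ] 𝕜)}
  add_mem' ha hb m := Submodule.add_mem _ (ha m) (hb m)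
  zero_mem' _ := Submodule.zero_mem _
  smul_mem' r _ ha m := Submodule.smul_mem _ r (ha m)

lemma PoleDatum.sectionsDeg_graded (P : PoleDatum I M Y) (U : Set X) :
    SetLike.GradedMonoid (P.sectionsDeg 𝕜 U) where
  one_mem _ := SetLike.GradedOne.one_mem (A := fun i : ℕ => ⋀[𝕜]^i (V →ₗ[ℝ] 𝕜))
  mul_mem _ _ _ _ ha hb m :=
    SetLike.GradedMul.mul_mem (A := fun i : ℕ => ⋀[𝕜]^i (V →ₗ[ℝ] 𝕜)) (ha m) (hb m)

lemma isInternal_of_proj {A : Type u} [Ring A] [Algebra 𝕜 A] (deg : ℕ → Submodule 𝕜 A)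
    (p : ℕ → A →ₗ[𝕜] A) (hmem : ∀ k a, p k a ∈ deg k) (hsame : ∀ k, ∀ a ∈ deg k, p k a = a)
    (hne : ∀ k l, k ≠ l → ∀ a ∈ deg k, p l a = 0) (F : Finset ℕ)
    (hsum : ∀ a, ∑ k ∈ F, p k a = a) : DirectSum.IsInternal deg := by
  have key : ∀ (x : DirectSum ℕ fun k => deg k) (k : ℕ),
      p k (DirectSum.coeAddMonoidHom deg x) = (x k : A) := by
    intro x k
    induction x using DirectSum.induction_on with
    | zero => simp
    | of i y =>
      rw [DirectSum.coeAddMonoidHom_of]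
      by_cases h : i = k
      · subst h
        rw [DirectSum.of_eq_same]
        exact hsame _ _ y.2
      · rw [DirectSum.of_eq_of_ne _ _ _ (Ne.symm h)]
        exact hne _ _ h _ y.2
    | add x y hx hy =>
      rw [map_add, map_add, DirectSum.add_apply, hx, hy]; rfl
  constructor
  · intro x y hxy
    refine DFinsupp.ext fun k => Subtype.ext ?_
    rw [← key, ← key, hxy]
  · intro s
    refine ⟨∑ k ∈ F, DirectSum.of (fun k => deg k) k ⟨p k s, hmem k s⟩, ?_⟩
    rw [map_sum]
    simp only [DirectSum.coeAddMonoidHom_of]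
    exact hsum s

lemma PoleDatum.sectionsDeg_isInternal (P : PoleDatum I M Y) (U : Set X) :
    DirectSum.IsInternal (P.sectionsDeg 𝕜 U) := by
  obtain ⟨F, hF⟩ := exists_degProj_sum 𝕜 V
  have hs : ∀ k, ∀ s ∈ P.sections 𝕜 U, (fun m => degProj 𝕜 V k (s m)) ∈ P.sections 𝕜 U :=
    fun k s hs => (HasPoles.degProj hs k).congr fun m hm => by simp only [zeroExt_apply _ hm]
  let p : ℕ → P.sections 𝕜 U →ₗ[𝕜] P.sections 𝕜 U := fun k =>
    { toFun := fun s => ⟨_, hs k s.1 s.2⟩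
      map_add' := fun s t => Subtype.ext (funext fun m => map_add (degProj 𝕜 V k) _ _)
      map_smul' := fun r s => Subtype.ext (funext fun m => map_smul (degProj 𝕜 V k) _ _) }
  refine isInternal_of_proj (P.sectionsDeg 𝕜 U) p (fun k s m => degProj_mem k _)
    (fun k s hs => Subtype.ext (funext fun m => degProj_same (hs m)))
    (fun k l h s hs => Subtype.ext (funext fun m => degProj_ne (hs m) h)) F fun s => ?_
  refine Subtype.ext (funext fun m => ?_)
  rw [AddSubmonoidClass.coe_finsetSum, Finset.sum_apply]
  exact hF _

variable (𝕜) in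
/-- The exterior derivative of forms with poles. -/
def PoleDatum.sectionsD (P : PoleDatum I M Y) (U : Opens X) :
    P.sections 𝕜 (U : Set X) →ₗ[𝕜] P.sections 𝕜 (U : Set X) where
  toFun s := ⟨fun m => dForm 𝕜 I (P.offY U) (zeroExt 𝕜 s.1) m, mem_sections (s.2.d U.2)⟩
  map_add' s t := Subtype.ext (funext fun m => by
    refine Eq.trans ?_ (dForm_add (P.regular_offY U.2) s.2.1 t.2.1 m.2)
    exact dForm_congr (fun m hm => by simp only [zeroExt_apply _ hm]; rfl) m.2)
  map_smul' r s := Subtype.ext (funext fun m => by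
    have h := dForm_mul (k := 0) (P.regular_offY U.2) (SmoothForm.const r) s.2.1 m.2
      (SetLike.algebraMap_mem_graded (fun i : ℕ => ⋀[𝕜]^i (V →ₗ[ℝ] 𝕜)) r)
    rw [dForm_const, zero_mul, zero_add, pow_zero, one_mul, ← Algebra.smul_def] at h
    refine Eq.trans ?_ h
    exact dForm_congr (fun m hm => by
      simp only [zeroExt_apply _ hm]; exact Algebra.smul_def r (s.1 ⟨m, hm⟩)) m.2)

lemma PoleDatum.zeroExt_sectionsD (P : PoleDatum I M Y) (U : Opens X)
    (s : P.sections 𝕜 (U : Set X)) :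
    EqOn (zeroExt 𝕜 (P.sectionsD 𝕜 U s).1) (dForm 𝕜 I (P.offY U) (zeroExt 𝕜 s.1)) (P.offY U) :=
  fun _ hm => zeroExt_apply _ hm

variable (𝕜) in
/-- The differential graded algebra of forms with poles over `U`. -/
def PoleDatum.dga (P : PoleDatum I M Y) (U : Opens X) : DGAlg.{u} 𝕜 where
  carrier := P.sections 𝕜 (U : Set X)
  deg := P.sectionsDeg 𝕜 U
  gradedMonoid := P.sectionsDeg_graded U
  isInternal := P.sectionsDeg_isInternal U
  d := P.sectionsD 𝕜 U
  d_mem {k a} ha m := dForm_mem (P.regular_offY U.2) a.2.1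
    (fun m hm => by rw [zeroExt_apply _ hm]; exact ha _) m.2
  d_d a := Subtype.ext (funext fun m =>
    (dForm_congr (P.zeroExt_sectionsD U a) m.2).trans
      (dForm_dForm (P.regular_offY U.2) a.2.1 m.2))
  d_mul {k a} ha b := Subtype.ext (funext fun m => by
    have h := dForm_mul (k := k) (P.regular_offY U.2) a.2.1 b.2.1 m.2
      (by rw [zeroExt_apply _ m.2]; exact ha _)
    rw [zeroExt_apply _ m.2, zeroExt_apply _ m.2] at h
    refine Eq.trans ?_ h
    exact dForm_congr (fun m hm => by simp only [zeroExt_apply _ hm]; rfl) m.2)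

/-- The pull-back of forms with poles, over `U`. -/
def PoleDatum.Hom.pullAlg {P : PoleDatum I M Y} {Q : PoleDatum J N Y} (g : P.Hom Q)
    {U U' : Set X} (h : U' ⊆ U) : Q.sections 𝕜 U →ₐ[𝕜] P.sections 𝕜 U' where
  toFun s := ⟨fun m => covMap 𝕜 (mder I J g.toFun m.1)
      (s.1 ⟨g.toFun m, g.mem_offY ⟨m.2.1, h m.2.2.1, m.2.2.2⟩⟩),
    ((s.2.pull g).mono h).congr fun m hm => by
      have hm' : g.toFun m ∈ Q.offY U := g.mem_offY ⟨hm.1, h hm.2.1, hm.2.2⟩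
      rw [zeroExt_apply _ hm, pullField, zeroExt_apply _ hm']⟩
  map_one' := Subtype.ext (funext fun m => map_one (covMap 𝕜 (mder I J g.toFun m.1)))
  map_zero' := Subtype.ext (funext fun m => map_zero (covMap 𝕜 (mder I J g.toFun m.1)))
  map_mul' _ _ := Subtype.ext (funext fun m => map_mul (covMap 𝕜 (mder I J g.toFun m.1)) _ _)
  map_add' _ _ := Subtype.ext (funext fun m => map_add (covMap 𝕜 (mder I J g.toFun m.1)) _ _)
  commutes' r := Subtype.ext (funext fun m => (covMap 𝕜 (mder I J g.toFun m.1)).commutes r)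

/-- The pull-back along a morphism of pole data, combined with the restriction to a smaller open
set, as a morphism of differential graded algebras. -/
def PoleDatum.Hom.pullDGA {P : PoleDatum I M Y} {Q : PoleDatum J N Y} (g : P.Hom Q)
    {U U' : Opens X} (h : U' ≤ U) : Q.dga 𝕜 U ⟶ P.dga 𝕜 U' :=
  DGAlg.Hom.mk (A := Q.dga 𝕜 U) (B := P.dga 𝕜 U') (g.pullAlg h)
    (fun ha m => covMap_mem _ (ha _))
    (fun a => Subtype.ext (funext fun m => by
      have hm' : m.1 ∈ P.offY U := ⟨m.2.1, h m.2.2.1, m.2.2.2⟩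
      have h1 := dForm_pull (𝕜 := 𝕜) (m := m.1) g.smooth (P.regular_offY U.2) (Q.regular_offY U.2)
        (fun m hm => g.mem_offY hm) (SetLike.coe_mem a : a.1 ∈ Q.sections 𝕜 U).1 hm'
      refine Eq.trans h1.symm ?_
      refine dForm_local (U'.2.preimage P.continuous_proj) m.2.2.1 hm' ?_ ?_
      · ext x
        constructor
        · rintro ⟨hx, hx'⟩; exact ⟨⟨hx.1, hx', hx.2.2⟩, hx'⟩
        · rintro ⟨hx, hx'⟩; exact ⟨⟨hx.1, h hx', hx.2.2⟩, hx'⟩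
      · rintro x ⟨hx, hx'⟩
        have hxm : x ∈ P.offY U' := ⟨hx.1, hx', hx.2.2⟩
        rw [zeroExt_apply _ hxm, pullField, zeroExt_apply _ (g.mem_offY hx)]
        rfl))

/-- The identity. -/
def PoleDatum.Hom.id (P : PoleDatum I M Y) : P.Hom P :=
  ⟨_root_.id, contMDiff_id, mapsTo_id _, fun _ => rfl, fun _ => rfl⟩

/-- The composition. -/
def PoleDatum.Hom.comp {P : PoleDatum I M Y} {Q : PoleDatum J N Y} {R : PoleDatum I₃ M₃ Y}
    (g' : Q.Hom R) (g : P.Hom Q) : P.Hom R :=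
  ⟨g'.toFun ∘ g.toFun, g'.smooth.comp g.smooth, g'.mapsTo.comp g.mapsTo,
    fun m => (g'.proj_comp _).trans (g.proj_comp m), fun m => (g'.μ_comp _).trans (g.μ_comp m)⟩

lemma PoleDatum.Hom.pullDGA_id (P : PoleDatum I M Y) (U : Opens X) :
    (Hom.id P).pullDGA (𝕜 := 𝕜) (le_refl U) = 𝟙 (P.dga 𝕜 U) :=
  DGAlg.hom_ext fun s => Subtype.ext (funext fun m => by
    have : mder I I (_root_.id : M → M) m.1 = ContinuousLinearMap.id ℝ V := mfderiv_id
    refine Eq.trans ?_ (covMap_id _)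
    exact congrArg (fun A => covMap 𝕜 A _) this)

lemma PoleDatum.Hom.pullDGA_comp {P : PoleDatum I M Y} {Q : PoleDatum J N Y}
    {R : PoleDatum I₃ M₃ Y} (g' : Q.Hom R) (g : P.Hom Q) {U U' U'' : Opens X} (h' : U' ≤ U)
    (h : U'' ≤ U') : (g'.comp g).pullDGA (𝕜 := 𝕜) (h.trans h') =
      g'.pullDGA h' ≫ g.pullDGA h :=
  DGAlg.hom_ext fun s => Subtype.ext (funext fun m => by
    have : mder I I₃ (g'.toFun ∘ g.toFun) m.1 =
        (mder J I₃ g'.toFun (g.toFun m.1)) ∘L (mder I J g.toFun m.1) :=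
      mfderiv_comp m.1 (g'.smooth.mdifferentiable (by simp) _)
        (g.smooth.mdifferentiable (by simp) _)
    refine Eq.trans ?_ (covMap_comp _ _ _)
    exact congrArg (fun A => covMap 𝕜 A _) this)

lemma PoleDatum.Hom.pullDGA_congr {P : PoleDatum I M Y} {Q : PoleDatum J N Y} {g g' : P.Hom Q}
    (h : g.toFun = g'.toFun) {U U' : Opens X} (hU : U' ≤ U) :
    g.pullDGA (𝕜 := 𝕜) hU = g'.pullDGA hU := by
  cases g; cases g'; cases h; rfl

variable (𝕜) in
/-- The presheaf of differential graded algebras of forms with poles. -/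
def PoleDatum.presheaf (P : PoleDatum I M Y) : (Opens (TopCat.of X))ᵒᵖ ⥤ DGAlg.{u} 𝕜 where
  obj U := P.dga 𝕜 U.unop
  map f := (Hom.id P).pullDGA (leOfHom f.unop)
  map_id U := Hom.pullDGA_id P U.unop
  map_comp _ _ := Hom.pullDGA_comp (Hom.id P) (Hom.id P) _ _

lemma PoleDatum.presheaf_map_apply (P : PoleDatum I M Y) {U U' : (Opens (TopCat.of X))ᵒᵖ}
    (f : U ⟶ U') (s : P.sections 𝕜 (U.unop : Set X)) (m : P.offY (U'.unop : Set X)) :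
    (((P.presheaf 𝕜).map f).toAlgHom s).1 m =
      s.1 ⟨m.1, m.2.1, leOfHom f.unop m.2.2.1, m.2.2.2⟩ := by
  have : mder I I (_root_.id : M → M) m.1 = ContinuousLinearMap.id ℝ V := mfderiv_id
  refine Eq.trans ?_ (covMap_id _)
  exact congrArg (fun A => covMap 𝕜 A _) this

lemma PoleDatum.isDGSheaf (P : PoleDatum I M Y) : IsDGSheaf 𝕜 X (P.presheaf 𝕜) := by
  intro k
  rw [TopCat.Presheaf.isSheaf_iff_isSheaf_comp' (forget (ModuleCat.{u} 𝕜)),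
    TopCat.Presheaf.isSheaf_iff_isSheafUniqueGluing_types]
  intro ι U sf hsf
  have hU : ∀ i, (U i : Set X) ⊆ (iSup U : Opens X) := fun i => le_iSup U i
  have hex : ∀ m ∈ P.offY (iSup U : Opens X), ∃ i, m ∈ P.offY (U i : Set X) := fun m hm => by
    obtain ⟨i, hi⟩ := Opens.mem_iSup.1 hm.2.1
    exact ⟨i, hm.1, hi, hm.2.2⟩
  let s : ∀ i, P.offY (U i : Set X) → Cov 𝕜 V := fun i => (sf i).1.1
  have hs : ∀ i, P.HasPoles 𝕜 (U i) (zeroExt 𝕜 (s i)) := fun i => (sf i).1.2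
  have hcomp : ∀ i j m (hi : m ∈ P.offY (U i : Set X)) (hj : m ∈ P.offY (U j : Set X)),
      s i ⟨m, hi⟩ = s j ⟨m, hj⟩ := fun i j m hi hj => by
    have h := hsf i j
    have hm : m ∈ P.offY (U i ⊓ U j : Opens X) := ⟨hi.1, ⟨hi.2.1, hj.2.1⟩, hi.2.2⟩
    have h1 := congrFun (congrArg (fun t => t.1.1) h) ⟨m, hm⟩
    refine Eq.trans ?_ (h1.trans ?_)
    · exact (P.presheaf_map_apply (Opens.infLELeft (U i) (U j)).op (sf i).1 ⟨m, hm⟩).symm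
    · exact P.presheaf_map_apply (Opens.infLERight (U i) (U j)).op (sf j).1 ⟨m, hm⟩
  choose c hc using hex
  let t : P.offY (iSup U : Opens X) → Cov 𝕜 V := fun m => s (c m.1 m.2) ⟨m.1, hc m.1 m.2⟩
  have ht : t ∈ P.sections 𝕜 (iSup U : Opens X) := by
    refine HasPoles.of_local fun x hx => ?_
    obtain ⟨i, hi⟩ := Opens.mem_iSup.1 hx
    refine ⟨U i, (U i).2, hi, hU i, (hs i).congr fun m hm => ?_⟩
    have hm' : m ∈ P.offY (iSup U : Opens X) := ⟨hm.1, hU i hm.2.1, hm.2.2⟩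
    rw [zeroExt_apply _ hm, zeroExt_apply _ hm']
    exact hcomp _ _ _ _ _
  refine ⟨⟨⟨t, ht⟩, fun m => (sf (c m.1 m.2)).2 _⟩, fun i => ?_, fun t' ht' => ?_⟩
  · refine Subtype.ext (Subtype.ext (funext fun m => ?_))
    refine (P.presheaf_map_apply (Opens.leSupr U i).op ⟨t, ht⟩ m).trans ?_
    exact hcomp _ _ _ _ _
  · refine Subtype.ext (Subtype.ext (funext fun m => ?_))
    have h1 := congrFun (congrArg (fun t => t.1.1) (ht' (c m.1 m.2))) ⟨m.1, hc m.1 m.2⟩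
    exact (P.presheaf_map_apply (Opens.leSupr U (c m.1 m.2)).op t'.1 ⟨m.1, hc m.1 m.2⟩).symm.trans h1

variable (𝕜) in
/-- The sheaf of differential graded algebras of forms with poles, pushed forward to `X`. -/
def PoleDatum.sheaf (P : PoleDatum I M Y) : ShDGA 𝕜 X := ⟨P.presheaf 𝕜, P.isDGSheaf⟩

/-- The pull-back of forms with poles, as a morphism of sheaves. -/
def PoleDatum.Hom.sheafMap {P : PoleDatum I M Y} {Q : PoleDatum J N Y} (g : P.Hom Q) :
    Q.sheaf 𝕜 ⟶ P.sheaf 𝕜 :=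
  ObjectProperty.homMk
    { app := fun U => g.pullDGA (le_refl U.unop)
      naturality := fun _ _ f =>
        (Hom.pullDGA_comp (Hom.id Q) g (leOfHom f.unop) (le_refl _)).symm.trans
          (Hom.pullDGA_comp g (Hom.id P) (le_refl _) (leOfHom f.unop)) }

lemma PoleDatum.Hom.sheafMap_id (P : PoleDatum I M Y) :
    (Hom.id P).sheafMap (𝕜 := 𝕜) = 𝟙 (P.sheaf 𝕜) := by
  ext U : 3
  exact Hom.pullDGA_id P U.unop

lemma PoleDatum.Hom.sheafMap_comp {P : PoleDatum I M Y} {Q : PoleDatum J N Y}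
    {R : PoleDatum I₃ M₃ Y} (g' : Q.Hom R) (g : P.Hom Q) :
    (g'.comp g).sheafMap (𝕜 := 𝕜) = g'.sheafMap ≫ g.sheafMap := by
  ext U : 3
  exact Hom.pullDGA_comp g' g (le_refl _) (le_refl _)

lemma PoleDatum.Hom.sheafMap_congr {P : PoleDatum I M Y} {Q : PoleDatum J N Y} {g g' : P.Hom Q}
    (h : g.toFun = g'.toFun) : g.sheafMap (𝕜 := 𝕜) = g'.sheafMap := by
  cases g; cases g'; cases h; rfl

end Sections

section MorseBott

universe u

variable (n m : ℕ) {X : Type u} [TopologicalSpace X] [ChartedSpace (EuclideanSpace ℝ (Fin n)) X]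
  [IsManifold (𝓡 n) ∞ X]

/-- `Y` is a closed submanifold of codimension `m` of the `n`-dimensional manifold `X`: near each
of its points it is given by the vanishing of the first `m` coordinates of some smooth chart. -/
structure IsClosedSubmanifold (Y : Set X) : Prop where
  isClosed : IsClosed Y
  codim_le : m ≤ n
  slice : ∀ y ∈ Y, ∃ φ ∈ IsManifold.maximalAtlas (𝓡 n) ∞ X, y ∈ φ.source ∧
    ∀ x ∈ φ.source, x ∈ Y ↔ ∀ i : Fin n, (i : ℕ) < m → φ x i = 0

/-- The Hessian of `f : X → ℝ` at `y`, in the preferred chart at `y`. If `y` is a critical point of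
`f` this is the intrinsic Hessian, a bilinear form on the tangent space at `y`. -/
def hessianAt (f : X → ℝ) (y : X) :
    EuclideanSpace ℝ (Fin n) →L[ℝ] EuclideanSpace ℝ (Fin n) →L[ℝ] ℝ :=
  fderiv ℝ (fderiv ℝ (f ∘ (extChartAt (𝓡 n) y).symm)) (extChartAt (𝓡 n) y y)

/-- The set of nonnegative Morse–Bott functions with zero set `Y`, a closed submanifold of
codimension `m`: the nonnegative smooth functions which vanish exactly on `Y` and whose Hessian
has rank `m` at the points of `Y`. -/
def morseBott (Y : Set X) : Set (X → ℝ) :=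
  {μ | ContMDiff (𝓡 n) 𝓘(ℝ, ℝ) ∞ μ ∧ (∀ x, 0 ≤ μ x) ∧ (∀ x, μ x = 0 ↔ x ∈ Y) ∧
    ∀ y ∈ Y, Module.finrank ℝ (LinearMap.range (hessianAt n μ y).toLinearMap) = m}

/-- An affine map from the geometric simplex of dimension `p` to the convex set of nonnegative
Morse–Bott functions. -/
@[ext]
structure AffineSimplex (Y : Set X) (p : ℕ) where
  toFun : stdSimplex ℝ (Fin (p + 1)) → X → ℝ
  mem : ∀ t, toFun t ∈ morseBott n m Y
  affine : ∀ (s t r : stdSimplex ℝ (Fin (p + 1))) (a b : ℝ), 0 ≤ a → 0 ≤ b → a + b = 1 →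
    (r : Fin (p + 1) → ℝ) = a • (s : Fin (p + 1) → ℝ) + b • (t : Fin (p + 1) → ℝ) →
    toFun r = a • toFun s + b • toFun t

variable {n m}

/-- The vertices of an affine simplex. -/
def AffineSimplex.vertex {Y : Set X} {p : ℕ} (σ : AffineSimplex n m Y p) (i : Fin (p + 1)) :
    morseBott n m Y := ⟨σ.toFun (stdSimplex.vertex i), σ.mem _⟩

/-- The composition of an affine simplex with the map of geometric simplices given by a map of
the vertices. -/
def AffineSimplex.reindex {Y : Set X} {p q : ℕ} (σ : AffineSimplex n m Y p)
    (θ : Fin (q + 1) → Fin (p + 1)) : AffineSimplex n m Y q where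
  toFun t := σ.toFun (stdSimplex.map θ t)
  mem t := σ.mem _
  affine s t r a b ha hb hab h := σ.affine _ _ _ a b ha hb hab (by
    simp only [stdSimplex.map_coe, h, map_add, map_smul])

lemma AffineSimplex.vertex_reindex {Y : Set X} {p q : ℕ} (σ : AffineSimplex n m Y p)
    (θ : Fin (q + 1) → Fin (p + 1)) (j : Fin (q + 1)) :
    (σ.reindex θ).vertex j = σ.vertex (θ j) :=
  Subtype.ext (congrArg σ.toFun (stdSimplex.map_vertex θ j))

lemma AffineSimplex.reindex_id {Y : Set X} {p : ℕ} (σ : AffineSimplex n m Y p) :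
    σ.reindex id = σ :=
  AffineSimplex.ext (funext fun t => congrArg σ.toFun (stdSimplex.map_id_apply t))

lemma AffineSimplex.reindex_reindex {Y : Set X} {p q r : ℕ} (σ : AffineSimplex n m Y p)
    (θ : Fin (q + 1) → Fin (p + 1)) (θ' : Fin (r + 1) → Fin (q + 1)) :
    σ.reindex (θ ∘ θ') = (σ.reindex θ).reindex θ' :=
  AffineSimplex.ext (funext fun t => congrArg σ.toFun (stdSimplex.map_comp_apply θ' θ t).symm)

variable (n m) in
/-- The affine singular simplicial set of the convex set of nonnegative Morse–Bott functions. -/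
def affineSing (Y : Set X) : SSet.{u} where
  obj k := AffineSimplex n m Y k.unop.len
  map θ := TypeCat.ofHom fun σ => σ.reindex θ.unop.toOrderHom
  map_id k := by
    ext σ : 3
    exact AffineSimplex.reindex_id σ
  map_comp θ θ' := by
    ext σ : 3
    exact AffineSimplex.reindex_reindex σ θ.unop.toOrderHom θ'.unop.toOrderHom

variable (n m) in
/-- The category of simplices of the affine singular set of the convex set of nonnegative
Morse–Bott functions: the objects are the affine simplices, the morphisms from `σ` to `τ` are the
compositions of face and degeneracy maps (that is, the simplicial operators) sending `σ`
to `τ`. -/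
abbrev SimplexCat (Y : Set X) : Type u := (affineSing n m Y).Elements

/-- The affine simplex that is an object of the category of simplices. -/
def SimplexCat.simplex {Y : Set X} (σ : SimplexCat n m Y) : AffineSimplex n m Y σ.1.unop.len := σ.2

/-- The map of vertices belonging to a morphism in the category of simplices. -/
def SimplexCat.onVertices {Y : Set X} {σ τ : SimplexCat n m Y} (f : σ ⟶ τ) :
    Fin (τ.1.unop.len + 1) → Fin (σ.1.unop.len + 1) := f.1.unop.toOrderHom

lemma SimplexCat.simplex_eq {Y : Set X} {σ τ : SimplexCat n m Y} (f : σ ⟶ τ) :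
    τ.simplex = σ.simplex.reindex (SimplexCat.onVertices f) := f.2.symm

end MorseBott

section Simplex

/-- Barycentric coordinates on the affine space `ℝ ^ p`. -/
def bary {p : ℕ} (s : Fin p → ℝ) : Fin (p + 1) → ℝ := Fin.cons (1 - ∑ i, s i) s

lemma sum_bary {p : ℕ} (s : Fin p → ℝ) : ∑ i, bary s i = 1 := by
  simp [bary, Fin.sum_univ_succ]

lemma bary_tail {p : ℕ} {t : Fin (p + 1) → ℝ} (ht : ∑ i, t i = 1) : bary (Fin.tail t) = t := by
  have : 1 - ∑ i, Fin.tail t i = t 0 := by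
    rw [← ht, Fin.sum_univ_succ]; simp [Fin.tail]
  rw [bary, this, Fin.cons_self_tail]

lemma tail_bary {p : ℕ} (s : Fin p → ℝ) : Fin.tail (bary s) = s := Fin.tail_cons _ _

/-- The geometric simplex of dimension `p`, placed in `ℝ ^ p` by omitting the coordinate `t₀`. -/
def geomSimplex (p : ℕ) : Set (Fin p → ℝ) := {s | bary s ∈ stdSimplex ℝ (Fin (p + 1))}

lemma mem_geomSimplex {p : ℕ} {s : Fin p → ℝ} :
    s ∈ geomSimplex p ↔ ∑ i, s i ≤ 1 ∧ ∀ i, 0 ≤ s i := by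
  rw [geomSimplex, mem_ofPred_eq, stdSimplex, mem_ofPred_eq]
  simp only [sum_bary, and_true, Fin.forall_fin_succ]
  simp [bary]

lemma convex_geomSimplex (p : ℕ) : Convex ℝ (geomSimplex p) := by
  intro s hs t ht a b ha hb hab
  rw [mem_geomSimplex] at *
  constructor
  · simp only [Pi.add_apply, Pi.smul_apply, smul_eq_mul, Finset.sum_add_distrib, ← Finset.mul_sum]
    nlinarith [mul_le_mul_of_nonneg_left hs.1 ha, mul_le_mul_of_nonneg_left ht.1 hb]
  · intro i
    exact add_nonneg (mul_nonneg ha (hs.2 i)) (mul_nonneg hb (ht.2 i))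

lemma interior_geomSimplex (p : ℕ) : (interior (geomSimplex p)).Nonempty := by
  have ho : IsOpen ({s : Fin p → ℝ | ∑ i, s i < 1} ∩ ⋂ i, {s : Fin p → ℝ | 0 < s i}) :=
    IsOpen.inter (isOpen_lt (continuous_finsetSum _ fun i _ => continuous_apply i)
      continuous_const)
      (isOpen_iInter_of_finite fun i => isOpen_lt continuous_const (continuous_apply i))
  refine ⟨fun _ => 1 / (p + 1), mem_interior.2 ⟨_, fun s hs => ?_, ho, ?_,
    mem_iInter.2 fun i => ?_⟩⟩
  · exact mem_geomSimplex.2 ⟨le_of_lt hs.1, fun i => le_of_lt (mem_iInter.1 hs.2 i)⟩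
  · have : (0 : ℝ) < p + 1 := by positivity
    simp only [mem_ofPred_eq, Finset.sum_const, Finset.card_univ, Fintype.card_fin, nsmul_eq_mul]
    rw [mul_one_div, div_lt_one this]; linarith
  · rw [mem_ofPred_eq]; positivity

/-- The vertices of the geometric simplex. -/
def geomVertex {p : ℕ} (i : Fin (p + 1)) : Fin p → ℝ :=
  Fin.tail (Pi.single i 1 : Fin (p + 1) → ℝ)

lemma bary_geomVertex {p : ℕ} (i : Fin (p + 1)) : bary (geomVertex i) = Pi.single i 1 :=
  bary_tail (by simp)

/-- The map of affine spaces given by a map of the vertices. -/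
def affMap {p q : ℕ} (θ : Fin (q + 1) → Fin (p + 1)) (s : Fin q → ℝ) : Fin p → ℝ :=
  Fin.tail (FunOnFinite.linearMap ℝ ℝ θ (bary s))

lemma bary_affMap {p q : ℕ} (θ : Fin (q + 1) → Fin (p + 1)) (s : Fin q → ℝ) :
    bary (affMap θ s) = FunOnFinite.linearMap ℝ ℝ θ (bary s) := by
  refine bary_tail ?_
  rw [← sum_bary s]
  simp only [FunOnFinite.linearMap_apply_apply]
  exact Finset.sum_fiberwise _ _ _

lemma affMap_mem {p q : ℕ} (θ : Fin (q + 1) → Fin (p + 1)) {s : Fin q → ℝ}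
    (hs : s ∈ geomSimplex q) : affMap θ s ∈ geomSimplex p := by
  rw [geomSimplex, mem_ofPred_eq, bary_affMap]
  exact stdSimplex.image_linearMap θ ⟨_, hs, rfl⟩

lemma affMap_id {p : ℕ} : affMap (id : Fin (p + 1) → Fin (p + 1)) = id := by
  funext s
  rw [affMap, FunOnFinite.linearMap_id]; exact tail_bary s

lemma affMap_comp {p q r : ℕ} (θ : Fin (q + 1) → Fin (p + 1)) (θ' : Fin (r + 1) → Fin (q + 1)) :
    affMap (θ ∘ θ') = affMap θ ∘ affMap θ' := by
  funext s
  rw [Function.comp_apply, affMap, affMap, bary_affMap, FunOnFinite.linearMap_comp]; rfl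

lemma contDiff_bary {p : ℕ} : ContDiff ℝ ∞ (bary : (Fin p → ℝ) → Fin (p + 1) → ℝ) := by
  rw [contDiff_pi]
  refine Fin.cases ?_ fun i => ?_
  · simp only [bary, Fin.cons_zero]; fun_prop
  · simp only [bary, Fin.cons_succ]; fun_prop

lemma contDiff_affMap {p q : ℕ} (θ : Fin (q + 1) → Fin (p + 1)) : ContDiff ℝ ∞ (affMap θ) := by
  rw [contDiff_pi]
  intro i
  exact (contDiff_apply ℝ ℝ i.succ).comp
    ((LinearMap.toContinuousLinearMap (FunOnFinite.linearMap ℝ ℝ θ)).contDiff.comp contDiff_bary)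

lemma sum_linearMap {p q : ℕ} (θ : Fin (q + 1) → Fin (p + 1)) (t : Fin (q + 1) → ℝ)
    (c : Fin (p + 1) → ℝ) :
    ∑ i, FunOnFinite.linearMap ℝ ℝ θ t i * c i = ∑ j, t j * c (θ j) := by
  simp only [FunOnFinite.linearMap_apply_apply, Finset.sum_mul]
  rw [← Finset.sum_fiberwise Finset.univ θ fun j => t j * c (θ j)]
  refine Finset.sum_congr rfl fun i _ => Finset.sum_congr rfl fun j hj => ?_
  rw [(Finset.mem_filter.1 hj).2]

end Simplex

section Functor

universe u

variable (𝕜 : Type) [RCLike 𝕜] {n m : ℕ} {X : Type u} [TopologicalSpace X]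
  [ChartedSpace (EuclideanSpace ℝ (Fin n)) X] [IsManifold (𝓡 n) ∞ X] {Y : Set X}

/-- The data for the sheaf of forms on `X` with poles given by `μ`. -/
def basePoleDatum (hY : IsClosedSubmanifold n m Y) (μ : morseBott n m Y) :
    PoleDatum (𝓡 n) X Y where
  S := univ
  proj := id
  μ := μ.1
  regular := ⟨uniqueMDiffOn_univ, by simp⟩
  continuous_proj := continuous_id
  smooth_μ := μ.2.1
  closed := hY.isClosed

/-- The sheaf of differential graded algebras on `X` of the differential forms `η` on `X ∖ Y` such
that, locally on `X`, some `μ ^ N • η` extends to a smooth form on `X`. -/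
def formsWithPoles (hY : IsClosedSubmanifold n m Y) (μ : morseBott n m Y) : ShDGA 𝕜 X :=
  (basePoleDatum hY μ).sheaf 𝕜

/-- The data for the sheaf of forms on `X × Δ_p` with poles given by `∑ tᵢ μᵢ`, where `μᵢ` are the
vertices of an affine simplex. -/
def simplexPoleDatum (hY : IsClosedSubmanifold n m Y) {p : ℕ} (σ : AffineSimplex n m Y p) :
    PoleDatum ((𝓡 n).prod 𝓘(ℝ, Fin p → ℝ)) (X × (Fin p → ℝ)) Y where
  S := univ ×ˢ geomSimplex p
  proj := Prod.fst
  μ z := ∑ i, bary z.2 i * (σ.vertex i).1 z.1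
  regular :=
    { unique := uniqueMDiffOn_univ.prod (uniqueMDiffOn_iff_uniqueDiffOn.2
        (uniqueDiffOn_convex (convex_geomSimplex p) (interior_geomSimplex p)))
      closure_interior := by
        rw [interior_prod_eq, interior_univ, closure_prod_eq, closure_univ,
          (convex_geomSimplex p).closure_interior_eq_closure_of_nonempty_interior
            (interior_geomSimplex p)]
        exact prod_mono le_rfl subset_closure }
  continuous_proj := continuous_fst
  smooth_μ := by
    refine contMDiff_finsetSum fun i _ => ?_
    have h1 : ContMDiff ((𝓡 n).prod 𝓘(ℝ, Fin p → ℝ)) 𝓘(ℝ, ℝ) ∞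
        fun z : X × (Fin p → ℝ) => bary z.2 i :=
      (contDiff_pi.1 contDiff_bary i).contMDiff.comp contMDiff_snd
    exact h1.smul ((σ.vertex i).2.1.comp contMDiff_fst)
  closed := hY.isClosed

/-- The map `X × Δ_q → X × Δ_p` belonging to a morphism of simplices. -/
def simplexHom (hY : IsClosedSubmanifold n m Y) {σ τ : SimplexCat n m Y} (f : σ ⟶ τ) :
    (simplexPoleDatum hY τ.simplex).Hom (simplexPoleDatum hY σ.simplex) where
  toFun := Prod.map id (affMap (SimplexCat.onVertices f))
  smooth := contMDiff_id.prodMap (contDiff_affMap _).contMDiff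
  mapsTo _ h := ⟨mem_univ _, affMap_mem _ h.2⟩
  proj_comp _ := rfl
  μ_comp z := by
    change ∑ i, bary (affMap (SimplexCat.onVertices f) z.2) i * (σ.simplex.vertex i).1 z.1 =
      ∑ i, bary z.2 i * (τ.simplex.vertex i).1 z.1
    rw [bary_affMap, SimplexCat.simplex_eq f]
    simp only [AffineSimplex.vertex_reindex]
    exact sum_linearMap _ _ fun i => (σ.simplex.vertex i).1 z.1

/-- The functor sending an affine simplex with vertices `μ₀, …, μ_p` to the push-forward to `X` of
the sheaf of differential graded algebras of forms on `X × Δ_p` with poles given by `∑ tᵢ μᵢ`.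
Morphisms are sent to the pull-backs along the corresponding maps of geometric simplices. -/
def simplexFunctor (hY : IsClosedSubmanifold n m Y) : SimplexCat n m Y ⥤ ShDGA 𝕜 X where
  obj σ := (simplexPoleDatum hY σ.simplex).sheaf 𝕜
  map f := (simplexHom hY f).sheafMap
  map_id σ := by
    refine Eq.trans ?_ (PoleDatum.Hom.sheafMap_id (𝕜 := 𝕜) (simplexPoleDatum hY σ.simplex))
    refine PoleDatum.Hom.sheafMap_congr ?_
    change Prod.map id (affMap id) = id
    rw [affMap_id]; rfl
  map_comp f g := by
    rw [← PoleDatum.Hom.sheafMap_comp]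
    refine PoleDatum.Hom.sheafMap_congr ?_
    change Prod.map id (affMap (SimplexCat.onVertices f ∘ SimplexCat.onVertices g)) = _
    rw [affMap_comp]; rfl

/-- The inclusion `X → X × Δ_p` at a vertex. -/
def vertexHom (hY : IsClosedSubmanifold n m Y) {p : ℕ} (σ : AffineSimplex n m Y p)
    (i : Fin (p + 1)) : (basePoleDatum hY (σ.vertex i)).Hom (simplexPoleDatum hY σ) where
  toFun x := (x, geomVertex i)
  smooth := contMDiff_id.prodMk contMDiff_const
  mapsTo x _ := by
    refine ⟨mem_univ _, ?_⟩
    change bary (geomVertex i) ∈ stdSimplex ℝ (Fin (p + 1))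
    rw [bary_geomVertex]
    exact single_mem_stdSimplex ℝ i
  proj_comp _ := rfl
  μ_comp x := by
    change ∑ j, bary (geomVertex i) j * (σ.vertex j).1 x = (σ.vertex i).1 x
    rw [bary_geomVertex]
    simp [Pi.single_apply]

/-- The restriction of forms on `X × Δ_p` to a vertex of `Δ_p`. -/
def restrictToVertex (hY : IsClosedSubmanifold n m Y) (σ : SimplexCat n m Y)
    (i : Fin (σ.1.unop.len + 1)) :
    (simplexFunctor 𝕜 hY).obj σ ⟶ formsWithPoles 𝕜 hY (σ.simplex.vertex i) :=
  (vertexHom hY σ.simplex i).sheafMap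

end Functor

end MorseBottForms

end

open MorseBottForms

/-!
Everything follows from one fact: for an affine simplex `σ` with vertices `μ₀, …, μ_p`, the
restriction of forms on `X × Δ_p` to a vertex `i` is a quasi-isomorphism (`isQuasiIso_vertexHom`).
It suffices to exhibit, locally on `X`, the inclusion of the vertex as a deformation retract of
`X × Δ_p` in a way that respects the poles, that is, by maps intertwining the functions
`∑ tⱼ μⱼ` (`PoleDatum.Hom.IsLocalRetract`).

Away from `Y` there are no poles, and the linear contraction `contractTo` of the simplex will do.
Near a point of `Y` the contraction has to be lifted to an isotopy of `X` moving `∑ tⱼ μⱼ` to the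
function with the contracted coordinates. This is the Morse–Bott lemma with parameters. In a slice
chart with orthogonal projection `π` onto the normal directions, Taylor's formula gives
`∑ tⱼ μⱼ = ⟨A_t(z) π z, π z⟩` with `A_t(z)` positive definite on the image of `π`, and
`Ψ_t(z) = A_t(z) ^ (1/2) π z + (1 - π) z` satisfies `‖π Ψ_t(z)‖ ^ 2 = ∑ tⱼ μⱼ(z)`
(`exists_normal_form`). The square root is smooth (`contDiffAt_posSqrt`), and `Ψ_t` is invertible
near the point uniformly in the compact parameter space (`exists_inverse_near_compact`). The
isotopy is `Ψ_c⁻¹ ∘ Ψ_t`, where `c` is the contraction of `t` (`exists_isotopy`).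

Given the retraction `r` and the homotopy `K`, pull-back along `r` lifts closed forms on the base,
and integration of `K^* α` along the fibre `[0, 1]` is a chain homotopy
(`dForm_fiberIntegral`, `PoleDatum.Hom.IsLocalRetract.exists_primitive`). Fibre integration
preserves finiteness of the pole order by compactness of `[0, 1]`
(`PoleDatum.HasPoles.fiberIntegral`).
That local statements on sections imply a quasi-isomorphism of complexes of sheaves is
`ShDGA.isQuasiIso_of_local`.

The rest is formal. The composition of `F(f)` with a restriction to a vertex is again a restriction
to a vertex, so `F(f)` is a quasi-isomorphism by two-out-of-three. The isomorphism `transport`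
is the zigzag of the two restrictions on the edge from `μ₀` to `μ₁`; naturality for maps of
simplices yields compatibility with all simplices and, by means of the `2`-simplices, the cocycle
condition. The Morse–Bott functions form a convex cone, because a nonnegative function vanishing on
`Y` is Morse–Bott if and only if its Hessian, a positive semidefinite form, has the tangent space of
`Y` as its kernel (`finrank_hessianAt_iff`).
-/

noncomputable section

namespace MorseBottForms

set_option linter.unusedSectionVars false
set_option maxSynthPendingDepth 3

/-! ### Square roots of positive operators -/

section Sqrt

variable {E : Type*} [NormedAddCommGroup E] [InnerProductSpace ℝ E] [FiniteDimensional ℝ E]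

local notation "⟪" x ", " y "⟫" => inner ℝ x y

/-- Symmetric positive definite operators. -/
def IsPosDef (B : E →L[ℝ] E) : Prop := IsSelfAdjoint B ∧ ∀ v, v ≠ 0 → 0 < ⟪B v, v⟫

lemma inner_map_comm {B : E →L[ℝ] E} (hB : IsSelfAdjoint B) (v w : E) :
    ⟪B v, w⟫ = ⟪v, B w⟫ := by
  have := ContinuousLinearMap.isSelfAdjoint_iff_isSymmetric.1 hB
  exact this v w

/-- A symmetric operator without nonzero eigenvalues vanishes. -/
lemma eq_zero_of_eigenvalues {X : E →L[ℝ] E} (hX : IsSelfAdjoint X)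
    (h : ∀ (v : E) (l : ℝ), v ≠ 0 → X v = l • v → l = 0) : X = 0 := by
  have hs := ContinuousLinearMap.isSelfAdjoint_iff_isSymmetric.1 hX
  have hs' : (X : E →ₗ[ℝ] E).IsSymmetric := hs
  let b := hs'.eigenvectorBasis rfl
  refine ContinuousLinearMap.coe_injective (b.toBasis.ext fun i => ?_)
  have h1 := hs'.apply_eigenvectorBasis rfl i
  have h2 : hs'.eigenvalues rfl i = 0 := by
    refine h (b i) _ (b.orthonormal.ne_zero i) ?_
    exact h1
  have : (X : E →ₗ[ℝ] E) (b i) = 0 := by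
    rw [h1, h2]; simp
  simpa using this

/-- The Sylvester equation `S X + X R = 0` has only the trivial symmetric solution. -/
lemma IsPosDef.sylvester {S R X : E →L[ℝ] E} (hS : IsPosDef S) (hR : IsPosDef R)
    (hX : IsSelfAdjoint X) (h : S * X + X * R = 0) : X = 0 := by
  refine eq_zero_of_eigenvalues hX fun v l hv hl => ?_
  have h1 : ⟪S (X v) + X (R v), v⟫ = 0 := by
    have : S (X v) + X (R v) = 0 := by simpa using congrArg (fun T => T v) h
    rw [this, inner_zero_left]
  rw [inner_add_left, inner_map_comm hX, hl, map_smul, real_inner_smul_left,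
    real_inner_smul_right] at h1
  have h2 : l * (⟪S v, v⟫ + ⟪R v, v⟫) = 0 := by linarith
  exact (mul_eq_zero.1 h2).resolve_right (add_pos (hS.2 v hv) (hR.2 v hv)).ne'

lemma IsPosDef.sq_injective {S R : E →L[ℝ] E} (hS : IsPosDef S) (hR : IsPosDef R)
    (h : S * S = R * R) : S = R := by
  refine sub_eq_zero.1 (hS.sylvester hR (hS.1.sub hR.1) ?_)
  rw [mul_sub, sub_mul, h]; abel

lemma IsPosDef.exists_sqrt {B : E →L[ℝ] E} (hB : IsPosDef B) :
    ∃ S : E →L[ℝ] E, IsPosDef S ∧ S * S = B := by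
  -- take the square roots of the eigenvalues in an orthonormal eigenbasis
  have hs : (B : E →ₗ[ℝ] E).IsSymmetric :=
    ContinuousLinearMap.isSelfAdjoint_iff_isSymmetric.1 hB.1
  let b := hs.eigenvectorBasis rfl
  let l := hs.eigenvalues rfl
  have hb : ∀ i, B (b i) = l i • b i := fun i => hs.apply_eigenvectorBasis rfl i
  have hl : ∀ i, 0 < l i := fun i => by
    have h1 := hB.2 (b i) (b.orthonormal.ne_zero i)
    rw [hb, real_inner_smul_left, real_inner_self_eq_norm_sq, b.orthonormal.1 i] at h1
    simpa using h1
  let S : E →ₗ[ℝ] E := b.toBasis.constr ℝ fun i => Real.sqrt (l i) • b i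
  have hS : ∀ i, S (b i) = Real.sqrt (l i) • b i := fun i => by
    have := b.toBasis.constr_basis ℝ (fun i => Real.sqrt (l i) • b i) i
    rwa [b.coe_toBasis] at this
  have hin : ∀ v w, ⟪S v, w⟫ = ∑ i, Real.sqrt (l i) * (⟪v, b i⟫ * ⟪b i, w⟫) := fun v w => by
    conv_lhs => rw [← b.sum_repr' v]
    rw [map_sum, sum_inner]
    refine Finset.sum_congr rfl fun i _ => ?_
    rw [map_smul, hS, real_inner_smul_left, real_inner_smul_left, real_inner_comm v]; ring
  refine ⟨LinearMap.toContinuousLinearMap S, ⟨?_, fun v hv => ?_⟩, ?_⟩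
  · rw [ContinuousLinearMap.isSelfAdjoint_iff_isSymmetric]
    intro v w
    change ⟪S v, w⟫ = ⟪v, S w⟫
    rw [real_inner_comm (S w), hin, hin]
    refine Finset.sum_congr rfl fun i _ => ?_
    rw [real_inner_comm v, real_inner_comm w]; ring
  · change 0 < ⟪S v, v⟫
    rw [hin]
    obtain ⟨i, hi⟩ : ∃ i, ⟪b i, v⟫ ≠ 0 := by
      by_contra! hc
      refine hv ?_
      rw [← b.sum_repr' v]; simp [hc]
    refine Finset.sum_pos' (fun j _ => ?_) ⟨i, Finset.mem_univ _, ?_⟩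
    · rw [real_inner_comm]; exact mul_nonneg (Real.sqrt_nonneg _) (mul_self_nonneg _)
    · rw [real_inner_comm]; exact mul_pos (Real.sqrt_pos.2 (hl i)) (mul_self_pos.2 hi)
  · refine ContinuousLinearMap.coe_injective (b.toBasis.ext fun i => ?_)
    simp only [OrthonormalBasis.coe_toBasis]
    change S (S (b i)) = B (b i)
    rw [hS, map_smul, hS, smul_smul, Real.mul_self_sqrt (hl i).le, hb]

open Classical in
/-- The positive definite square root of a positive definite operator, and `0` for all other
operators. -/
noncomputable def posSqrt (B : E →L[ℝ] E) : E →L[ℝ] E :=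
  if h : IsPosDef B then h.exists_sqrt.choose else 0

lemma IsPosDef.posSqrt {B : E →L[ℝ] E} (hB : IsPosDef B) : IsPosDef (posSqrt B) := by
  rw [MorseBottForms.posSqrt, dif_pos hB]; exact hB.exists_sqrt.choose_spec.1

lemma IsPosDef.posSqrt_mul_self {B : E →L[ℝ] E} (hB : IsPosDef B) :
    MorseBottForms.posSqrt B * MorseBottForms.posSqrt B = B := by
  rw [MorseBottForms.posSqrt, dif_pos hB]; exact hB.exists_sqrt.choose_spec.2

lemma IsPosDef.posSqrt_eq {B S : E →L[ℝ] E} (hB : IsPosDef B) (hS : IsPosDef S)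
    (h : S * S = B) : MorseBottForms.posSqrt B = S :=
  hB.posSqrt.sq_injective hS (hB.posSqrt_mul_self.trans h.symm)

/-- Positive definite operators form an open subset of the symmetric operators, by compactness of
the unit sphere. -/
lemma IsPosDef.eventually {B : E →L[ℝ] E} (hB : IsPosDef B) :
    ∀ᶠ T in 𝓝 B, IsSelfAdjoint T → IsPosDef T := by
  have hK : IsCompact (Metric.sphere (0 : E) 1) := isCompact_sphere 0 1
  have h1 : ∀ᶠ T in 𝓝 B, ∀ v ∈ Metric.sphere (0 : E) 1, 0 < ⟪T v, v⟫ := by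
    refine hK.eventually_forall_of_forall_eventually fun v hv => ?_
    have hc : Continuous fun q : (E →L[ℝ] E) × E => ⟪q.1 q.2, q.2⟫ := by fun_prop
    refine hc.continuousAt.eventually (lt_mem_nhds (hB.2 v ?_))
    rintro rfl; simp at hv
  filter_upwards [h1] with T hT hsa
  refine ⟨hsa, fun v hv => ?_⟩
  have hn : 0 < ‖v‖ := norm_pos_iff.2 hv
  have h2 := hT (‖v‖⁻¹ • v) (by simp [norm_smul, hn.ne'])
  rw [map_smul, real_inner_smul_left, real_inner_smul_right] at h2
  have h3 : 0 < ‖v‖⁻¹ := inv_pos.2 hn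
  exact pos_of_mul_pos_right (pos_of_mul_pos_right h2 h3.le) h3.le

variable (E) in
/-- Linear coordinates on the space of symmetric operators. -/
lemma exists_symCoord : ∃ (d : ℕ) (j : (Fin d → ℝ) →L[ℝ] (E →L[ℝ] E))
    (T : (E →L[ℝ] E) →L[ℝ] (Fin d → ℝ)),
      (∀ x, T (j x) = x) ∧ (∀ x, IsSelfAdjoint (j x)) ∧ ∀ S, IsSelfAdjoint S → j (T S) = S := by
  let F : Submodule ℝ (E →L[ℝ] E) := selfAdjoint.submodule ℝ (E →L[ℝ] E)
  let b := Module.finBasis ℝ F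
  let j : (Fin (Module.finrank ℝ F) → ℝ) →ₗ[ℝ] (E →L[ℝ] E) :=
    F.subtype ∘ₗ b.equivFun.symm.toLinearMap
  have hj : Function.Injective j := Subtype.val_injective.comp b.equivFun.symm.injective
  obtain ⟨T, hT⟩ := j.exists_leftInverse_of_injective (LinearMap.ker_eq_bot.2 hj)
  have hT' : ∀ x, T (j x) = x := fun x => congrArg (fun L => L x) hT
  refine ⟨_, LinearMap.toContinuousLinearMap j, LinearMap.toContinuousLinearMap T, hT',
    fun x => (b.equivFun.symm x).2, fun S hS => ?_⟩
  have h1 : j (b.equivFun ⟨S, hS⟩) = S := by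
    change ((b.equivFun.symm (b.equivFun ⟨S, hS⟩) : F) : E →L[ℝ] E) = S
    rw [LinearEquiv.symm_apply_apply]
  change j (T S) = S
  rw [← h1, hT']

lemma IsSelfAdjoint.mul_self' {S : E →L[ℝ] E} (hS : IsSelfAdjoint S) : IsSelfAdjoint (S * S) :=
  (hS.commute_iff hS).1 rfl

/-- The inverse function theorem: a smooth map between spaces of the same finite dimension with
injective derivative has a smooth local section. -/
lemma ContDiffAt.exists_local_section {F : Type*} [NormedAddCommGroup F] [NormedSpace ℝ F]
    [FiniteDimensional ℝ F] {f : F → F} {x : F} (hf : ContDiffAt ℝ ∞ f x)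
    (hinj : Function.Injective (fderiv ℝ f x)) :
    ∃ g : F → F, ContDiffAt ℝ ∞ g (f x) ∧ g (f x) = x ∧ ∀ᶠ y in 𝓝 (f x), f (g y) = y := by
  have : CompleteSpace F := FiniteDimensional.complete ℝ F
  let e := (LinearEquiv.ofInjectiveEndo (fderiv ℝ f x).toLinearMap hinj).toContinuousLinearEquiv
  have he : HasFDerivAt f (e : F →L[ℝ] F) x := (hf.differentiableAt (by simp)).hasFDerivAt
  have hst : HasStrictFDerivAt f (e : F →L[ℝ] F) x := hf.hasStrictFDerivAt' he (by simp)
  exact ⟨hf.localInverse he (by simp), hf.to_localInverse he (by simp),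
    hf.localInverse_apply_image he (by simp), hst.eventually_right_inverse⟩

/-- Squaring, on symmetric operators, has injective derivative `v ↦ S v + v S` at a positive
definite operator `S`, by the Sylvester equation. -/
lemma fderiv_symSq_injective {d : ℕ} {j : (Fin d → ℝ) →L[ℝ] (E →L[ℝ] E)}
    {T : (E →L[ℝ] E) →L[ℝ] (Fin d → ℝ)} (hTj : ∀ x, T (j x) = x) (hj : ∀ x, IsSelfAdjoint (j x))
    (hjT : ∀ S, IsSelfAdjoint S → j (T S) = S) {x₀ : Fin d → ℝ} (hx₀ : IsPosDef (j x₀)) :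
    Function.Injective (fderiv ℝ (fun x => T (j x * j x)) x₀) := by
  have hd : ∀ v, fderiv ℝ (fun x => T (j x * j x)) x₀ v =
      T (j x₀ * j v + j v * j x₀) := fun v => by
    have h0 : HasFDerivAt (fun x => j x * j x) (j x₀ • j + MulOpposite.op (j x₀) • j) x₀ :=
      (j.hasFDerivAt (x := x₀)).mul' (j.hasFDerivAt (x := x₀))
    have h1 : HasFDerivAt (fun x => T (j x * j x))
        (T.comp (j x₀ • j + MulOpposite.op (j x₀) • j)) x₀ := T.hasFDerivAt.comp x₀ h0
    rw [h1.fderiv]; rfl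
  rw [injective_iff_map_eq_zero]
  intro v hv
  rw [hd] at hv
  have hsa : IsSelfAdjoint (j x₀ * j v + j v * j x₀) := by
    rw [IsSelfAdjoint, star_add, star_mul, star_mul, (hj x₀).star_eq, (hj v).star_eq, add_comm]
  have h1 : j x₀ * j v + j v * j x₀ = 0 := by rw [← hjT _ hsa, hv, map_zero]
  rw [← hTj v, hx₀.sylvester hx₀ (hj v) h1, map_zero]

/-- The square root depends smoothly on a positive definite operator: it is a local inverse of
squaring on the space of symmetric operators. -/
lemma contDiffAt_posSqrt {P : Type*} [NormedAddCommGroup P] [NormedSpace ℝ P]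
    {f : P → E →L[ℝ] E} {p : P} (hf : ContDiffAt ℝ ∞ f p) (hs : ∀ᶠ q in 𝓝 p, IsSelfAdjoint (f q))
    (hp : IsPosDef (f p)) : ContDiffAt ℝ ∞ (fun q => posSqrt (f q)) p := by
  obtain ⟨d, j, T, hTj, hj, hjT⟩ := exists_symCoord E
  have hsqd : ContDiff ℝ ∞ (fun x => T (j x * j x)) := T.contDiff.comp (j.contDiff.mul j.contDiff)
  set x₀ := T (posSqrt (f p)) with hx₀'
  have hx₀ : j x₀ = posSqrt (f p) := hjT _ hp.posSqrt.1
  have hinj := fderiv_symSq_injective hTj hj hjT (x₀ := x₀) (by rw [hx₀]; exact hp.posSqrt)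
  generalize hsq : (fun x => T (j x * j x)) = sq at hsqd hinj
  obtain ⟨g, hg, hgS, hri⟩ := ContDiffAt.exists_local_section hsqd.contDiffAt hinj
  have hSq : sq x₀ = T (f p) := by
    rw [← hsq]; beta_reduce
    rw [hx₀, hp.posSqrt_mul_self]
  rw [hSq] at hg hgS hri
  have hTf : ContDiffAt ℝ ∞ (fun q => T (f q)) p := T.contDiff.contDiffAt.comp p hf
  have hmain : ContDiffAt ℝ ∞ (fun q => j (g (T (f q)))) p :=
    j.contDiff.contDiffAt.comp p (hg.comp p hTf)
  refine hmain.congr_of_eventuallyEq ?_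
  have hpos : ∀ᶠ q in 𝓝 p, IsPosDef (j (g (T (f q)))) := by
    have h0 : j (g (T (f p))) = posSqrt (f p) := by rw [hgS, hx₀]
    have h1 := hmain.continuousAt.eventually (h0 ▸ hp.posSqrt.eventually)
    filter_upwards [h1] with q hq using hq (hj _)
  have hri' := hTf.continuousAt.eventually hri
  filter_upwards [hs, hpos, hri', hf.continuousAt.eventually hp.eventually] with q h1 h2 h3 h4
  refine (h4 h1).posSqrt_eq h2 ?_
  rw [← hsq] at h3
  exact ((hjT _ (IsSelfAdjoint.mul_self' h2.1)).symm.trans (congrArg j h3)).trans (hjT _ h1)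

end Sqrt

/-! ### Inverse functions near a compact set -/

section InverseNearCompact

variable {F : Type*} [NormedAddCommGroup F] [NormedSpace ℝ F] [FiniteDimensional ℝ F]

/-- The inverse function theorem near a compact set on which the map is injective. -/
lemma exists_inverse_near_compact {f : F → F} {K O : Set F} (hK : IsCompact K) (hO : IsOpen O)
    (hKO : K ⊆ O) (hf : ContDiffOn ℝ ∞ f O) (hinj : InjOn f K)
    (hd : ∀ x ∈ K, Function.Injective (fderiv ℝ f x)) :
    ∃ (O₁ O₂ : Set F) (g : F → F), IsOpen O₁ ∧ K ⊆ O₁ ∧ O₁ ⊆ O ∧ IsOpen O₂ ∧ f '' K ⊆ O₂ ∧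
      ContDiffOn ℝ ∞ g O₂ ∧ MapsTo g O₂ O₁ ∧ (∀ y ∈ O₂, f (g y) = y) ∧
      ∀ x ∈ O₁, f x ∈ O₂ ∧ g (f x) = x := by
  have hfat : ∀ x ∈ O, ContDiffAt ℝ ∞ f x := fun x hx => hf.contDiffAt (hO.mem_nhds hx)
  have hfd : ContinuousOn (fderiv ℝ f) O := hf.continuousOn_fderiv_of_isOpen hO (by simp)
  have hst : ∀ x ∈ O, Function.Injective (fderiv ℝ f x) →
      ∃ e : F ≃L[ℝ] F, HasStrictFDerivAt f (e : F →L[ℝ] F) x := fun x hx hi =>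
    ⟨(LinearEquiv.ofInjectiveEndo (fderiv ℝ f x).toLinearMap hi).toContinuousLinearEquiv,
      (hfat x hx).hasStrictFDerivAt (by simp)⟩
  have hcomp : CompleteSpace F := FiniteDimensional.complete ℝ F
  obtain ⟨t, ht, hti⟩ := hinj.exists_mem_nhdsSet hK
    (fun x hx => (hfat x (hKO hx)).continuousAt) (fun x hx => by
      obtain ⟨e, he⟩ := hst x (hKO hx) (hd x hx)
      refine ⟨_, (he.toOpenPartialHomeomorph f).open_source.mem_nhds
        he.mem_toOpenPartialHomeomorph_source, ?_⟩
      exact (he.toOpenPartialHomeomorph f).injOn)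
  obtain ⟨t', ht'o, hKt', ht't⟩ := mem_nhdsSet_iff_exists.1 ht
  let O₁ := t' ∩ (O ∩ fderiv ℝ f ⁻¹' {L | Function.Injective L})
  have hO₁ : IsOpen O₁ :=
    ht'o.inter (hfd.isOpen_inter_preimage hO ContinuousLinearMap.isOpen_injective)
  have hi₁ : InjOn f O₁ := hti.mono (inter_subset_left.trans ht't)
  have hO₂ : IsOpen (f '' O₁) := by
    rw [isOpen_iff_mem_nhds]
    rintro _ ⟨x, hx, rfl⟩
    obtain ⟨e, he⟩ := hst x hx.2.1 hx.2.2
    rw [← he.map_nhds_eq_of_equiv]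
    exact Filter.image_mem_map (hO₁.mem_nhds hx)
  have hl : ∀ x ∈ O₁, Function.invFunOn f O₁ (f x) = x := fun x hx =>
    hi₁.leftInvOn_invFunOn hx
  refine ⟨O₁, f '' O₁, Function.invFunOn f O₁, hO₁, fun x hx => ⟨hKt' hx, hKO hx, hd x hx⟩,
    fun x hx => hx.2.1, hO₂, image_mono fun x hx => ⟨hKt' hx, hKO hx, hd x hx⟩, ?_, ?_, ?_, ?_⟩
  · rintro _ ⟨x, hx, rfl⟩
    obtain ⟨g, hg, hgx, hev⟩ := ContDiffAt.exists_local_section (hfat x hx.2.1) hx.2.2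
    refine (hg.congr_of_eventuallyEq ?_).contDiffWithinAt
    have h1 : ∀ᶠ y in 𝓝 (f x), g y ∈ O₁ :=
      hg.continuousAt.eventually (by rw [hgx]; exact hO₁.mem_nhds hx)
    filter_upwards [hev, h1] with y h2 h3
    have := hl _ h3
    rwa [h2] at this
  · rintro _ ⟨x, hx, rfl⟩
    rw [hl x hx]; exact hx
  · rintro _ ⟨x, hx, rfl⟩
    rw [hl x hx]
  · exact fun x hx => ⟨mem_image_of_mem f hx, hl x hx⟩

end InverseNearCompact

/-! ### Integrals depending on parameters -/

section ParametricIntegral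

variable {P : Type} [NormedAddCommGroup P] [NormedSpace ℝ P]

/-- A set is locally convex if all its points have arbitrarily small convex neighbourhoods in the
set. -/
def IsLocallyConvex (D : Set P) : Prop := ∀ x ∈ D, ∃ r > 0, Convex ℝ (D ∩ Metric.ball x r)

lemma Convex.isLocallyConvex {D : Set P} (hD : Convex ℝ D) : IsLocallyConvex D := fun x _ =>
  ⟨1, one_pos, hD.inter (convex_ball x 1)⟩

lemma IsLocallyConvex.inter_open {D O : Set P} (hD : IsLocallyConvex D) (hO : IsOpen O) :
    IsLocallyConvex (D ∩ O) := by
  rintro x ⟨hx, hxO⟩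
  obtain ⟨r, hr, hc⟩ := hD x hx
  obtain ⟨r', hr', hO'⟩ := Metric.isOpen_iff.1 hO x hxO
  refine ⟨min r r', lt_min hr hr', ?_⟩
  have : D ∩ O ∩ Metric.ball x (min r r') =
      (D ∩ Metric.ball x r) ∩ Metric.ball x (min r r') := by
    ext y
    constructor
    · rintro ⟨⟨h1, h2⟩, h3⟩
      exact ⟨⟨h1, Metric.ball_subset_ball (min_le_left _ _) h3⟩, h3⟩
    · rintro ⟨⟨h1, h2⟩, h3⟩
      exact ⟨⟨h1, hO' (Metric.ball_subset_ball (min_le_right _ _) h3)⟩, h3⟩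
  rw [this]
  exact hc.inter (convex_ball _ _)

variable {F : Type} [NormedAddCommGroup F] [NormedSpace ℝ F] {D : Set P} {a b : ℝ}

/-- The partial derivative in the direction of the parameters. -/
def fderivFst (f : P × ℝ → F) (S : Set (P × ℝ)) (z : P × ℝ) : P →L[ℝ] F :=
  (fderivWithin ℝ f S z).comp (ContinuousLinearMap.inl ℝ P ℝ)

lemma hasFDerivWithinAt_fst {f : P × ℝ → F} {x : P} {s : ℝ} (hs : s ∈ Icc a b)
    (hf : DifferentiableWithinAt ℝ f (D ×ˢ Icc a b) (x, s)) :
    HasFDerivWithinAt (fun y => f (y, s)) (fderivFst f (D ×ˢ Icc a b) (x, s)) D x := by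
  have h1 : HasFDerivWithinAt (fun y : P => (y, s)) (ContinuousLinearMap.inl ℝ P ℝ) D x :=
    (hasFDerivAt_prodMk_left x s).hasFDerivWithinAt
  have hm : MapsTo (fun y : P => (y, s)) D (D ×ˢ Icc a b) := fun y hy => ⟨hy, hs⟩
  exact hf.hasFDerivWithinAt.comp x h1 hm

lemma continuousOn_section {f : P × ℝ → F} (hf : ContinuousOn f (D ×ˢ Icc a b)) {x : P}
    (hx : x ∈ D) : ContinuousOn (fun s => f (x, s)) (Icc a b) :=
  hf.comp (by fun_prop) fun _ hs => ⟨hx, hs⟩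

lemma intervalIntegrable_section {f : P × ℝ → F} (hab : a ≤ b)
    (hf : ContinuousOn f (D ×ˢ Icc a b)) {x : P}
    (hx : x ∈ D) : IntervalIntegrable (fun s => f (x, s)) MeasureTheory.volume a b :=
  (continuousOn_section hf hx).intervalIntegrable_of_Icc hab

/-- Continuity in the parameter is uniform over a compact interval. -/
lemma eventually_uniform {f : P × ℝ → F} (hf : ContinuousOn f (D ×ˢ Icc a b)) {x : P} (hx : x ∈ D)
    {ε : ℝ} (hε : 0 < ε) :
    ∀ᶠ y in 𝓝 x, ∀ s ∈ Icc a b, y ∈ D → ‖f (y, s) - f (x, s)‖ ≤ ε := by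
  have key : ∀ᶠ y in 𝓝 x, ∀ s ∈ Icc a b, y ∈ D → s ∈ Icc a b → ‖f (y, s) - f (x, s)‖ ≤ ε := by
    refine isCompact_Icc.eventually_forall_of_forall_eventually fun s hs => ?_
    have h1 := Metric.continuousWithinAt_iff'.1 (hf (x, s) ⟨hx, hs⟩) (ε / 2) (half_pos hε)
    rw [eventually_nhdsWithin_iff] at h1
    have h2 : ∀ᶠ z : P × ℝ in 𝓝 (x, s), (x, z.2) ∈ D ×ˢ Icc a b →
        dist (f (x, z.2)) (f (x, s)) < ε / 2 :=
      (Continuous.continuousAt (f := fun z : P × ℝ => (x, z.2)) (by fun_prop)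
        (x := (x, s))).eventually h1
    filter_upwards [h1, h2] with z h3 h4 hz hz'
    rw [← dist_eq_norm]
    have := dist_triangle_right (f (z.1, z.2)) (f (x, z.2)) (f (x, s))
    linarith [h3 ⟨hz, hz'⟩, h4 ⟨hx, hz'⟩]
  filter_upwards [key] with y hy s hs hD using hy s hs hD hs

variable (hab : a < b) (hD : UniqueDiffOn ℝ D) (hc : IsLocallyConvex D)
include hab hD hc

omit hc in
lemma continuousOn_fderivFst {f : P × ℝ → F} {n : WithTop ℕ∞} (hn : n ≠ 0)
    (hf : ContDiffOn ℝ n f (D ×ˢ Icc a b)) :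
    ContinuousOn (fderivFst f (D ×ˢ Icc a b)) (D ×ˢ Icc a b) :=
  (hf.continuousOn_fderivWithin (hD.prod (uniqueDiffOn_Icc hab))
    (ENat.one_le_iff_ne_zero_withTop.2 hn)).clm_comp continuousOn_const

/-- Differentiation under the integral sign, for parameters in a locally convex set. Convexity
allows the mean value inequality to be used up to the boundary of the set. -/
lemma hasFDerivWithinAt_integral [CompleteSpace F] {f : P × ℝ → F}
    (hf : ContDiffOn ℝ 1 f (D ×ˢ Icc a b))
    {x : P} (hx : x ∈ D) :
    HasFDerivWithinAt (fun y => ∫ s in a..b, f (y, s))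
      (∫ s in a..b, fderivFst f (D ×ˢ Icc a b) (x, s)) D x := by
  have hfc := hf.continuousOn
  have hf' := continuousOn_fderivFst hab hD one_ne_zero hf
  have hint := fun {y : P} (hy : y ∈ D) => intervalIntegrable_section hab.le hfc hy
  rw [hasFDerivWithinAt_iff_isLittleO, Asymptotics.isLittleO_iff]
  intro ε hε
  obtain ⟨r, hr, hconv⟩ := hc x hx
  have hpos : 0 < b - a := sub_pos.2 hab
  have hu := eventually_uniform hf' hx (div_pos hε hpos)
  obtain ⟨δ, hδ, hball⟩ := Metric.eventually_nhds_iff_ball.1 hu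
  have hconv' : Convex ℝ (D ∩ Metric.ball x (min r δ)) := by
    have h1 : D ∩ Metric.ball x (min r δ) =
        (D ∩ Metric.ball x r) ∩ Metric.ball x (min r δ) := by
      rw [inter_assoc, inter_eq_right.2 (Metric.ball_subset_ball (min_le_left r δ))]
    rw [h1]; exact hconv.inter (convex_ball _ _)
  have hm : 0 < min r δ := lt_min hr hδ
  filter_upwards [inter_mem_nhdsWithin D (Metric.ball_mem_nhds x hm)] with y hy
  have hest : ∀ s ∈ Icc a b, ‖f (y, s) - f (x, s) - fderivFst f (D ×ˢ Icc a b) (x, s) (y - x)‖ ≤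
      ε / (b - a) * ‖y - x‖ := fun s hs => by
    refine hconv'.norm_image_sub_le_of_norm_hasFDerivWithin_le' (f := fun y => f (y, s))
      (f' := fun y => fderivFst f (D ×ˢ Icc a b) (y, s)) (fun z hz => ?_) (fun z hz => ?_)
      ⟨hx, Metric.mem_ball_self hm⟩ hy
    · exact (hasFDerivWithinAt_fst hs ((hf (z, s) ⟨hz.1, hs⟩).differentiableWithinAt
        one_ne_zero)).mono inter_subset_left
    · exact hball z (Metric.ball_subset_ball (min_le_right _ _) hz.2) s hs hz.1
  have hi' := intervalIntegrable_section hab.le hf' hx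
  have heq : (∫ s in a..b, f (y, s)) - (∫ s in a..b, f (x, s)) -
      (∫ s in a..b, fderivFst f (D ×ˢ Icc a b) (x, s)) (y - x) =
      ∫ s in a..b, (f (y, s) - f (x, s) - fderivFst f (D ×ˢ Icc a b) (x, s) (y - x)) := by
    rw [intervalIntegral.integral_sub ((hint hy.1).sub (hint hx)),
      intervalIntegral.integral_sub (hint hy.1) (hint hx),
      ContinuousLinearMap.intervalIntegral_apply hi']
    exact (continuousOn_section hf' hx |>.clm_apply continuousOn_const).intervalIntegrable_of_Icc
      hab.le
  rw [heq]
  refine (intervalIntegral.norm_integral_le_of_norm_le_const fun s hs => hest s ?_).trans ?_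
  · rw [uIoc_of_le hab.le] at hs; exact Ioc_subset_Icc_self hs
  · rw [abs_of_pos hpos]
    apply le_of_eq; field_simp

omit hc in
lemma contDiffOn_fderivFst {f : P × ℝ → F} {n m : WithTop ℕ∞} (hmn : m + 1 ≤ n)
    (hf : ContDiffOn ℝ n f (D ×ˢ Icc a b)) :
    ContDiffOn ℝ m (fderivFst f (D ×ˢ Icc a b)) (D ×ˢ Icc a b) :=
  (hf.fderivWithin (hD.prod (uniqueDiffOn_Icc hab)) hmn).clm_comp contDiffOn_const

lemma fderivWithin_integral [CompleteSpace F] {f : P × ℝ → F}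
    (hf : ContDiffOn ℝ 1 f (D ×ˢ Icc a b))
    {x : P} (hx : x ∈ D) : fderivWithin ℝ (fun y => ∫ s in a..b, f (y, s)) D x =
      ∫ s in a..b, fderivFst f (D ×ˢ Icc a b) (x, s) :=
  (hasFDerivWithinAt_integral hab hD hc hf hx).fderivWithin (hD x hx)

omit hab in
/-- Integrals of smooth functions depend smoothly on parameters in a locally convex set. -/
lemma contDiffOn_integral [CompleteSpace F] {f : P × ℝ → F} (hab : a ≤ b)
    (hf : ContDiffOn ℝ ∞ f (D ×ˢ Icc a b)) :
    ContDiffOn ℝ ∞ (fun y => ∫ s in a..b, f (y, s)) D := by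
  rcases hab.eq_or_lt with rfl | hab
  · simpa using contDiffOn_const
  rw [contDiffOn_infty]
  intro n
  induction n generalizing F with
  | zero =>
    exact (contDiffOn_zero.2 fun x hx => (hasFDerivWithinAt_integral hab hD hc
      (hf.of_le (by norm_cast)) hx).continuousWithinAt)
  | succ n ih =>
    have hf1 : ContDiffOn ℝ 1 f (D ×ˢ Icc a b) := hf.of_le (by norm_cast)
    rw [show ((n + 1 : ℕ) : WithTop ℕ∞) = (n : WithTop ℕ∞) + 1 by push_cast; rfl]
    refine contDiffOn_succ_of_fderivWithin (fun x hx =>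
      (hasFDerivWithinAt_integral hab hD hc hf1 hx).differentiableWithinAt) (by simp) ?_
    refine (ih (contDiffOn_fderivFst hab hD (m := ∞) (by simp) hf)).congr fun x hx => ?_
    exact fderivWithin_integral hab hD hc hf1 hx

end ParametricIntegral

/-! ### Taylor expansion at a critical submanifold -/

section Taylor

variable {E : Type} [NormedAddCommGroup E] [InnerProductSpace ℝ E] [FiniteDimensional ℝ E]

local notation "⟪" x ", " y "⟫" => inner ℝ x y

/-- The coefficient `∫₀¹ (1 - s) D²f(z - (1 - s) π z) ds` of the Taylor expansion of `f` around
the projection `z - π z`. -/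
def taylorCoeff (π : E →L[ℝ] E) (f : E → ℝ) (z : E) : E →L[ℝ] E →L[ℝ] ℝ :=
  ∫ s in (0 : ℝ)..1, (1 - s) • fderiv ℝ (fderiv ℝ f) (z - (1 - s) • π z)

/-- Taylor's formula of order two along the segment from `z - π z` to `z`, for a function that
vanishes to first order at `z - π z`. -/
lemma taylor_quadratic {f : E → ℝ} {Ω : Set E} (hΩ : IsOpen Ω) (hf : ContDiffOn ℝ ∞ f Ω)
    {π : E →L[ℝ] E} {z : E} (hseg : ∀ s ∈ Icc (0 : ℝ) 1, z - (1 - s) • π z ∈ Ω)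
    (h0 : f (z - π z) = 0) (h1 : fderiv ℝ f (z - π z) = 0) :
    f z = taylorCoeff π f z (π z) (π z) := by
  set c : ℝ → E := fun s => z - (1 - s) • π z with hc
  have hcd : ∀ s, HasDerivAt c (π z) s := fun s => by
    have h2 : HasDerivAt (fun s : ℝ => (1 - s) • π z) ((-1 : ℝ) • π z) s :=
      ((hasDerivAt_id s).const_sub 1).smul_const (π z)
    have := h2.const_sub z
    simpa using this
  have hfd : ContDiffOn ℝ ∞ (fderiv ℝ f) Ω := hf.fderiv_of_isOpen hΩ (by simp)
  have hfdd : ContinuousOn (fderiv ℝ (fderiv ℝ f)) Ω :=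
    hfd.continuousOn_fderiv_of_isOpen hΩ (by simp)
  have hcc : Continuous c := by fun_prop
  have hone : ContinuousOn (fun s : ℝ => 1 - s) (Icc 0 1) := by fun_prop
  have hcont : ContinuousOn (fun s => (1 - s) • fderiv ℝ (fderiv ℝ f) (c s)) (Icc 0 1) :=
    hone.smul (hfdd.comp hcc.continuousOn fun s hs => hseg s hs)
  have hG : ∀ s ∈ Icc (0 : ℝ) 1, HasDerivAt (fun s => (1 - s) * fderiv ℝ f (c s) (π z) + f (c s))
      ((1 - s) * fderiv ℝ (fderiv ℝ f) (c s) (π z) (π z)) s := fun s hs => by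
    have hm := hΩ.mem_nhds (hseg s hs)
    have h2 : HasDerivAt (fun s => f (c s)) (fderiv ℝ f (c s) (π z)) s :=
      ((hf.contDiffAt hm).differentiableAt (by simp)).hasFDerivAt.comp_hasDerivAt s (hcd s)
    have h3 : HasDerivAt (fun s => fderiv ℝ f (c s)) (fderiv ℝ (fderiv ℝ f) (c s) (π z)) s :=
      ((hfd.contDiffAt hm).differentiableAt (by simp)).hasFDerivAt.comp_hasDerivAt s (hcd s)
    have h4 : HasDerivAt (fun s => fderiv ℝ f (c s) (π z))
        (fderiv ℝ (fderiv ℝ f) (c s) (π z) (π z)) s := by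
      have := h3.clm_apply (hasDerivAt_const s (π z))
      simpa using this
    have h5 := (((hasDerivAt_id s).const_sub 1).mul h4).add h2
    refine h5.congr_deriv ?_
    simp
  have hint : IntervalIntegrable (fun s => (1 - s) • fderiv ℝ (fderiv ℝ f) (c s))
      MeasureTheory.volume 0 1 := hcont.intervalIntegrable_of_Icc zero_le_one
  have hcont2 : ContinuousOn (fun s => ((1 - s) • fderiv ℝ (fderiv ℝ f) (c s)) (π z)) (Icc 0 1) :=
    hcont.clm_apply continuousOn_const
  have hcont3 : ContinuousOn (fun s => ((1 - s) • fderiv ℝ (fderiv ℝ f) (c s)) (π z) (π z))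
      (Icc 0 1) := hcont2.clm_apply continuousOn_const
  have hev : taylorCoeff π f z (π z) (π z) =
      ∫ s in (0 : ℝ)..1, (1 - s) * fderiv ℝ (fderiv ℝ f) (c s) (π z) (π z) := by
    rw [taylorCoeff, ContinuousLinearMap.intervalIntegral_apply hint,
      ContinuousLinearMap.intervalIntegral_apply (hcont2.intervalIntegrable_of_Icc zero_le_one)]
    rfl
  have hFT := intervalIntegral.integral_eq_sub_of_hasDerivAt (a := 0) (b := 1)
    (fun s hs => hG s (by rwa [uIcc_of_le zero_le_one] at hs))
    (hcont3.intervalIntegrable_of_Icc zero_le_one)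
  rw [hev]
  refine Eq.trans ?_ hFT.symm
  have e0 : c 0 = z - π z := by simp [hc]
  have e1 : c 1 = z := by simp [hc]
  simp only [e0, e1, h0, h1]
  simp

lemma taylorCoeff_of_eq_zero {f : E → ℝ} {π : E →L[ℝ] E} {z : E} (hz : π z = 0) :
    taylorCoeff π f z = (1 / 2 : ℝ) • fderiv ℝ (fderiv ℝ f) z := by
  simp only [taylorCoeff, hz, smul_zero, sub_zero]
  refine (intervalIntegral.integral_smul_const (fun s : ℝ => 1 - s) _).trans ?_
  congr 1
  rw [intervalIntegral.integral_sub (by simp) (by simp)]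
  simp; norm_num

lemma contDiffOn_taylorCoeff {f : E → ℝ} {Ω : Set E} (hΩ : IsOpen Ω) (hf : ContDiffOn ℝ ∞ f Ω)
    {π : E →L[ℝ] E} {B : Set E} (hB : IsOpen B)
    (hseg : ∀ z ∈ B, ∀ s ∈ Icc (0 : ℝ) 1, z - (1 - s) • π z ∈ Ω) :
    ContDiffOn ℝ ∞ (taylorCoeff π f) B := by
  have hfd : ContDiffOn ℝ ∞ (fderiv ℝ (fderiv ℝ f)) Ω :=
    (hf.fderiv_of_isOpen hΩ (m := ∞) (by simp)).fderiv_of_isOpen hΩ (by simp)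
  refine contDiffOn_integral (f := fun q : E × ℝ =>
    (1 - q.2) • fderiv ℝ (fderiv ℝ f) (q.1 - (1 - q.2) • π q.1)) hB.uniqueDiffOn
    ?_ zero_le_one ?_
  · have := (Convex.isLocallyConvex (convex_univ (𝕜 := ℝ) (E := E))).inter_open hB
    rwa [univ_inter] at this
  · have h1 : ContDiffOn ℝ ∞ (fun q : E × ℝ => 1 - q.2) (B ×ˢ Icc 0 1) := by fun_prop
    have h2 : ContDiffOn ℝ ∞ (fun q : E × ℝ => q.1 - (1 - q.2) • π q.1) (B ×ˢ Icc 0 1) := by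
      fun_prop
    refine h1.smul (hfd.comp h2 ?_)
    rintro ⟨z, s⟩ ⟨hz, hs⟩
    exact hseg z hz s hs

lemma taylorCoeff_symm {f : E → ℝ} {Ω : Set E} (hΩ : IsOpen Ω) (hf : ContDiffOn ℝ ∞ f Ω)
    {π : E →L[ℝ] E} {z : E} (hseg : ∀ s ∈ Icc (0 : ℝ) 1, z - (1 - s) • π z ∈ Ω) (v w : E) :
    taylorCoeff π f z v w = taylorCoeff π f z w v := by
  have hfd : ContinuousOn (fderiv ℝ (fderiv ℝ f)) Ω :=
    (hf.fderiv_of_isOpen hΩ (m := ∞) (by simp)).continuousOn_fderiv_of_isOpen hΩ (by simp)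
  have hone : ContinuousOn (fun s : ℝ => 1 - s) (Icc 0 1) := by fun_prop
  have hseg' : ContinuousOn (fun s : ℝ => z - (1 - s) • π z) (Icc 0 1) := by fun_prop
  have hcont : ContinuousOn (fun s : ℝ => (1 - s) • fderiv ℝ (fderiv ℝ f) (z - (1 - s) • π z))
      (Icc 0 1) :=
    hone.smul (hfd.comp hseg' fun s hs => hseg s hs)
  have hev : ∀ v w, taylorCoeff π f z v w =
      ∫ s in (0 : ℝ)..1, (1 - s) * fderiv ℝ (fderiv ℝ f) (z - (1 - s) • π z) v w := fun v w => by
    rw [taylorCoeff, ContinuousLinearMap.intervalIntegral_apply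
        (hcont.intervalIntegrable_of_Icc zero_le_one),
      ContinuousLinearMap.intervalIntegral_apply
        ((hcont.clm_apply continuousOn_const).intervalIntegrable_of_Icc zero_le_one)]
    rfl
  rw [hev, hev]
  refine intervalIntegral.integral_congr fun s hs => ?_
  rw [uIcc_of_le zero_le_one] at hs
  have h1 : IsSymmSndFDerivAt ℝ f (z - (1 - s) • π z) :=
    (hf.contDiffAt (hΩ.mem_nhds (hseg s hs))).isSymmSndFDerivAt (by simp; norm_cast)
  rw [h1 v w]

/-- The operator representing a bilinear form. -/
lemma exists_sharp : ∃ T : (E →L[ℝ] E →L[ℝ] ℝ) →L[ℝ] (E →L[ℝ] E), ∀ A v w,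
    ⟪T A v, w⟫ = A v w := by
  let e := stdOrthonormalBasis ℝ E
  let T : (E →L[ℝ] E →L[ℝ] ℝ) →ₗ[ℝ] (E →L[ℝ] E) :=
    { toFun := fun A => ∑ i, ((ContinuousLinearMap.apply ℝ ℝ (e i)).comp A).smulRight (e i)
      map_add' := fun A B => by
        ext v; simp [add_smul, Finset.sum_add_distrib]
      map_smul' := fun c A => by
        ext v; simp [mul_smul, Finset.smul_sum] }
  let T' : (E →L[ℝ] E →L[ℝ] ℝ) →L[ℝ] (E →L[ℝ] E) := LinearMap.toContinuousLinearMap T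
  refine ⟨T', fun A v w => ?_⟩
  have h1 : T A v = ∑ i, A v (e i) • e i := by simp [T]
  change ⟪T A v, w⟫ = _
  rw [h1, sum_inner]
  conv_rhs => rw [← e.sum_repr' w, map_sum]
  refine Finset.sum_congr rfl fun i _ => ?_
  rw [real_inner_smul_left, map_smul, smul_eq_mul, mul_comm]

end Taylor

section NormalForm

variable {E : Type} [NormedAddCommGroup E] [InnerProductSpace ℝ E] [FiniteDimensional ℝ E]

local notation "⟪" x ", " y "⟫" => inner ℝ x y

/-- The square root of a positive definite operator commutes with the orthogonal projections that
commute with the operator. -/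
lemma IsPosDef.posSqrt_comm {B π : E →L[ℝ] E} (hB : IsPosDef B) (hπ : IsSelfAdjoint π)
    (hππ : π * π = π) (h : π * B = B * π) :
    π * MorseBottForms.posSqrt B = MorseBottForms.posSqrt B * π := by
  set S := MorseBottForms.posSqrt B with hS
  -- the reflection `R` conjugates `S` to a square root of `B`, hence to `S`
  set R : E →L[ℝ] E := (2 : ℝ) • π - 1 with hR
  have hRs : IsSelfAdjoint R := by
    rw [IsSelfAdjoint, hR, star_sub, star_smul, hπ.star_eq, star_one]; simp
  have hRR : R * R = 1 := by
    rw [hR]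
    simp only [sub_mul, mul_sub, smul_mul_assoc, mul_smul_comm, hππ, one_mul, mul_one]
    module
  have hRB : R * B = B * R := by
    rw [hR]; simp only [sub_mul, mul_sub, smul_mul_assoc, mul_smul_comm, h, one_mul, mul_one]
  have hpos : IsPosDef (R * S * R) := by
    refine ⟨?_, fun v hv => ?_⟩
    · rw [IsSelfAdjoint, star_mul, star_mul, hRs.star_eq, hB.posSqrt.1.star_eq, mul_assoc]
    · have h1 : ⟪(R * S * R) v, v⟫ = ⟪S (R v), R v⟫ := inner_map_comm hRs _ _
      rw [h1]
      refine hB.posSqrt.2 _ fun h0 => hv ?_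
      have : R (R v) = v := by
        have := congrArg (fun T : E →L[ℝ] E => T v) hRR
        simpa using this
      rw [← this, h0, map_zero]
  have hsq : R * S * R * (R * S * R) = B := by
    have : R * S * R * (R * S * R) = R * (S * (R * R) * S) * R := by noncomm_ring
    rw [this, hRR, mul_one, hB.posSqrt_mul_self, hRB, mul_assoc, hRR, mul_one]
  have hkey := hB.posSqrt_eq hpos hsq
  have h1 : R * S = S * R := by
    conv_rhs => rw [hS, hkey]
    rw [mul_assoc, hRR, mul_one]
  rw [hR] at h1
  simp only [sub_mul, mul_sub, smul_mul_assoc, mul_smul_comm, one_mul, mul_one,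
    sub_left_inj] at h1
  exact smul_right_injective _ two_ne_zero h1

/-- The bilinear form `A` along the image of `π`, completed to an operator on the whole space. -/
def blockOp (T : (E →L[ℝ] E →L[ℝ] ℝ) →L[ℝ] (E →L[ℝ] E)) (π : E →L[ℝ] E)
    (A : E →L[ℝ] E →L[ℝ] ℝ) : E →L[ℝ] E := π * T A * π + (1 - π)

variable {T : (E →L[ℝ] E →L[ℝ] ℝ) →L[ℝ] (E →L[ℝ] E)} (hT : ∀ A v w, ⟪T A v, w⟫ = A v w)
  {π : E →L[ℝ] E} (hπ : IsSelfAdjoint π) (hππ : π * π = π)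
include hT hπ hππ

omit hππ in
lemma inner_blockOp (A : E →L[ℝ] E →L[ℝ] ℝ) (v w : E) :
    ⟪blockOp T π A v, w⟫ = A (π v) (π w) + ⟪v - π v, w⟫ := by
  have : blockOp T π A v = π (T A (π v)) + (v - π v) := rfl
  rw [this, inner_add_left, inner_map_comm hπ, hT]

omit hππ in
lemma blockOp_isSelfAdjoint {A : E →L[ℝ] E →L[ℝ] ℝ} (hA : ∀ v w, A v w = A w v) :
    IsSelfAdjoint (blockOp T π A) := by
  rw [ContinuousLinearMap.isSelfAdjoint_iff_isSymmetric]
  intro v w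
  change ⟪blockOp T π A v, w⟫ = ⟪v, blockOp T π A w⟫
  rw [real_inner_comm (blockOp T π A w), inner_blockOp hT hπ, inner_blockOp hT hπ, hA,
    inner_sub_left, inner_sub_left, inner_map_comm hπ, real_inner_comm v,
    real_inner_comm (π w)]

lemma blockOp_isPosDef {A : E →L[ℝ] E →L[ℝ] ℝ} (hA : ∀ v w, A v w = A w v)
    (hpos : ∀ v, π v ≠ 0 → 0 < A (π v) (π v)) : IsPosDef (blockOp T π A) := by
  refine ⟨blockOp_isSelfAdjoint hT hπ hA, fun v hv => ?_⟩
  rw [inner_blockOp hT hπ]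
  have hπ2 : π (π v) = π v := congrArg (fun L : E →L[ℝ] E => L v) hππ
  have h1 : ⟪v - π v, v⟫ = ‖v - π v‖ ^ 2 := by
    rw [← real_inner_self_eq_norm_sq, inner_sub_right (v - π v) v (π v),
      ← inner_map_comm hπ (v - π v) v, map_sub, hπ2, sub_self, inner_zero_left, sub_zero]
  rw [h1]
  by_cases h0 : π v = 0
  · rw [h0, sub_zero, map_zero, zero_add]; positivity
  · have := hpos v h0; positivity

omit hT hπ in
lemma proj_mul_blockOp (A : E →L[ℝ] E →L[ℝ] ℝ) : π * blockOp T π A = blockOp T π A * π := by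
  rw [blockOp, mul_add, add_mul, mul_sub, sub_mul, hππ]
  simp only [mul_assoc, hππ, mul_one, one_mul]
  rw [← mul_assoc π π, hππ]

/-- The norm of the normal form coordinates computes the quadratic form. -/
lemma norm_sq_proj_sqrt {A : E →L[ℝ] E →L[ℝ] ℝ} (hB : IsPosDef (blockOp T π A)) (z : E) :
    ‖π (posSqrt (blockOp T π A) (π z) + (z - π z))‖ ^ 2 = A (π z) (π z) := by
  have hπ2 : ∀ v, π (π v) = π v := fun v => congrArg (fun L : E →L[ℝ] E => L v) hππ
  have hc : ∀ v, π (posSqrt (blockOp T π A) v) = posSqrt (blockOp T π A) (π v) := fun v =>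
    congrArg (fun L : E →L[ℝ] E => L v) (hB.posSqrt_comm hπ hππ (proj_mul_blockOp hππ A))
  have hs : ∀ v, posSqrt (blockOp T π A) (posSqrt (blockOp T π A) v) = blockOp T π A v := fun v =>
    congrArg (fun L : E →L[ℝ] E => L v) hB.posSqrt_mul_self
  rw [map_add, map_sub, hπ2, sub_self, add_zero, hc, hπ2, ← real_inner_self_eq_norm_sq,
    inner_map_comm hB.posSqrt.1, real_inner_comm, hs, inner_blockOp hT hπ, hπ2, sub_self,
    inner_zero_left, add_zero]

end NormalForm

/-! ### The Morse–Bott lemma with parameters -/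

section Isotopy

variable {E : Type} [NormedAddCommGroup E] [InnerProductSpace ℝ E] [FiniteDimensional ℝ E]

lemma isCompact_geomSimplex (p : ℕ) : IsCompact (geomSimplex p) := by
  have h : geomSimplex p = Fin.tail '' stdSimplex ℝ (Fin (p + 1)) := by
    ext s
    constructor
    · exact fun hs => ⟨bary s, hs, tail_bary s⟩
    · rintro ⟨t, ht, rfl⟩
      change bary (Fin.tail t) ∈ stdSimplex ℝ (Fin (p + 1))
      rwa [bary_tail ht.2]
  rw [h]
  exact (isCompact_stdSimplex ℝ _).image (by unfold Fin.tail; fun_prop)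

/-- The point of the simplex obtained by moving `t` towards the vertex `i`; it is `t` at time `1`
and the vertex at time `0`. -/
def contractTo {p : ℕ} (i : Fin (p + 1)) (t : Fin p → ℝ) (s : ℝ) : Fin p → ℝ :=
  s • t + (1 - s) • geomVertex i

lemma geomVertex_mem {p : ℕ} (i : Fin (p + 1)) : geomVertex i ∈ geomSimplex p := by
  change bary (geomVertex i) ∈ stdSimplex ℝ (Fin (p + 1))
  rw [bary_geomVertex]
  exact single_mem_stdSimplex ℝ i

lemma contractTo_mem {p : ℕ} (i : Fin (p + 1)) {t : Fin p → ℝ} (ht : t ∈ geomSimplex p) {s : ℝ}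
    (hs : s ∈ Icc (0 : ℝ) 1) : contractTo i t s ∈ geomSimplex p :=
  convex_geomSimplex p ht (geomVertex_mem i) hs.1 (sub_nonneg.2 hs.2) (by ring)

lemma contractTo_one {p : ℕ} (i : Fin (p + 1)) (t : Fin p → ℝ) : contractTo i t 1 = t := by
  simp [contractTo]

lemma contractTo_zero {p : ℕ} (i : Fin (p + 1)) (t : Fin p → ℝ) :
    contractTo i t 0 = geomVertex i := by
  simp [contractTo]

lemma contractTo_vertex {p : ℕ} (i : Fin (p + 1)) (s : ℝ) :
    contractTo i (geomVertex i) s = geomVertex i := by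
  rw [contractTo, ← add_smul]; simp

lemma contDiff_contractTo {p : ℕ} (i : Fin (p + 1)) :
    ContDiff ℝ ∞ fun q : (Fin p → ℝ) × ℝ => contractTo i q.1 q.2 := by
  unfold contractTo; fun_prop

/-- The Morse–Bott lemma with parameters: near `z₀`, and uniformly for `t` in the simplex, the
convex combinations of the functions `f j` are the square of the norm of the component `π Ψ` of a
coordinate system `Ψ`. -/
lemma exists_normal_form {p : ℕ} {π : E →L[ℝ] E} (hπ : IsSelfAdjoint π) (hππ : π * π = π)
    {Ω : Set E} (hΩ : IsOpen Ω) {z₀ : E} (hz₀ : z₀ ∈ Ω) (hπz₀ : π z₀ = 0)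
    {f : Fin (p + 1) → E → ℝ} (hf : ∀ j, ContDiffOn ℝ ∞ (f j) Ω)
    (hnn : ∀ j, ∀ z ∈ Ω, 0 ≤ f j z) (hzero : ∀ j, ∀ z ∈ Ω, π z = 0 → f j z = 0)
    (hpos : ∀ j v, π v ≠ 0 → 0 < fderiv ℝ (fderiv ℝ (f j)) z₀ (π v) (π v)) :
    ∃ (O : Set (E × (Fin p → ℝ))) (Ψ : E × (Fin p → ℝ) → E), IsOpen O ∧
      {z₀} ×ˢ geomSimplex p ⊆ O ∧ ContDiffOn ℝ ∞ Ψ O ∧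
      (∀ q ∈ O, q.1 ∈ Ω ∧ ∑ j, bary q.2 j * f j q.1 = ‖π (Ψ q)‖ ^ 2) ∧
      (∀ t, Ψ (z₀, t) = z₀) ∧
      ∀ t ∈ geomSimplex p, ∀ v, fderiv ℝ Ψ (z₀, t) (v, 0) = 0 → v = 0 := by
  obtain ⟨T, hT⟩ := exists_sharp (E := E)
  have hπ2 : ∀ v, π (π v) = π v := fun v => congrArg (fun L : E →L[ℝ] E => L v) hππ
  -- a neighbourhood on which the segments to the image of `1 - π` stay in `Ω`
  obtain ⟨U, hUo, hzU, hseg⟩ : ∃ U : Set E, IsOpen U ∧ z₀ ∈ U ∧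
      ∀ z ∈ U, ∀ s ∈ Icc (0 : ℝ) 1, z - (1 - s) • π z ∈ Ω := by
    have h1 : ∀ᶠ z in 𝓝 z₀, ∀ s ∈ Icc (0 : ℝ) 1, z - (1 - s) • π z ∈ Ω := by
      refine isCompact_Icc.eventually_forall_of_forall_eventually fun s hs => ?_
      have hc : Continuous fun q : E × ℝ => q.1 - (1 - q.2) • π q.1 := by fun_prop
      refine hc.continuousAt.eventually (hΩ.mem_nhds ?_)
      simpa [hπz₀] using hz₀
    obtain ⟨U, hU, hUo, hz⟩ := eventually_nhds_iff.1 h1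
    exact ⟨U, hUo, hz, hU⟩
  have hUΩ : ∀ z ∈ U, z ∈ Ω := fun z hz => by
    simpa using hseg z hz 1 ⟨zero_le_one, le_rfl⟩
  have htay : ∀ j, ∀ z ∈ U, f j z = taylorCoeff π (f j) z (π z) (π z) := fun j z hz => by
    have hm : z - π z ∈ Ω := by simpa using hseg z hz 0 ⟨le_rfl, zero_le_one⟩
    have h0 : f j (z - π z) = 0 := hzero j _ hm (by rw [map_sub, hπ2, sub_self])
    refine taylor_quadratic hΩ (hf j) (hseg z hz) h0 (IsLocalMin.fderiv_eq_zero ?_)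
    filter_upwards [hΩ.mem_nhds hm] with w hw
    rw [h0]; exact hnn j w hw
  let A : E × (Fin p → ℝ) → E →L[ℝ] E →L[ℝ] ℝ := fun q =>
    ∑ j, bary q.2 j • taylorCoeff π (f j) q.1
  let B : E × (Fin p → ℝ) → E →L[ℝ] E := fun q => blockOp T π (A q)
  have hbary : ∀ j, ContDiff ℝ ∞ fun q : E × (Fin p → ℝ) => bary q.2 j := fun j =>
    (contDiff_pi.1 contDiff_bary j).comp contDiff_snd
  have hAs : ContDiffOn ℝ ∞ A (U ×ˢ univ) := by
    refine ContDiffOn.sum fun j _ => (hbary j).contDiffOn.smul ?_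
    exact (contDiffOn_taylorCoeff hΩ (hf j) hUo hseg).comp contDiff_fst.contDiffOn
      fun q hq => hq.1
  have hBs : ContDiffOn ℝ ∞ B (U ×ˢ univ) := by
    have h1 : ContDiffOn ℝ ∞ (fun q => T (A q)) (U ×ˢ univ) := T.contDiff.comp_contDiffOn hAs
    exact (((contDiff_const (c := π)).contDiffOn.clm_comp h1).clm_comp
      (contDiff_const (c := π)).contDiffOn).add contDiffOn_const
  have hAsymm : ∀ q ∈ U ×ˢ (univ : Set (Fin p → ℝ)), ∀ v w, A q v w = A q w v := fun q hq v w => by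
    simp only [A, sum_apply, smul_apply]
    exact Finset.sum_congr rfl fun j _ => by
      rw [taylorCoeff_symm hΩ (hf j) (hseg q.1 hq.1)]
  have hBsa : ∀ q ∈ U ×ˢ (univ : Set (Fin p → ℝ)), IsSelfAdjoint (B q) := fun q hq =>
    blockOp_isSelfAdjoint hT hπ (hAsymm q hq)
  have hUuo : IsOpen (U ×ˢ (univ : Set (Fin p → ℝ))) := hUo.prod isOpen_univ
  let O : Set (E × (Fin p → ℝ)) := {q | q ∈ U ×ˢ univ ∧ IsPosDef (B q)}
  have hO : IsOpen O := by
    rw [isOpen_iff_mem_nhds]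
    rintro q ⟨hq, hqp⟩
    have hqn := hUuo.mem_nhds hq
    filter_upwards [hqn, (hBs.contDiffAt hqn).continuousAt.eventually hqp.eventually] with q' h1 h2
    exact ⟨h1, h2 (hBsa q' h1)⟩
  have hKO : {z₀} ×ˢ geomSimplex p ⊆ O := by
    rintro ⟨z, t⟩ ⟨rfl, ht⟩
    have hm : (z, t) ∈ U ×ˢ (univ : Set (Fin p → ℝ)) := ⟨hzU, mem_univ _⟩
    refine ⟨hm, blockOp_isPosDef hT hπ hππ (hAsymm _ hm) fun v hv => ?_⟩
    simp only [A, sum_apply, smul_apply,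
      taylorCoeff_of_eq_zero hπz₀, smul_eq_mul]
    have hb : bary t ∈ stdSimplex ℝ (Fin (p + 1)) := ht
    obtain ⟨j, hj⟩ : ∃ j, bary t j ≠ 0 := by
      by_contra! hc
      have := hb.2
      simp [hc] at this
    refine Finset.sum_pos' (fun k _ => ?_) ⟨j, Finset.mem_univ _, ?_⟩
    · exact mul_nonneg (hb.1 k) (mul_nonneg (by norm_num) (hpos k v hv).le)
    · exact mul_pos (lt_of_le_of_ne (hb.1 j) hj.symm) (mul_pos (by norm_num) (hpos j v hv))
  have hS : ∀ q ∈ O, ContDiffAt ℝ ∞ (fun q => posSqrt (B q)) q := fun q hq =>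
    contDiffAt_posSqrt (hBs.contDiffAt (hUuo.mem_nhds hq.1))
      (by filter_upwards [hUuo.mem_nhds hq.1] with q' h using hBsa q' h) hq.2
  -- `B` is the identity on the image of `1 - π`, so only the component `π z` is rescaled
  refine ⟨O, fun q => posSqrt (B q) (π q.1) + (q.1 - π q.1), hO, hKO, fun q hq => ?_,
    fun q hq => ⟨hUΩ _ hq.1.1, ?_⟩, fun t => by simp [hπz₀], fun t ht v hv => ?_⟩
  · have h1 : ContDiffAt ℝ ∞ (fun q : E × (Fin p → ℝ) => π q.1) q := by fun_prop
    have h2 : ContDiffAt ℝ ∞ (fun q : E × (Fin p → ℝ) => q.1 - π q.1) q := by fun_prop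
    exact (((hS q hq).clm_apply h1).add h2).contDiffWithinAt
  · rw [norm_sq_proj_sqrt hT hπ hππ hq.2]
    simp only [A, sum_apply, smul_apply, smul_eq_mul]
    exact Finset.sum_congr rfl fun j _ => by rw [← htay j q.1 hq.1.1]
  · have hq := hKO (show (z₀, t) ∈ {z₀} ×ˢ geomSimplex p from ⟨rfl, ht⟩)
    have h1 : HasFDerivAt (fun q : E × (Fin p → ℝ) => π q.1)
        (π.comp (ContinuousLinearMap.fst ℝ E (Fin p → ℝ))) (z₀, t) :=
      π.hasFDerivAt.comp (z₀, t) hasFDerivAt_fst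
    have h2 := ((hS _ hq).differentiableAt (by simp)).hasFDerivAt.clm_apply h1
    have h3 := h2.add ((hasFDerivAt_fst (p := (z₀, t))).sub h1)
    have h4 := h3.fderiv
    have h5 : posSqrt (B (z₀, t)) (π v) + (v - π v) = 0 := by
      have h6 : fderiv ℝ (fun q => posSqrt (B q) (π q.1) + (q.1 - π q.1)) (z₀, t) = _ := h4
      rw [h6] at hv
      simpa [hπz₀] using hv
    have hc := hq.2.posSqrt_comm hπ hππ (proj_mul_blockOp hππ (A (z₀, t)))
    have hc' : π (posSqrt (B (z₀, t)) (π v)) = posSqrt (B (z₀, t)) (π v) := by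
      have := congrArg (fun L : E →L[ℝ] E => L (π v)) hc
      refine Eq.trans this ?_
      change posSqrt (B (z₀, t)) (π (π v)) = _
      rw [hπ2]
    have h7 : posSqrt (B (z₀, t)) (π v) = 0 := by
      have := congrArg π h5
      rwa [map_add, map_sub, hπ2, sub_self, add_zero, map_zero, hc'] at this
    have h8 : π v = 0 := by
      by_contra h0
      have := hq.2.posSqrt.2 (π v) h0
      rw [h7, inner_zero_left] at this
      exact lt_irrefl _ this
    rw [h7, h8] at h5
    simpa using h5

/-- The isotopy `g(·, t, s)` moving the function with barycentric coordinates `t` to the one with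
barycentric coordinates `contractTo i t s`. In the coordinates of the Morse–Bott lemma both are the
same function, so `g` composes one coordinate system with the inverse of the other. -/
lemma exists_isotopy {p : ℕ} {π : E →L[ℝ] E} (hπ : IsSelfAdjoint π) (hππ : π * π = π)
    {Ω : Set E} (hΩ : IsOpen Ω) {z₀ : E} (hz₀ : z₀ ∈ Ω) (hπz₀ : π z₀ = 0)
    {f : Fin (p + 1) → E → ℝ} (hf : ∀ j, ContDiffOn ℝ ∞ (f j) Ω)
    (hnn : ∀ j, ∀ z ∈ Ω, 0 ≤ f j z) (hzero : ∀ j, ∀ z ∈ Ω, π z = 0 → f j z = 0)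
    (hpos : ∀ j v, π v ≠ 0 → 0 < fderiv ℝ (fderiv ℝ (f j)) z₀ (π v) (π v)) (i : Fin (p + 1)) :
    ∃ (V : Set E) (Q : Set ((E × (Fin p → ℝ)) × ℝ)) (g : (E × (Fin p → ℝ)) × ℝ → E),
      IsOpen V ∧ z₀ ∈ V ∧ V ⊆ Ω ∧ IsOpen Q ∧ (V ×ˢ geomSimplex p) ×ˢ Icc 0 1 ⊆ Q ∧
      ContDiffOn ℝ ∞ g Q ∧ MapsTo g Q Ω ∧
      (∀ q ∈ (V ×ˢ geomSimplex p) ×ˢ Icc (0 : ℝ) 1,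
        ∑ j, bary (contractTo i q.1.2 q.2) j * f j (g q) = ∑ j, bary q.1.2 j * f j q.1.1) ∧
      (∀ z ∈ V, ∀ t ∈ geomSimplex p, g ((z, t), 1) = z) ∧
      (∀ z ∈ V, ∀ s ∈ Icc (0 : ℝ) 1, g ((z, geomVertex i), s) = z) := by
  obtain ⟨O, Ψ, hO, hKO, hΨ, hnorm, hΨ₀, hinj⟩ :=
    exists_normal_form hπ hππ hΩ hz₀ hπz₀ hf hnn hzero hpos
  have hΨat : ∀ q ∈ O, ContDiffAt ℝ ∞ Ψ q := fun q hq => hΨ.contDiffAt (hO.mem_nhds hq)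
  let Φ : E × (Fin p → ℝ) → E × (Fin p → ℝ) := fun q => (Ψ q, q.2)
  have hK : IsCompact (({z₀} : Set E) ×ˢ geomSimplex p) :=
    isCompact_singleton.prod (isCompact_geomSimplex p)
  obtain ⟨O₁, O₂, Θ, hO₁, hKO₁, hO₁O, hO₂, hKO₂, hΘ, hΘm, hr, hl⟩ :=
    exists_inverse_near_compact (f := Φ) hK hO hKO (hΨ.prodMk contDiff_snd.contDiffOn)
      (by
        rintro ⟨z, t⟩ ⟨hz, ht⟩ ⟨z', t'⟩ ⟨hz', ht'⟩ h
        exact Prod.ext ((mem_singleton_iff.1 hz).trans (mem_singleton_iff.1 hz').symm)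
          (Prod.ext_iff.1 h).2)
      (by
        rintro ⟨z, t⟩ ⟨hz, ht⟩
        obtain rfl : z = z₀ := hz
        have hzt : (z, t) ∈ ({z} : Set E) ×ˢ geomSimplex p := ⟨rfl, ht⟩
        have h1 : HasFDerivAt Φ ((fderiv ℝ Ψ (z, t)).prod (ContinuousLinearMap.snd ℝ E _)) (z, t) :=
          ((hΨat _ (hKO hzt)).differentiableAt (by simp)).hasFDerivAt.prodMk hasFDerivAt_snd
        rw [h1.fderiv, injective_iff_map_eq_zero]
        rintro ⟨v, τ⟩ h
        have h2 : τ = 0 := (Prod.ext_iff.1 h).2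
        subst h2
        rw [hinj t ht v (Prod.ext_iff.1 h).1]; rfl)
  have hΘ2 : ∀ q ∈ O₂, (Θ q).2 = q.2 := fun q hq => (Prod.ext_iff.1 (hr q hq)).2
  have hΘ1 : ∀ q ∈ O₂, Ψ (Θ q) = q.1 := fun q hq => (Prod.ext_iff.1 (hr q hq)).1
  let c : (E × (Fin p → ℝ)) × ℝ → E × (Fin p → ℝ) := fun q => (Ψ q.1, contractTo i q.1.2 q.2)
  let Q : Set ((E × (Fin p → ℝ)) × ℝ) := (Prod.fst ⁻¹' O₁) ∩ c ⁻¹' O₂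
  have hcs : ContDiffOn ℝ ∞ c (Prod.fst ⁻¹' O₁) := by
    refine (hΨ.comp contDiff_fst.contDiffOn fun q hq => hO₁O hq).prodMk ?_
    exact ((contDiff_contractTo i).comp
      (((contDiff_snd.comp contDiff_fst).prodMk contDiff_snd))).contDiffOn
  have hQ : IsOpen Q := hcs.continuousOn.isOpen_inter_preimage (hO₁.preimage continuous_fst) hO₂
  have hKQ : (({z₀} : Set E) ×ˢ (geomSimplex p ×ˢ Icc (0 : ℝ) 1)) ⊆
      (fun q : E × ((Fin p → ℝ) × ℝ) => ((q.1, q.2.1), q.2.2)) ⁻¹' Q := by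
    rintro ⟨z, t, s⟩ ⟨hz, ht, hs⟩
    obtain rfl : z = z₀ := hz
    refine ⟨hKO₁ ⟨rfl, ht⟩, hKO₂ ⟨(z, contractTo i t s), ⟨rfl, contractTo_mem i ht hs⟩, ?_⟩⟩
    change (Ψ (z, contractTo i t s), contractTo i t s) = (Ψ (z, t), contractTo i t s)
    rw [hΨ₀, hΨ₀]
  obtain ⟨V, W, hV, hW, hzV, hKW, hVW⟩ := generalized_tube_lemma isCompact_singleton
    ((isCompact_geomSimplex p).prod isCompact_Icc) (hQ.preimage (by fun_prop)) hKQ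
  have hVQ : ∀ z ∈ V, ∀ t ∈ geomSimplex p, ∀ s ∈ Icc (0 : ℝ) 1, ((z, t), s) ∈ Q :=
    fun z hz t ht s hs => hVW (show (z, t, s) ∈ V ×ˢ W from ⟨hz, hKW ⟨ht, hs⟩⟩)
  -- apply the coordinates at `t`, then the inverse coordinates at `contractTo i t s`
  have h0 : (0 : ℝ) ∈ Icc (0 : ℝ) 1 := ⟨le_rfl, zero_le_one⟩
  have h1 : (1 : ℝ) ∈ Icc (0 : ℝ) 1 := ⟨zero_le_one, le_rfl⟩
  refine ⟨V, Q, fun q => (Θ (c q)).1, hV, hzV rfl, fun z hz => ?_, hQ, ?_, ?_, ?_, ?_, ?_, ?_⟩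
  · exact (hnorm _ (hO₁O (hVQ z hz _ (geomVertex_mem i) 0 h0).1)).1
  · rintro ⟨⟨z, t⟩, s⟩ ⟨⟨hz, ht⟩, hs⟩
    exact hVQ z hz t ht s hs
  · exact contDiff_fst.comp_contDiffOn (hΘ.comp (hcs.mono inter_subset_left) fun q hq => hq.2)
  · exact fun q hq => (hnorm _ (hO₁O (hΘm hq.2))).1
  · rintro ⟨⟨z, t⟩, s⟩ ⟨⟨hz, ht⟩, hs⟩
    have hq := hVQ z hz t ht s hs
    have e1 := (hnorm _ (hO₁O (hΘm hq.2))).2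
    rw [hΘ1 _ hq.2, hΘ2 _ hq.2] at e1
    exact e1.trans (hnorm _ (hO₁O hq.1)).2.symm
  · intro z hz t ht
    have hq := (hVQ z hz t ht 1 h1).1
    have e1 : c ((z, t), 1) = Φ (z, t) := by
      change (Ψ (z, t), contractTo i t 1) = _
      rw [contractTo_one]
    change (Θ (c ((z, t), 1))).1 = z
    rw [e1, (hl _ hq).2]
  · intro z hz s hs
    have hq := (hVQ z hz _ (geomVertex_mem i) s hs).1
    have e1 : c ((z, geomVertex i), s) = Φ (z, geomVertex i) := by
      change (Ψ (z, geomVertex i), contractTo i (geomVertex i) s) = _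
      rw [contractTo_vertex]
    change (Θ (c ((z, geomVertex i), s))).1 = z
    rw [e1, (hl _ hq).2]

end Isotopy

/-! ### Hessians in slice charts -/

section Hessian

variable {E : Type} [NormedAddCommGroup E] [NormedSpace ℝ E] [FiniteDimensional ℝ E]

/-- The second derivative at a critical point transforms as a bilinear form under a change of
coordinates. -/
lemma fderiv_fderiv_comp {F : E → ℝ} {g : E → E} {w : E} (hg : ContDiffAt ℝ ∞ g w)
    (hF : ContDiffAt ℝ ∞ F (g w)) (hc : fderiv ℝ F (g w) = 0) (v v' : E) :
    fderiv ℝ (fderiv ℝ (fun z => F (g z))) w v v' =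
      fderiv ℝ (fderiv ℝ F) (g w) (fderiv ℝ g w v) (fderiv ℝ g w v') := by
  have hF2 : ∀ᶠ z in 𝓝 (g w), DifferentiableAt ℝ F z := by
    filter_upwards [(hF.of_le (m := 1) (by simp)).eventually (by simp)] with z hz
      using hz.differentiableAt one_ne_zero
  have hg2 : ∀ᶠ z in 𝓝 w, DifferentiableAt ℝ g z := by
    filter_upwards [(hg.of_le (m := 1) (by simp)).eventually (by simp)] with z hz
      using hz.differentiableAt one_ne_zero
  have h1 : fderiv ℝ (fun z => F (g z)) =ᶠ[𝓝 w]
      fun z => (fderiv ℝ F (g z)).comp (fderiv ℝ g z) := by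
    filter_upwards [hg.continuousAt.eventually hF2, hg2] with z h2 h3
    exact fderiv_comp z h2 h3
  have h4 : HasFDerivAt (fun z => fderiv ℝ F (g z))
      ((fderiv ℝ (fderiv ℝ F) (g w)).comp (fderiv ℝ g w)) w :=
    ((hF.fderiv_right (m := ∞) (by simp)).differentiableAt (by simp)).hasFDerivAt.comp w
      (hg.differentiableAt (by simp)).hasFDerivAt
  have h5 : HasFDerivAt (fderiv ℝ g) (fderiv ℝ (fderiv ℝ g) w) w :=
    ((hg.fderiv_right (m := ∞) (by simp)).differentiableAt (by simp)).hasFDerivAt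
  rw [h1.fderiv_eq, (h4.clm_comp h5).fderiv, hc]
  simp

lemma finrank_range_congr {H H' : E →L[ℝ] E →L[ℝ] ℝ} {L : E →L[ℝ] E} (hL : Function.Injective L)
    (h : ∀ v w, H v w = H' (L v) (L w)) :
    Module.finrank ℝ (LinearMap.range H.toLinearMap) =
      Module.finrank ℝ (LinearMap.range H'.toLinearMap) := by
  let e := LinearEquiv.ofInjectiveEndo L.toLinearMap hL
  have he : ∀ v, e v = L v := fun v => rfl
  have hk : LinearMap.ker H.toLinearMap =
      (LinearMap.ker H'.toLinearMap).map e.symm.toLinearMap := by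
    ext v
    rw [Submodule.mem_map_equiv, LinearEquiv.symm_symm, LinearMap.mem_ker, LinearMap.mem_ker]
    constructor
    · intro hv
      ext w
      obtain ⟨w', rfl⟩ := e.surjective w
      have := congrArg (fun l : E →L[ℝ] ℝ => l w') hv
      exact (h v w').symm.trans this
    · intro hv
      ext w
      have := congrArg (fun l : E →L[ℝ] ℝ => l (e w)) hv
      exact (h v w).trans this
  have h1 := LinearMap.finrank_range_add_finrank_ker H.toLinearMap
  have h2 := LinearMap.finrank_range_add_finrank_ker H'.toLinearMap
  rw [hk, LinearEquiv.finrank_map_eq] at h1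
  omega

variable {f : E → ℝ} {Ω : Set E} {w : E}

lemma deriv_line (hΩ : IsOpen Ω) (hf : ContDiffOn ℝ ∞ f Ω) (v : E) {s : ℝ} (hs : w + s • v ∈ Ω) :
    HasDerivAt (fun s : ℝ => f (w + s • v)) (fderiv ℝ f (w + s • v) v) s := by
  have hc : HasDerivAt (fun s : ℝ => w + s • v) v s := by
    simpa using ((hasDerivAt_id s).smul_const v).const_add w
  exact ((hf.contDiffAt (hΩ.mem_nhds hs)).differentiableAt
    (by simp)).hasFDerivAt.comp_hasDerivAt s hc

lemma deriv_deriv_line (hΩ : IsOpen Ω) (hf : ContDiffOn ℝ ∞ f Ω) (hw : w ∈ Ω) (v : E) :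
    deriv (deriv fun s : ℝ => f (w + s • v)) 0 = fderiv ℝ (fderiv ℝ f) w v v := by
  have hcc : Continuous fun s : ℝ => w + s • v := by fun_prop
  have hev : ∀ᶠ s : ℝ in 𝓝 0, w + s • v ∈ Ω :=
    hcc.continuousAt.eventually (hΩ.mem_nhds (by simpa using hw))
  have h1 : deriv (fun s : ℝ => f (w + s • v)) =ᶠ[𝓝 0] fun s => fderiv ℝ f (w + s • v) v := by
    filter_upwards [hev] with s hs using (deriv_line hΩ hf v hs).deriv
  have hc : HasDerivAt (fun s : ℝ => w + s • v) v 0 := by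
    simpa using ((hasDerivAt_id (0 : ℝ)).smul_const v).const_add w
  have hd : HasFDerivAt (fderiv ℝ f) (fderiv ℝ (fderiv ℝ f) w) (w + (0 : ℝ) • v) := by
    rw [zero_smul, add_zero]
    exact (((hf.contDiffAt (hΩ.mem_nhds hw)).fderiv_right (m := ∞) (by simp)).differentiableAt
      (by simp)).hasFDerivAt
  have h2 : HasDerivAt (fun s : ℝ => fderiv ℝ f (w + s • v) v) (fderiv ℝ (fderiv ℝ f) w v v) 0 := by
    have h3 : HasDerivAt (fun s : ℝ => fderiv ℝ f (w + s • v)) (fderiv ℝ (fderiv ℝ f) w v) 0 :=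
      hd.comp_hasDerivAt 0 hc
    have h4 := h3.clm_apply (hasDerivAt_const (0 : ℝ) v)
    rw [map_zero, add_zero] at h4
    exact h4
  rw [h1.deriv_eq, h2.deriv]

/-- The second derivative is positive semidefinite at a minimum. If it were negative in a direction,
the restriction to the line would also have a local maximum, hence be constant. -/
lemma hess_nonneg (hΩ : IsOpen Ω) (hf : ContDiffOn ℝ ∞ f Ω) (hw : w ∈ Ω)
    (hnn : ∀ z ∈ Ω, 0 ≤ f z) (h0 : f w = 0) (v : E) : 0 ≤ fderiv ℝ (fderiv ℝ f) w v v := by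
  by_contra! hneg
  rw [← deriv_deriv_line hΩ hf hw v] at hneg
  have hcc : Continuous fun s : ℝ => w + s • v := by fun_prop
  have hev : ∀ᶠ s : ℝ in 𝓝 0, w + s • v ∈ Ω :=
    hcc.continuousAt.eventually (hΩ.mem_nhds (by simpa using hw))
  have hmin : IsLocalMin (fun s : ℝ => f (w + s • v)) 0 := by
    filter_upwards [hev] with s hs
    simpa [h0] using hnn _ hs
  have hcont : ContinuousAt (fun s : ℝ => f (w + s • v)) 0 :=
    (deriv_line hΩ hf v (by simpa using hw)).continuousAt
  have hmax := isLocalMax_of_deriv_deriv_neg hneg hmin.deriv_eq_zero hcont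
  have hconst : (fun s : ℝ => f (w + s • v)) =ᶠ[𝓝 0] fun _ => f (w + (0 : ℝ) • v) := by
    filter_upwards [hmin, hmax] with s h1 h2 using le_antisymm h2 h1
  have h1 : deriv (fun s : ℝ => f (w + s • v)) =ᶠ[𝓝 0] fun _ => 0 := by
    filter_upwards [hconst.eventuallyEq_nhds] with s hs
    rw [hs.deriv_eq, deriv_const]
  rw [h1.deriv_eq, deriv_const] at hneg
  exact lt_irrefl _ hneg

/-- An isotropic vector of a positive semidefinite form lies in its kernel. -/
lemma eq_zero_of_hess_eq_zero {H : E →L[ℝ] E →L[ℝ] ℝ} (hs : ∀ v w, H v w = H w v)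
    (hnn : ∀ v, 0 ≤ H v v) {v : E} (hv : H v v = 0) : H v = 0 := by
  ext u
  by_contra hne
  have key : ∀ t : ℝ, 0 ≤ 2 * t * H v u + t ^ 2 * H u u := fun t => by
    have h1 := hnn (v + t • u)
    simp only [map_add, map_smul, add_apply, smul_apply, smul_eq_mul, hv, hs u v] at h1
    nlinarith
  set a := H v u
  set b := H u u
  have hb : 0 ≤ b := hnn u
  have hne' : a ≠ 0 := hne
  have h1 := key (-a / (b + 1))
  have hb1 : 0 < b + 1 := by linarith
  -- the quadratic polynomial `2 t a + t² b` takes a negative value at `t = -a / (b + 1)`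
  have h2 : 2 * (-a / (b + 1)) * a + (-a / (b + 1)) ^ 2 * b = -(a ^ 2 * (b + 2)) / (b + 1) ^ 2 := by
    field_simp; ring
  rw [h2] at h1
  have : -(a ^ 2 * (b + 2)) / (b + 1) ^ 2 < 0 := by
    apply div_neg_of_neg_of_pos
    · have : 0 < a ^ 2 := by positivity
      nlinarith
    · positivity
  linarith

lemma hess_symm (hΩ : IsOpen Ω) (hf : ContDiffOn ℝ ∞ f Ω) (hw : w ∈ Ω) (v v' : E) :
    fderiv ℝ (fderiv ℝ f) w v v' = fderiv ℝ (fderiv ℝ f) w v' v :=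
  (hf.contDiffAt (hΩ.mem_nhds hw)).isSymmSndFDerivAt (by simp; norm_cast) v v'

lemma hess_eq_zero_of_mem (hΩ : IsOpen Ω) (hf : ContDiffOn ℝ ∞ f Ω) {K : Submodule ℝ E}
    (hw : w ∈ Ω) (hwK : w ∈ K) (h0 : ∀ z ∈ Ω, z ∈ K → f z = 0) {v : E} (hv : v ∈ K) :
    fderiv ℝ (fderiv ℝ f) w v v = 0 := by
  rw [← deriv_deriv_line hΩ hf hw v]
  have hcc : Continuous fun s : ℝ => w + s • v := by fun_prop
  have hev : (fun s : ℝ => f (w + s • v)) =ᶠ[𝓝 0] fun _ => 0 := by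
    filter_upwards [hcc.continuousAt.eventually (hΩ.mem_nhds (by simpa using hw))] with s hs
    exact h0 _ hs (K.add_mem hwK (K.smul_mem s hv))
  have h1 : deriv (fun s : ℝ => f (w + s • v)) =ᶠ[𝓝 0] fun _ => 0 := by
    filter_upwards [hev.eventuallyEq_nhds] with s hs
    rw [hs.deriv_eq, deriv_const]
  rw [h1.deriv_eq, deriv_const]

/-- For a nonnegative function vanishing on a subspace, the rank of the second derivative is the
codimension of the subspace if and only if the second derivative is nondegenerate in the transverse
directions. -/
lemma finrank_hess_iff (hΩ : IsOpen Ω) (hf : ContDiffOn ℝ ∞ f Ω) {K : Submodule ℝ E}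
    (hw : w ∈ Ω) (hwK : w ∈ K) (hnn : ∀ z ∈ Ω, 0 ≤ f z) (h0 : ∀ z ∈ Ω, z ∈ K → f z = 0) {m : ℕ}
    (hK : Module.finrank ℝ K + m = Module.finrank ℝ E) :
    Module.finrank ℝ (LinearMap.range (fderiv ℝ (fderiv ℝ f) w).toLinearMap) = m ↔
      ∀ v, fderiv ℝ (fderiv ℝ f) w v v = 0 → v ∈ K := by
  set H := fderiv ℝ (fderiv ℝ f) w
  have h1 := LinearMap.finrank_range_add_finrank_ker H.toLinearMap
  have hker : ∀ v, H v v = 0 ↔ v ∈ LinearMap.ker H.toLinearMap := fun v => by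
    rw [LinearMap.mem_ker]
    constructor
    · exact fun hv => eq_zero_of_hess_eq_zero (hess_symm hΩ hf hw)
        (hess_nonneg hΩ hf hw hnn (h0 w hw hwK)) hv
    · intro hv
      have := congrArg (fun l : E →L[ℝ] ℝ => l v) hv
      simpa using this
  have hle : K ≤ LinearMap.ker H.toLinearMap := fun v hv =>
    (hker v).1 (hess_eq_zero_of_mem hΩ hf hw hwK h0 hv)
  constructor
  · intro hm v hv
    have : K = LinearMap.ker H.toLinearMap := Submodule.eq_of_le_of_finrank_eq hle (by omega)
    rw [this]; exact (hker v).1 hv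
  · intro h
    have : K = LinearMap.ker H.toLinearMap := le_antisymm hle fun v hv => h v ((hker v).2 hv)
    rw [← this] at h1
    omega

end Hessian

section Slice

universe u

variable {n m : ℕ} {X : Type u} [TopologicalSpace X] [ChartedSpace (EuclideanSpace ℝ (Fin n)) X]
  [IsManifold (𝓡 n) ∞ X] {Y : Set X}

/-- The subspace on which the first `m` coordinates vanish. -/
def sliceSubspace (n m : ℕ) : Submodule ℝ (EuclideanSpace ℝ (Fin n)) where
  carrier := {z | ∀ i : Fin n, (i : ℕ) < m → z i = 0}
  add_mem' ha hb i hi := by simp [ha i hi, hb i hi]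
  zero_mem' i _ := rfl
  smul_mem' c z hz i hi := by simp [hz i hi]

lemma finrank_sliceSubspace (h : m ≤ n) :
    Module.finrank ℝ (sliceSubspace n m) + m = Module.finrank ℝ (EuclideanSpace ℝ (Fin n)) := by
  let L : EuclideanSpace ℝ (Fin n) →ₗ[ℝ] (Fin m → ℝ) :=
    { toFun := fun z i => z (Fin.castLE h i)
      map_add' := fun _ _ => rfl
      map_smul' := fun _ _ => rfl }
  have hk : LinearMap.ker L = sliceSubspace n m := by
    ext z
    rw [LinearMap.mem_ker]
    constructor
    · intro hz i hi
      exact congrFun hz ⟨i, hi⟩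
    · intro hz
      funext i
      exact hz (Fin.castLE h i) i.2
  have hr : LinearMap.range L = ⊤ := by
    rw [LinearMap.range_eq_top]
    intro y
    refine ⟨WithLp.toLp 2 fun i => if hi : (i : ℕ) < m then y ⟨i, hi⟩ else 0, ?_⟩
    funext i
    exact dif_pos i.2
  have h1 := LinearMap.finrank_range_add_finrank_ker L
  rw [hk, hr, finrank_top, Module.finrank_fin_fun] at h1
  omega

variable {φ ψ : OpenPartialHomeomorph X (EuclideanSpace ℝ (Fin n))}

lemma contDiffOn_comp_chart (hφ : φ ∈ IsManifold.maximalAtlas (𝓡 n) ∞ X) {μ : X → ℝ}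
    (hμ : ContMDiff (𝓡 n) 𝓘(ℝ, ℝ) ∞ μ) : ContDiffOn ℝ ∞ (fun z => μ (φ.symm z)) φ.target := by
  rw [← contMDiffOn_iff_contDiffOn]
  exact hμ.comp_contMDiffOn (contMDiffOn_symm_of_mem_maximalAtlas hφ)

lemma contDiffAt_transition (hφ : φ ∈ IsManifold.maximalAtlas (𝓡 n) ∞ X)
    (hψ : ψ ∈ IsManifold.maximalAtlas (𝓡 n) ∞ X) {y : X} (hy : y ∈ φ.source) (hy' : y ∈ ψ.source) :
    ContDiffAt ℝ ∞ (fun z => ψ (φ.symm z)) (φ y) := by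
  rw [← contMDiffAt_iff_contDiffAt]
  have h1 : ContMDiffAt (𝓡 n) (𝓡 n) ∞ φ.symm (φ y) :=
    contMDiffAt_symm_of_mem_maximalAtlas hφ (φ.map_source hy)
  have h2 : ContMDiffAt (𝓡 n) (𝓡 n) ∞ ψ (φ.symm (φ y)) :=
    contMDiffAt_of_mem_maximalAtlas hψ (by rwa [φ.left_inv hy])
  exact h2.comp (φ y) h1

/-- The rank of the Hessian at a minimum can be computed in any chart. -/
lemma finrank_hess_chart (hφ : φ ∈ IsManifold.maximalAtlas (𝓡 n) ∞ X)
    (hψ : ψ ∈ IsManifold.maximalAtlas (𝓡 n) ∞ X) {y : X} (hy : y ∈ φ.source) (hy' : y ∈ ψ.source)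
    {μ : X → ℝ} (hμ : ContMDiff (𝓡 n) 𝓘(ℝ, ℝ) ∞ μ) (hnn : ∀ x, 0 ≤ μ x) (h0 : μ y = 0) :
    Module.finrank ℝ (LinearMap.range (fderiv ℝ (fderiv ℝ fun z => μ (φ.symm z)) (φ y)).toLinearMap)
      = Module.finrank ℝ
        (LinearMap.range (fderiv ℝ (fderiv ℝ fun z => μ (ψ.symm z)) (ψ y)).toLinearMap) := by
  have hg := contDiffAt_transition hφ hψ hy hy'
  have hg' := contDiffAt_transition hψ hφ hy' hy
  set g := fun z => ψ (φ.symm z) with hgdef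
  have hgy : g (φ y) = ψ y := by simp only [hgdef, φ.left_inv hy]
  have hF := (contDiffOn_comp_chart hψ hμ).contDiffAt (ψ.open_target.mem_nhds (ψ.map_source hy'))
  have hev : ∀ᶠ z in 𝓝 (φ y), z ∈ φ.target ∧ φ.symm z ∈ ψ.source := by
    have h1 := φ.open_target.mem_nhds (φ.map_source hy)
    refine Filter.Eventually.and h1 ((φ.continuousAt_symm (φ.map_source hy)).eventually ?_)
    rw [φ.left_inv hy]
    exact ψ.open_source.mem_nhds hy'
  have heq : (fun z => μ (φ.symm z)) =ᶠ[𝓝 (φ y)] fun z => μ (ψ.symm (g z)) := by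
    filter_upwards [hev] with z hz
    simp only [hgdef, ψ.left_inv hz.2]
  have hc : fderiv ℝ (fun z => μ (ψ.symm z)) (g (φ y)) = 0 := by
    refine IsLocalMin.fderiv_eq_zero (Filter.Eventually.of_forall fun z => ?_)
    rw [hgy]
    change μ (ψ.symm (ψ y)) ≤ μ (ψ.symm z)
    rw [ψ.left_inv hy', h0]; exact hnn _
  -- the opposite transition map provides a left inverse of the derivative
  have hinj : Function.Injective (fderiv ℝ g (φ y)) := by
    have hid : (fun z => φ (ψ.symm (g z))) =ᶠ[𝓝 (φ y)] id := by
      filter_upwards [hev] with z hz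
      simp only [hgdef, ψ.left_inv hz.2, φ.right_inv hz.1, id]
    have h1 : HasFDerivAt (fun z => φ (ψ.symm (g z)))
        ((fderiv ℝ (fun z => φ (ψ.symm z)) (g (φ y))).comp (fderiv ℝ g (φ y))) (φ y) := by
      have h2 : DifferentiableAt ℝ (fun z => φ (ψ.symm z)) (g (φ y)) := by
        rw [hgy]; exact hg'.differentiableAt (by simp)
      exact h2.hasFDerivAt.comp (φ y) (hg.differentiableAt (by simp)).hasFDerivAt
    have h2 := (h1.congr_of_eventuallyEq hid.symm).unique (hasFDerivAt_id (φ y))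
    refine Function.LeftInverse.injective
      (g := fderiv ℝ (fun z => φ (ψ.symm z)) (g (φ y))) fun v => ?_
    exact congrArg (fun L : EuclideanSpace ℝ (Fin n) →L[ℝ] EuclideanSpace ℝ (Fin n) => L v) h2
  refine finrank_range_congr hinj fun v w => ?_
  rw [heq.fderiv.fderiv_eq, fderiv_fderiv_comp hg (by rw [hgy]; exact hF) hc, hgy]

lemma hessianAt_eq (μ : X → ℝ) (y : X) : hessianAt n μ y =
    fderiv ℝ (fderiv ℝ fun z => μ ((chartAt (EuclideanSpace ℝ (Fin n)) y).symm z))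
      (chartAt (EuclideanSpace ℝ (Fin n)) y y) := by
  rw [hessianAt]
  rfl

variable (hY : IsClosedSubmanifold n m Y) (hφ : φ ∈ IsManifold.maximalAtlas (𝓡 n) ∞ X)
  (hs : ∀ x ∈ φ.source, x ∈ Y ↔ ∀ i : Fin n, (i : ℕ) < m → φ x i = 0)
include hY hφ hs

/-- The Morse–Bott condition at a point, in a slice chart. -/
lemma finrank_hessianAt_iff {y : X} (hy : y ∈ φ.source) (hyY : y ∈ Y) {μ : X → ℝ}
    (hμ : ContMDiff (𝓡 n) 𝓘(ℝ, ℝ) ∞ μ) (hnn : ∀ x, 0 ≤ μ x) (h0 : ∀ x, μ x = 0 ↔ x ∈ Y) :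
    Module.finrank ℝ (LinearMap.range (hessianAt n μ y).toLinearMap) = m ↔
      ∀ v, fderiv ℝ (fderiv ℝ fun z => μ (φ.symm z)) (φ y) v v = 0 → v ∈ sliceSubspace n m := by
  rw [hessianAt_eq, finrank_hess_chart (IsManifold.chart_mem_maximalAtlas y) hφ
    (mem_chart_source _ y) hy hμ hnn ((h0 y).2 hyY)]
  refine finrank_hess_iff (K := sliceSubspace n m) φ.open_target
    (contDiffOn_comp_chart hφ hμ) (φ.map_source hy) ((hs y hy).1 hyY) (fun z _ => hnn _)
    (fun z hz hzK => (h0 _).2 ?_)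
    (finrank_sliceSubspace hY.codim_le)
  refine (hs _ (φ.map_target hz)).2 ?_
  rw [φ.right_inv hz]; exact hzK

omit hφ hs in
/-- The nonnegative Morse–Bott functions form a convex cone: in a slice chart the Hessians are
positive semidefinite forms with the same kernel, the tangent space of `Y`. -/
lemma add_mem_morseBott {μ ν : X → ℝ} (hμ : μ ∈ morseBott n m Y) (hν : ν ∈ morseBott n m Y) :
    μ + ν ∈ morseBott n m Y := by
  have hz : ∀ x, (μ + ν) x = 0 ↔ x ∈ Y := fun x => by
    rw [← hμ.2.2.1 x, Pi.add_apply, add_eq_zero_iff_of_nonneg (hμ.2.1 x) (hν.2.1 x), hμ.2.2.1,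
      hν.2.2.1, and_self]
  have hnn : ∀ x, 0 ≤ (μ + ν) x := fun x => add_nonneg (hμ.2.1 x) (hν.2.1 x)
  refine ⟨hμ.1.add hν.1, hnn, hz, fun y hy => ?_⟩
  obtain ⟨φ, hφ, hyφ, hs⟩ := hY.slice y hy
  have hw := φ.open_target.mem_nhds (φ.map_source hyφ)
  have h1 := contDiffOn_comp_chart hφ hμ.1
  have h2 := contDiffOn_comp_chart hφ hν.1
  rw [finrank_hessianAt_iff hY hφ hs hyφ hy (hμ.1.add hν.1) hnn hz]
  intro v hv
  have hadd : fderiv ℝ (fderiv ℝ fun z => (μ + ν) (φ.symm z)) (φ y) =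
      fderiv ℝ (fderiv ℝ fun z => μ (φ.symm z)) (φ y) +
        fderiv ℝ (fderiv ℝ fun z => ν (φ.symm z)) (φ y) := by
    have h3 : (fderiv ℝ fun z => (μ + ν) (φ.symm z)) =ᶠ[𝓝 (φ y)]
        fun z => fderiv ℝ (fun z => μ (φ.symm z)) z + fderiv ℝ (fun z => ν (φ.symm z)) z := by
      filter_upwards [hw] with z hz
      have hzn := φ.open_target.mem_nhds hz
      exact fderiv_fun_add ((h1.contDiffAt hzn).differentiableAt (by simp))
        ((h2.contDiffAt hzn).differentiableAt (by simp))
    rw [h3.fderiv_eq]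
    exact fderiv_fun_add
      (((h1.contDiffAt hw).fderiv_right (m := ∞) (by simp)).differentiableAt (by simp))
      (((h2.contDiffAt hw).fderiv_right (m := ∞) (by simp)).differentiableAt (by simp))
  rw [hadd] at hv
  have hν0 : ν (φ.symm (φ y)) = 0 := by rw [φ.left_inv hyφ]; exact (hν.2.2.1 y).2 hy
  have hμ0 : μ (φ.symm (φ y)) = 0 := by rw [φ.left_inv hyφ]; exact (hμ.2.2.1 y).2 hy
  have h3 := hess_nonneg φ.open_target h1 (φ.map_source hyφ) (fun z _ => hμ.2.1 _) hμ0 v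
  have h4 := hess_nonneg φ.open_target h2 (φ.map_source hyφ) (fun z _ => hν.2.1 _) hν0 v
  refine (finrank_hessianAt_iff hY hφ hs hyφ hy hμ.1 hμ.2.1 hμ.2.2.1).1 (hμ.2.2.2 y hy) v ?_
  rw [add_apply, add_apply] at hv
  linarith

omit hφ hs in
lemma smul_mem_morseBott {μ : X → ℝ} (hμ : μ ∈ morseBott n m Y) {c : ℝ} (hc : 0 < c) :
    c • μ ∈ morseBott n m Y := by
  have hz : ∀ x, (c • μ) x = 0 ↔ x ∈ Y := fun x => by
    rw [← hμ.2.2.1 x, Pi.smul_apply, smul_eq_zero_iff_right hc.ne']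
  have hnn : ∀ x, 0 ≤ (c • μ) x := fun x => mul_nonneg hc.le (hμ.2.1 x)
  have hsm : ContMDiff (𝓡 n) 𝓘(ℝ, ℝ) ∞ (c • μ) := by
    have h : ContMDiff (𝓡 n) 𝓘(ℝ, ℝ) ∞ fun _ : X => c := contMDiff_const
    exact h.smul hμ.1
  refine ⟨hsm, hnn, hz, fun y hy => ?_⟩
  obtain ⟨φ, hφ, hyφ, hs⟩ := hY.slice y hy
  have h1 := contDiffOn_comp_chart hφ hμ.1
  rw [finrank_hessianAt_iff hY hφ hs hyφ hy hsm hnn hz]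
  intro v hv
  refine (finrank_hessianAt_iff hY hφ hs hyφ hy hμ.1 hμ.2.1 hμ.2.2.1).1 (hμ.2.2.2 y hy) v ?_
  have hsmul : fderiv ℝ (fderiv ℝ fun z => (c • μ) (φ.symm z)) (φ y) =
      c • fderiv ℝ (fderiv ℝ fun z => μ (φ.symm z)) (φ y) := by
    have h3 : (fderiv ℝ fun z => (c • μ) (φ.symm z)) =
        c • fderiv ℝ (fun z => μ (φ.symm z)) := fderiv_const_smul_field c
    rw [h3]
    exact congrFun (fderiv_const_smul_field c) _
  rw [hsmul, smul_apply, smul_apply, smul_eq_mul] at hv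
  exact (mul_eq_zero.1 hv).resolve_left hc.ne'

end Slice

/-! ### Contraction and restriction of covectors on a cylinder -/

section Fiber

variable (𝕜 : Type) [RCLike 𝕜]
variable {V : Type} [NormedAddCommGroup V] [NormedSpace ℝ V] [FiniteDimensional ℝ V]
variable {W : Type} [NormedAddCommGroup W] [NormedSpace ℝ W] [FiniteDimensional ℝ W]

/-- The evaluation of covectors at a vector. -/
def covEval (v : V) : Module.Dual 𝕜 (V →ₗ[ℝ] 𝕜) where
  toFun l := l v
  map_add' _ _ := rfl
  map_smul' _ _ := rfl

variable (V) in
/-- The restriction of a covector on `V × ℝ` to `V`. -/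
def fiberRestrict : Cov 𝕜 (V × ℝ) →ₗ[𝕜] Cov 𝕜 V :=
  (covMap 𝕜 (ContinuousLinearMap.inl ℝ V ℝ)).toLinearMap

variable (V) in
/-- The contraction of a covector on `V × ℝ` with the unit vector of `ℝ`, restricted to `V`. -/
def fiberContract : Cov 𝕜 (V × ℝ) →ₗ[𝕜] Cov 𝕜 V :=
  fiberRestrict 𝕜 V ∘ₗ CliffordAlgebra.contractLeft (Q := 0) (covEval 𝕜 ((0, 1) : V × ℝ))

variable {𝕜}

lemma contractLeft_covMap (A : V →L[ℝ] W) (v : V) (w : Cov 𝕜 W) :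
    CliffordAlgebra.contractLeft (Q := 0) (covEval 𝕜 v) (covMap 𝕜 A w) =
      covMap 𝕜 A (CliffordAlgebra.contractLeft (Q := 0) (covEval 𝕜 (A v)) w) := by
  induction w using CliffordAlgebra.left_induction with
  | algebraMap r =>
    rw [AlgHom.commutes, CliffordAlgebra.contractLeft_algebraMap,
      CliffordAlgebra.contractLeft_algebraMap, map_zero]
  | add a b ha hb => rw [map_add, map_add, map_add, map_add, ha, hb]
  | ι_mul b l hb =>
    have h1 : covMap 𝕜 A (CliffordAlgebra.ι 0 l) = CliffordAlgebra.ι 0 (l ∘ₗ A.toLinearMap) :=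
      covMap_ι A l
    rw [map_mul, h1, CliffordAlgebra.contractLeft_ι_mul, CliffordAlgebra.contractLeft_ι_mul,
      map_sub, map_smul, map_mul, h1, hb]
    rfl

lemma fiberRestrict_covMap (A : V →L[ℝ] W) (w : Cov 𝕜 (W × ℝ)) :
    fiberRestrict 𝕜 V (covMap 𝕜 (A.prodMap (ContinuousLinearMap.id ℝ ℝ)) w) =
      covMap 𝕜 A (fiberRestrict 𝕜 W w) := by
  change covMap 𝕜 _ _ = covMap 𝕜 A (covMap 𝕜 _ _)
  rw [← covMap_comp, ← covMap_comp]
  congr 1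

lemma fiberContract_covMap (A : V →L[ℝ] W) (w : Cov 𝕜 (W × ℝ)) :
    fiberContract 𝕜 V (covMap 𝕜 (A.prodMap (ContinuousLinearMap.id ℝ ℝ)) w) =
      covMap 𝕜 A (fiberContract 𝕜 W w) := by
  change fiberRestrict 𝕜 V (CliffordAlgebra.contractLeft (Q := 0) _ _) = _
  rw [contractLeft_covMap, fiberRestrict_covMap]
  have : (A.prodMap (ContinuousLinearMap.id ℝ ℝ)) ((0, 1) : V × ℝ) = (0, 1) := by simp
  rw [this]; rfl

lemma contractLeft_mem (v : V) (k : ℕ) {w : Cov 𝕜 V} (hw : w ∈ ⋀[𝕜]^(k + 1) (V →ₗ[ℝ] 𝕜)) :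
    CliffordAlgebra.contractLeft (Q := 0) (covEval 𝕜 v) w ∈ ⋀[𝕜]^k (V →ₗ[ℝ] 𝕜) := by
  induction k generalizing w with
  | zero =>
    change w ∈ (LinearMap.range (ExteriorAlgebra.ι 𝕜 (M := V →ₗ[ℝ] 𝕜))) ^ 1 at hw
    rw [pow_one] at hw
    obtain ⟨l, rfl⟩ := hw
    have := CliffordAlgebra.contractLeft_ι (Q := 0) (covEval 𝕜 v) l
    refine this ▸ ?_
    exact SetLike.algebraMap_mem_graded (fun i : ℕ => ⋀[𝕜]^i (V →ₗ[ℝ] 𝕜)) _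
  | succ k ih =>
    change w ∈ (LinearMap.range (ExteriorAlgebra.ι 𝕜 (M := V →ₗ[ℝ] 𝕜))) ^ (k + 1 + 1) at hw
    rw [pow_succ'] at hw
    induction hw using Submodule.mul_induction_on' with
    | mem_mul_mem m hm b hb =>
      obtain ⟨l, rfl⟩ := hm
      have := CliffordAlgebra.contractLeft_ι_mul (Q := 0) (covEval 𝕜 v) l b
      refine this ▸ Submodule.sub_mem _ (Submodule.smul_mem _ _ hb) ?_
      have h1 : ExteriorAlgebra.ι 𝕜 l ∈ ⋀[𝕜]^1 (V →ₗ[ℝ] 𝕜) := by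
        change _ ∈ (LinearMap.range (ExteriorAlgebra.ι 𝕜 (M := V →ₗ[ℝ] 𝕜))) ^ 1
        rw [pow_one]; exact ⟨_, rfl⟩
      have h2 := SetLike.GradedMul.mul_mem (A := fun i : ℕ => ⋀[𝕜]^i (V →ₗ[ℝ] 𝕜)) h1 (ih hb)
      rwa [add_comm] at h2
    | add x hx y hy h1 h2 => rw [map_add]; exact Submodule.add_mem _ h1 h2

lemma fiberContract_mem {k : ℕ} {w : Cov 𝕜 (V × ℝ)}
    (hw : w ∈ ⋀[𝕜]^(k + 1) ((V × ℝ) →ₗ[ℝ] 𝕜)) :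
    fiberContract 𝕜 V w ∈ ⋀[𝕜]^k (V →ₗ[ℝ] 𝕜) :=
  covMap_mem _ (contractLeft_mem _ k hw)

lemma fiberContract_eq_zero {w : Cov 𝕜 (V × ℝ)} (hw : w ∈ ⋀[𝕜]^0 ((V × ℝ) →ₗ[ℝ] 𝕜)) :
    fiberContract 𝕜 V w = 0 := by
  change w ∈ (LinearMap.range (ExteriorAlgebra.ι 𝕜 (M := (V × ℝ) →ₗ[ℝ] 𝕜))) ^ 0 at hw
  rw [pow_zero, Submodule.mem_one] at hw
  obtain ⟨r, rfl⟩ := hw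
  change fiberRestrict 𝕜 V (CliffordAlgebra.contractLeft (Q := 0) _ (algebraMap _ _ r)) = 0
  rw [CliffordAlgebra.contractLeft_algebraMap, map_zero]

/-- The contraction anticommutes with wedge products up to the derivative along the fibre. -/
lemma fiberContract_wedgeUp (L : (V × ℝ) →ₗ[ℝ] Cov 𝕜 (V × ℝ)) :
    wedgeUp 𝕜 (((fiberContract 𝕜 V).restrictScalars ℝ ∘ₗ L) ∘ₗ
        (ContinuousLinearMap.inl ℝ V ℝ).toLinearMap) + fiberContract 𝕜 V (wedgeUp 𝕜 L) =
      fiberRestrict 𝕜 V (L (0, 1)) := by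
  set b := Module.finBasis ℝ (V × ℝ)
  have h1 : ∀ i, fiberContract 𝕜 V (covOne 𝕜 (b.coord i) * L (b i)) =
      b.coord i (0, 1) • fiberRestrict 𝕜 V (L (b i)) -
        covOne 𝕜 (b.coord i ∘ₗ (ContinuousLinearMap.inl ℝ V ℝ).toLinearMap) *
          fiberContract 𝕜 V (L (b i)) := fun i => by
    have h2 := CliffordAlgebra.contractLeft_ι_mul (Q := 0) (covEval 𝕜 ((0, 1) : V × ℝ))
      (Algebra.linearMap ℝ 𝕜 ∘ₗ b.coord i) (L (b i))
    have h3 := congrArg (fiberRestrict 𝕜 V) h2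
    rw [map_sub, map_smul] at h3
    refine h3.trans (congrArg₂ _ ?_ ?_)
    · exact algebraMap_smul 𝕜 (b.coord i (0, 1)) _
    · refine (map_mul (covMap 𝕜 (ContinuousLinearMap.inl ℝ V ℝ)) _ _).trans ?_
      exact congrArg (· * _) (covMap_covOne _ _)
  have h4 : L (0, 1) = ∑ i, b.coord i (0, 1) • L (b i) := by
    conv_lhs => rw [← b.sum_repr (0, 1), map_sum]
    simp
  have h5 : ∀ (r : ℝ) (w : Cov 𝕜 (V × ℝ)),
      fiberRestrict 𝕜 V (r • w) = r • fiberRestrict 𝕜 V w :=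
    fun r w => ((fiberRestrict 𝕜 V).restrictScalars ℝ).map_smul r w
  rw [wedgeUp_pull, wedgeUp, map_sum, h4, map_sum, ← Finset.sum_add_distrib]
  refine Finset.sum_congr rfl fun i _ => ?_
  rw [h1, h5]
  simp only [LinearMap.comp_apply, LinearMap.restrictScalars_apply]
  abel

variable (𝕜 V) in
/-- The contraction as a continuous linear map. -/
def fiberContractL : Cov 𝕜 (V × ℝ) →L[ℝ] Cov 𝕜 V :=
  LinearMap.toContinuousLinearMap ((fiberContract 𝕜 V).restrictScalars ℝ)

variable (𝕜 V) in
/-- The restriction to `V` as a continuous linear map. -/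
def fiberRestrictL : Cov 𝕜 (V × ℝ) →L[ℝ] Cov 𝕜 V :=
  LinearMap.toContinuousLinearMap ((fiberRestrict 𝕜 V).restrictScalars ℝ)

variable (𝕜 V) in
/-- `wedgeUp` as a continuous linear map. -/
def wedgeUpL : (V →L[ℝ] Cov 𝕜 V) →L[ℝ] Cov 𝕜 V :=
  ∑ i, (LinearMap.toContinuousLinearMap
      (LinearMap.mulLeft ℝ (covOne 𝕜 ((Module.finBasis ℝ V).coord i)))).comp
    (ContinuousLinearMap.apply ℝ (Cov 𝕜 V) (Module.finBasis ℝ V i))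

lemma wedgeUpL_apply (L : V →L[ℝ] Cov 𝕜 V) : wedgeUpL 𝕜 V L = wedgeUp 𝕜 L.toLinearMap := by
  simp [wedgeUpL, wedgeUp, sum_apply]

instance covComplete : CompleteSpace (Cov 𝕜 V) := FiniteDimensional.complete ℝ _

/-- Integration along the interval of the contraction is a chain homotopy between the restrictions
to the end points. -/
lemma extD_integral {D : Set V} {a b : ℝ} (hab : a < b) (hD : UniqueDiffOn ℝ D)
    (hc : IsLocallyConvex D) {ζ : V × ℝ → Cov 𝕜 (V × ℝ)} (hζ : ContDiffOn ℝ ∞ ζ (D ×ˢ Icc a b))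
    {x : V} (hx : x ∈ D) :
    extD 𝕜 (fun y => ∫ s in a..b, fiberContract 𝕜 V (ζ (y, s))) D x +
        ∫ s in a..b, fiberContract 𝕜 V (extD 𝕜 ζ (D ×ˢ Icc a b) (x, s)) =
      fiberRestrict 𝕜 V (ζ (x, b)) - fiberRestrict 𝕜 V (ζ (x, a)) := by
  set S := D ×ˢ Icc a b
  have hS : UniqueDiffOn ℝ S := hD.prod (uniqueDiffOn_Icc hab)
  have h1 : ContDiffOn ℝ ∞ (fun z => fiberContractL 𝕜 V (ζ z)) S :=
    (fiberContractL 𝕜 V).contDiff.comp_contDiffOn hζ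
  have hdiff : ∀ {s}, s ∈ Icc a b → HasFDerivWithinAt ζ (fderivWithin ℝ ζ S (x, s)) S (x, s) :=
    fun hs => ((hζ _ ⟨hx, hs⟩).differentiableWithinAt (by simp)).hasFDerivWithinAt
  have hdc : ContinuousOn (fderivWithin ℝ ζ S) S := hζ.continuousOn_fderivWithin hS (by simp)
  have hF : ∀ {s}, s ∈ Icc a b → fderivFst (fun z => fiberContractL 𝕜 V (ζ z)) S (x, s) =
      ((fiberContractL 𝕜 V).comp (fderivWithin ℝ ζ S (x, s))).comp
        (ContinuousLinearMap.inl ℝ V ℝ) := fun {s} hs => by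
    rw [fderivFst]
    congr 1
    exact ((fiberContractL 𝕜 V).hasFDerivAt.comp_hasFDerivWithinAt _ (hdiff hs)).fderivWithin
      (hS _ ⟨hx, hs⟩)
  have hFc := continuousOn_fderivFst hab hD (by simp) h1
  have h2 : extD 𝕜 (fun y => ∫ s in a..b, fiberContract 𝕜 V (ζ (y, s))) D x =
      ∫ s in a..b, wedgeUpL 𝕜 V (fderivFst (fun z => fiberContractL 𝕜 V (ζ z)) S (x, s)) := by
    rw [extD, ← wedgeUpL_apply,
      ContinuousLinearMap.intervalIntegral_comp_comm _ (intervalIntegrable_section hab.le hFc hx)]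
    congr 1
    exact fderivWithin_integral hab hD hc (h1.of_le (by simp)) hx
  have hdcx := continuousOn_section hdc hx
  have hi1 : IntervalIntegrable
      (fun s => wedgeUpL 𝕜 V (fderivFst (fun z => fiberContractL 𝕜 V (ζ z)) S (x, s)))
      MeasureTheory.volume a b :=
    ((wedgeUpL 𝕜 V).continuous.comp_continuousOn
      (continuousOn_section hFc hx)).intervalIntegrable_of_Icc hab.le
  have hext : ContinuousOn (extD 𝕜 ζ S) S := (contDiffOn_extD hS hζ).continuousOn
  have hi2 : IntervalIntegrable (fun s => fiberContract 𝕜 V (extD 𝕜 ζ S (x, s)))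
      MeasureTheory.volume a b :=
    ((fiberContractL 𝕜 V).continuous.comp_continuousOn
      (continuousOn_section hext hx)).intervalIntegrable_of_Icc hab.le
  rw [h2, ← intervalIntegral.integral_add hi1 hi2]
  have hcong : EqOn (fun s => wedgeUpL 𝕜 V (fderivFst (fun z => fiberContractL 𝕜 V (ζ z)) S (x, s))
      + fiberContract 𝕜 V (extD 𝕜 ζ S (x, s)))
      (fun s => fiberRestrictL 𝕜 V (fderivWithin ℝ ζ S (x, s) (0, 1))) (uIcc a b) := by
    intro s hs
    rw [uIcc_of_le hab.le] at hs
    beta_reduce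
    rw [hF hs, wedgeUpL_apply]
    exact fiberContract_wedgeUp (fderivWithin ℝ ζ S (x, s)).toLinearMap
  rw [intervalIntegral.integral_congr hcong]
  refine intervalIntegral.integral_eq_sub_of_hasDerivAt_of_le
    (f := fun s => fiberRestrictL 𝕜 V (ζ (x, s))) hab.le ?_ (fun s hs => ?_) ?_
  · exact (fiberRestrictL 𝕜 V).continuous.comp_continuousOn
      (continuousOn_section hζ.continuousOn hx)
  · have h3 : HasDerivWithinAt (fun s : ℝ => ((x, s) : V × ℝ)) (0, 1) (Icc a b) s :=
      ((hasDerivAt_const s x).prodMk (hasDerivAt_id s)).hasDerivWithinAt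
    have h4 := (hdiff (Ioo_subset_Icc_self hs)).comp_hasDerivWithinAt s h3
      (fun s' hs' => (⟨hx, hs'⟩ : (x, s') ∈ S))
    exact (fiberRestrictL 𝕜 V).hasFDerivAt.comp_hasDerivAt s
      (h4.hasDerivAt (Icc_mem_nhds hs.1 hs.2))
  · exact ((fiberRestrictL 𝕜 V).continuous.comp_continuousOn
      (hdcx.clm_apply continuousOn_const)).intervalIntegrable_of_Icc hab.le

end Fiber

/-! ### Fibre integration of differential forms -/

section LocalPull

universe u v

variable {𝕜 : Type} [RCLike 𝕜]
variable {V : Type} [NormedAddCommGroup V] [NormedSpace ℝ V] [FiniteDimensional ℝ V]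
  {H : Type} [TopologicalSpace H] {I : ModelWithCorners ℝ V H} [I.Boundaryless]
  {M : Type u} [TopologicalSpace M] [ChartedSpace H M] [IsManifold I ∞ M]
variable {W : Type} [NormedAddCommGroup W] [NormedSpace ℝ W] [FiniteDimensional ℝ W]
  {G : Type} [TopologicalSpace G] {J : ModelWithCorners ℝ W G} [J.Boundaryless]
  {N : Type v} [TopologicalSpace N] [ChartedSpace G N] [IsManifold J ∞ N]

lemma eventually_chart_of_continuousAt {g : M → N} {x₀ : M} {y₀ : N} {z : V}
    (hz : z ∈ (extChartAt I x₀).target) (hg : ContinuousAt g ((extChartAt I x₀).symm z))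
    (hy : g ((extChartAt I x₀).symm z) ∈ (extChartAt J y₀).source) :
    ∀ᶠ z' in 𝓝 z, z' ∈ (extChartAt I x₀).target ∧
      g ((extChartAt I x₀).symm z') ∈ (extChartAt J y₀).source := by
  have ht := (isOpen_extChartAt_target (I := I) x₀).mem_nhds hz
  have h1 : ContinuousAt (fun z' => g ((extChartAt I x₀).symm z')) z :=
    ContinuousAt.comp hg ((continuousOn_extChartAt_symm x₀).continuousAt ht)
  exact Filter.Eventually.and ht
    (h1.preimage_mem_nhds ((isOpen_extChartAt_source y₀).mem_nhds hy))

lemma chartRep_pull_eventually {g : M → N} {D : Set M} (hg : ∀ m ∈ D, ContMDiffAt I J ∞ g m)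
    {x₀ : M} {y₀ : N} {z : V} (hz : z ∈ chartSet I D x₀)
    (hy : g ((extChartAt I x₀).symm z) ∈ (extChartAt J y₀).source) (η : CovField 𝕜 W N) :
    chartRep 𝕜 I x₀ (pullField 𝕜 I J g η) =ᶠ[𝓝[chartSet I D x₀] z] fun z =>
      covMap 𝕜 (fderiv ℝ (inCharts I J g x₀ y₀) z)
        (chartRep 𝕜 J y₀ η (inCharts I J g x₀ y₀ z)) := by
  filter_upwards [nhdsWithin_le_nhds
    (eventually_chart_of_continuousAt hz.1 (hg _ hz.2).continuousAt hy),
    self_mem_nhdsWithin] with z' h1 h2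
  exact chartRep_pull h1.1 h1.2 ((hg _ h2.2).mdifferentiableAt (by simp)) η

/-- The pull-back of a smooth form along a map that is smooth near its domain is smooth. -/
lemma SmoothForm.pull_of_contMDiffAt {g : M → N} {D : Set M} {D' : Set N}
    (hg : ∀ m ∈ D, ContMDiffAt I J ∞ g m) (hD : MapsTo g D D') {η : CovField 𝕜 W N}
    (hη : SmoothForm 𝕜 J D' η) : SmoothForm 𝕜 I D (pullField 𝕜 I J g η) := by
  intro x₀ z hz
  set n := g ((extChartAt I x₀).symm z) with hn
  have hy : n ∈ (extChartAt J n).source := mem_extChartAt_source n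
  have hev := eventually_chart_of_continuousAt hz.1 (hg _ hz.2).continuousAt hy
  have hgc := contDiffAt_inCharts hz.1 hy (hg _ hz.2)
  have h1 : ContDiffWithinAt ℝ ∞ (chartRep 𝕜 J n η) (chartSet J D' n)
      (inCharts I J g x₀ n z) := hη n _ (mem_chartSet hy (hD hz.2))
  have h2 : ContDiffWithinAt ℝ ∞ (fun z => covMap 𝕜 (fderiv ℝ (inCharts I J g x₀ n) z)
      (chartRep 𝕜 J n η (inCharts I J g x₀ n z))) (chartSet I D x₀) z := by
    refine contDiffWithinAt_covMap (hgc.fderiv_right (m := ∞) (by simp)).contDiffWithinAt ?_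
    refine h1.comp_of_preimage_mem_nhdsWithin z hgc.contDiffWithinAt ?_
    filter_upwards [nhdsWithin_le_nhds hev, self_mem_nhdsWithin] with z' h3 h4
    exact mem_chartSet h3.2 (hD h4.2)
  exact h2.congr_of_eventuallyEq (chartRep_pull_eventually hg hz hy η)
    (chartRep_pull hz.1 hy ((hg _ hz.2).mdifferentiableAt (by simp)) η)

lemma extD_chartRep_pull_of_contMDiffAt {g : M → N} {D : Set M} {D' : Set N}
    (hg : ∀ m ∈ D, ContMDiffAt I J ∞ g m) (hr : RegularDomain I D)
    (hD : MapsTo g D D') {η : CovField 𝕜 W N} (hη : SmoothForm 𝕜 J D' η) {x₀ : M} {y₀ : N} {z : V}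
    (hz : z ∈ chartSet I D x₀)
    (hy : g ((extChartAt I x₀).symm z) ∈ (extChartAt J y₀).source) :
    extD 𝕜 (chartRep 𝕜 I x₀ (pullField 𝕜 I J g η)) (chartSet I D x₀) z =
      covMap 𝕜 (fderiv ℝ (inCharts I J g x₀ y₀) z)
        (extD 𝕜 (chartRep 𝕜 J y₀ η) (chartSet J D' y₀) (inCharts I J g x₀ y₀ z)) := by
  have hev := eventually_chart_of_continuousAt hz.1 (hg _ hz.2).continuousAt hy
  have hgc := contDiffAt_inCharts hz.1 hy (hg _ hz.2)
  have hm : inCharts I J g x₀ y₀ z ∈ chartSet J D' y₀ := mem_chartSet hy (hD hz.2)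
  rw [← extD_pullback hgc (hr.chart x₀ z hz) ?_
    ((hη y₀ _ hm).differentiableWithinAt (by simp))]
  · exact extD_congr Filter.EventuallyEq.rfl (chartRep_pull_eventually hg hz hy η)
      (chartRep_pull hz.1 hy ((hg _ hz.2).mdifferentiableAt (by simp)) η)
  · filter_upwards [nhdsWithin_le_nhds hev, self_mem_nhdsWithin] with z' h1 h2
    exact mem_chartSet h1.2 (hD h2.2)

/-- The exterior derivative commutes with pull-backs along maps that are smooth near the domain. -/
lemma dForm_pull_of_contMDiffAt {g : M → N} {D : Set M} {D' : Set N}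
    (hg : ∀ m ∈ D, ContMDiffAt I J ∞ g m) (hr : RegularDomain I D) (hr' : RegularDomain J D')
    (hD : MapsTo g D D') {η : CovField 𝕜 W N} (hη : SmoothForm 𝕜 J D' η) {m : M} (hm : m ∈ D) :
    dForm 𝕜 I D (pullField 𝕜 I J g η) m = pullField 𝕜 I J g (dForm 𝕜 J D' η) m := by
  have hs : m ∈ (extChartAt I m).source := mem_extChartAt_source m
  have hz := mem_chartSet hs hm
  have hl := (extChartAt I m).left_inv hs
  have hy : g ((extChartAt I m).symm (extChartAt I m m)) ∈ (extChartAt J (g m)).source := by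
    rw [hl]; exact mem_extChartAt_source _
  have hm' : inCharts I J g m (g m) (extChartAt I m m) ∈ chartSet J D' (g m) :=
    mem_chartSet hy (hD hz.2)
  rw [eq_of_chartRep hs (pullField 𝕜 I J g (dForm 𝕜 J D' η)), dForm,
    extD_chartRep_pull_of_contMDiffAt hg hr hD hη hz hy,
    chartRep_pull hz.1 hy ((hg _ hz.2).mdifferentiableAt (by simp)), chartRep_dForm hr' hη hm']

end LocalPull

section FiberIntegral

universe u

variable {𝕜 : Type} [RCLike 𝕜]
variable {V : Type} [NormedAddCommGroup V] [NormedSpace ℝ V] [FiniteDimensional ℝ V]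
  {H : Type} [TopologicalSpace H] {I : ModelWithCorners ℝ V H} [I.Boundaryless]
  {M : Type u} [TopologicalSpace M] [ChartedSpace H M] [IsManifold I ∞ M]

/-- Fibre integration along `[a, b]` of a form on `M × ℝ`. -/
def fiberIntegral (a b : ℝ) (α : CovField 𝕜 (V × ℝ) (M × ℝ)) : CovField 𝕜 V M := fun x =>
  ∫ s in a..b, fiberContract 𝕜 V (α (x, s))

lemma extChartAt_cylinder (x₀ : M) : extChartAt (I.prod 𝓘(ℝ, ℝ)) ((x₀, 0) : M × ℝ) =
    (extChartAt I x₀).prod (PartialEquiv.refl ℝ) := by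
  rw [extChartAt_prod, extChartAt_model_space_eq_id]

lemma chartSet_cylinder (D : Set M) (T : Set ℝ) (x₀ : M) :
    chartSet (I.prod 𝓘(ℝ, ℝ)) (D ×ˢ T) ((x₀, 0) : M × ℝ) = chartSet I D x₀ ×ˢ T := by
  rw [chartSet, chartSet, extChartAt_cylinder]
  ext z
  simp only [PartialEquiv.prod_target, PartialEquiv.refl_target, mem_inter_iff, mem_prod,
    mem_univ, and_true, mem_preimage]
  exact (and_assoc).symm

lemma chartRep_cylinder {x₀ : M} {z : V} (hz : z ∈ (extChartAt I x₀).target) (s : ℝ)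
    (α : CovField 𝕜 (V × ℝ) (M × ℝ)) :
    chartRep 𝕜 (I.prod 𝓘(ℝ, ℝ)) ((x₀, 0) : M × ℝ) α (z, s) =
      covMap 𝕜 ((mder 𝓘(ℝ, V) I (extChartAt I x₀).symm z).prodMap (ContinuousLinearMap.id ℝ ℝ))
        (α ((extChartAt I x₀).symm z, s)) := by
  have h1 : (extChartAt (I.prod 𝓘(ℝ, ℝ)) ((x₀, 0) : M × ℝ)).symm =
      ((extChartAt I x₀).prod (PartialEquiv.refl ℝ)).symm := by rw [extChartAt_cylinder]
  have h2 : ((extChartAt (I.prod 𝓘(ℝ, ℝ)) ((x₀, 0) : M × ℝ)).symm : V × ℝ → M × ℝ) =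
      Prod.map (extChartAt I x₀).symm id := by rw [h1]; rfl
  have h3 : mder 𝓘(ℝ, V × ℝ) (I.prod 𝓘(ℝ, ℝ))
      (Prod.map (extChartAt I x₀).symm (id : ℝ → ℝ)) (z, s) =
      (mder 𝓘(ℝ, V) I (extChartAt I x₀).symm z).prodMap (ContinuousLinearMap.id ℝ ℝ) := by
    have h4 := mfderiv_prodMap (p := (z, s)) (mdiff_symm hz)
      (mdifferentiableAt_id (I := 𝓘(ℝ, ℝ)) (x := s))
    rw [mfderiv_id] at h4
    rw [mder, modelWithCornersSelf_prod, ← chartedSpaceSelf_prod]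
    exact h4
  rw [chartRep, h2, h3]
  rfl

variable {D : Set M} {a b : ℝ} {α : CovField 𝕜 (V × ℝ) (M × ℝ)}

lemma intervalIntegrable_fiberContract (hab : a ≤ b)
    (hα : SmoothForm 𝕜 (I.prod 𝓘(ℝ, ℝ)) (D ×ˢ Icc a b) α) {x : M} (hx : x ∈ D) :
    IntervalIntegrable (fun s => fiberContract 𝕜 V (α (x, s))) MeasureTheory.volume a b := by
  have hs := mem_extChartAt_source (I := I) x
  have hz := mem_chartSet hs hx
  have h1 := hα (x, 0)
  rw [chartSet_cylinder] at h1
  have h2 : ∀ s, fiberContract 𝕜 V (α (x, s)) = covMap 𝕜 (mder I 𝓘(ℝ, V) (extChartAt I x) x)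
      (fiberContract 𝕜 V (chartRep 𝕜 (I.prod 𝓘(ℝ, ℝ)) ((x, 0) : M × ℝ) α
        (extChartAt I x x, s))) := fun s => by
    rw [chartRep_cylinder hz.1, fiberContract_covMap, ← covMap_comp, mfderiv_symm_comp hs,
      covMap_id, (extChartAt I x).left_inv hs]
  simp only [h2]
  exact ((LinearMap.toContinuousLinearMap ((covMap 𝕜 (mder I 𝓘(ℝ, V)
    (extChartAt I x) x)).toLinearMap.restrictScalars ℝ)).continuous.comp_continuousOn
    ((fiberContractL 𝕜 V).continuous.comp_continuousOn
      (continuousOn_section h1.continuousOn hz))).intervalIntegrable_of_Icc hab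

lemma chartRep_fiberIntegral (hab : a ≤ b)
    (hα : SmoothForm 𝕜 (I.prod 𝓘(ℝ, ℝ)) (D ×ˢ Icc a b) α) {x₀ : M} {z : V}
    (hz : z ∈ chartSet I D x₀) :
    chartRep 𝕜 I x₀ (fiberIntegral a b α) z =
      ∫ s in a..b, fiberContract 𝕜 V
        (chartRep 𝕜 (I.prod 𝓘(ℝ, ℝ)) ((x₀, 0) : M × ℝ) α (z, s)) := by
  rw [chartRep]
  refine (ContinuousLinearMap.intervalIntegral_comp_comm (LinearMap.toContinuousLinearMap
    ((covMap 𝕜 (mder 𝓘(ℝ, V) I (extChartAt I x₀).symm z)).toLinearMap.restrictScalars ℝ))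
    (intervalIntegrable_fiberContract hab hα hz.2)).symm.trans ?_
  congr 1
  funext s
  rw [chartRep_cylinder hz.1, fiberContract_covMap]
  rfl

lemma SmoothForm.fiberIntegral (hr : RegularDomain I D)
    (hc : ∀ x₀, IsLocallyConvex (chartSet I D x₀)) (hab : a ≤ b)
    (hα : SmoothForm 𝕜 (I.prod 𝓘(ℝ, ℝ)) (D ×ˢ Icc a b) α) :
    SmoothForm 𝕜 I D (fiberIntegral a b α) := fun x₀ => by
  have h1 := hα (x₀, 0)
  rw [chartSet_cylinder] at h1
  have h2 : ContDiffOn ℝ ∞ (fun z => fiberContractL 𝕜 V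
      (chartRep 𝕜 (I.prod 𝓘(ℝ, ℝ)) ((x₀, 0) : M × ℝ) α z)) (chartSet I D x₀ ×ˢ Icc a b) :=
    (fiberContractL 𝕜 V).contDiff.comp_contDiffOn h1
  exact (contDiffOn_integral (hr.chart x₀) (hc x₀) hab h2).congr fun z hz =>
    chartRep_fiberIntegral hab hα hz

lemma RegularDomain.prod_Icc (hr : RegularDomain I D) (hab : a < b) :
    RegularDomain (I.prod 𝓘(ℝ, ℝ)) (D ×ˢ Icc a b) where
  unique := hr.unique.prod (uniqueMDiffOn_iff_uniqueDiffOn.2 (uniqueDiffOn_Icc hab))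
  closure_interior := by
    rw [interior_prod_eq, closure_prod_eq, interior_Icc, closure_Ioo hab.ne]
    exact prod_mono hr.closure_interior le_rfl

/-- Fibre integration is a chain homotopy between the restrictions to the two ends of the
cylinder. -/
lemma dForm_fiberIntegral (hr : RegularDomain I D)
    (hc : ∀ x₀, IsLocallyConvex (chartSet I D x₀)) (hab : a < b)
    (hα : SmoothForm 𝕜 (I.prod 𝓘(ℝ, ℝ)) (D ×ˢ Icc a b) α) {x : M} (hx : x ∈ D) :
    dForm 𝕜 I D (fiberIntegral a b α) x +
        fiberIntegral a b (dForm 𝕜 (I.prod 𝓘(ℝ, ℝ)) (D ×ˢ Icc a b) α) x =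
      fiberRestrict 𝕜 V (α (x, b)) - fiberRestrict 𝕜 V (α (x, a)) := by
  have hs := mem_extChartAt_source (I := I) x
  have hz := mem_chartSet hs hx
  have hr' := hr.prod_Icc hab
  have hdα := hα.d hr'
  set z := extChartAt I x x
  have hzx : (extChartAt I x).symm z = x := (extChartAt I x).left_inv hs
  have h1 := hα (x, 0)
  rw [chartSet_cylinder] at h1
  set ζ := chartRep 𝕜 (I.prod 𝓘(ℝ, ℝ)) ((x, 0) : M × ℝ) α with hζ
  have key := extD_integral hab (hr.chart x) (hc x) h1 hz
  have h2 : extD 𝕜 (chartRep 𝕜 I x (fiberIntegral a b α)) (chartSet I D x) z =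
      extD 𝕜 (fun y => ∫ s in a..b, fiberContract 𝕜 V (ζ (y, s))) (chartSet I D x) z := by
    refine extD_congr Filter.EventuallyEq.rfl ?_ (chartRep_fiberIntegral hab.le hα hz)
    filter_upwards [self_mem_nhdsWithin] with y hy using chartRep_fiberIntegral hab.le hα hy
  have h3 : chartRep 𝕜 I x (fiberIntegral a b
      (dForm 𝕜 (I.prod 𝓘(ℝ, ℝ)) (D ×ˢ Icc a b) α)) z =
      ∫ s in a..b, fiberContract 𝕜 V (extD 𝕜 ζ (chartSet I D x ×ˢ Icc a b) (z, s)) := by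
    rw [chartRep_fiberIntegral hab.le hdα hz]
    refine intervalIntegral.integral_congr fun s hs' => ?_
    rw [uIcc_of_le hab.le] at hs'
    rw [chartRep_dForm hr' hα (by rw [chartSet_cylinder]; exact ⟨hz, hs'⟩), chartSet_cylinder]
  have h4 : ∀ s, covMap 𝕜 (mder I 𝓘(ℝ, V) (extChartAt I x) x) (fiberRestrict 𝕜 V (ζ (z, s))) =
      fiberRestrict 𝕜 V (α (x, s)) := fun s => by
    rw [hζ, chartRep_cylinder hz.1, fiberRestrict_covMap, ← covMap_comp, mfderiv_symm_comp hs,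
      covMap_id, hzx]
  rw [eq_of_chartRep hs (fiberIntegral a b (dForm 𝕜 (I.prod 𝓘(ℝ, ℝ)) (D ×ˢ Icc a b) α)), h3,
    dForm, h2, ← map_add, key, map_sub, h4, h4]

lemma fiberIntegral_mem {k : ℕ} {x : M} (hab : a ≤ b)
    (h : ∀ s ∈ Icc a b, α (x, s) ∈ ⋀[𝕜]^(k + 1) ((V × ℝ) →ₗ[ℝ] 𝕜))
    (hint : IntervalIntegrable (fun s => fiberContract 𝕜 V (α (x, s))) MeasureTheory.volume a b) :
    fiberIntegral a b α x ∈ ⋀[𝕜]^k (V →ₗ[ℝ] 𝕜) := by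
  have h1 := ContinuousLinearMap.intervalIntegral_comp_comm (LinearMap.toContinuousLinearMap
    ((degProj 𝕜 V k).restrictScalars ℝ)) hint
  have h2 : fiberIntegral a b α x = degProj 𝕜 V k (fiberIntegral a b α x) := by
    refine Eq.trans ?_ h1
    refine intervalIntegral.integral_congr fun s hs => ?_
    rw [uIcc_of_le hab] at hs
    exact (degProj_same (fiberContract_mem (h s hs))).symm
  rw [h2]; exact degProj_mem _ _

lemma fiberIntegral_eq_zero {x : M} (hab : a ≤ b)
    (h : ∀ s ∈ Icc a b, fiberContract 𝕜 V (α (x, s)) = 0) : fiberIntegral a b α x = 0 := by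
  rw [fiberIntegral, intervalIntegral.integral_congr (g := fun _ => 0)]
  · simp
  · intro s hs
    rw [uIcc_of_le hab] at hs
    exact h s hs

end FiberIntegral

/-! ### Local maps of pole data -/

section Cylinder

universe u

variable {𝕜 : Type} [RCLike 𝕜]
variable {V : Type} [NormedAddCommGroup V] [NormedSpace ℝ V] [FiniteDimensional ℝ V]
  {H : Type} [TopologicalSpace H] {I : ModelWithCorners ℝ V H} [I.Boundaryless]
  {M : Type u} [TopologicalSpace M] [ChartedSpace H M] [IsManifold I ∞ M]
variable {W : Type} [NormedAddCommGroup W] [NormedSpace ℝ W] [FiniteDimensional ℝ W]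
  {G : Type} [TopologicalSpace G] {J : ModelWithCorners ℝ W G} [J.Boundaryless]
  {N : Type u} [TopologicalSpace N] [ChartedSpace G N] [IsManifold J ∞ N]
variable {X : Type u} [TopologicalSpace X] {Y : Set X}

/-- A map from the part of the domain of `P` over `U` to the part of the domain of `Q` over `U'`,
smooth near its domain, preserving the singular locus, and, unless there are no singularities over
`U`, compatible with the functions `μ`. It need not be compatible with the projections to `X`. -/
structure PoleDatum.IsLocalHom (P : PoleDatum I M Y) (Q : PoleDatum J N Y) (U U' : Set X)
    (g : M → N) : Prop where
  smooth : ∀ m ∈ P.S, P.proj m ∈ U → ContMDiffAt I J ∞ g m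
  mapsTo : ∀ m ∈ P.S, P.proj m ∈ U → g m ∈ Q.S
  proj_mem : ∀ m ∈ P.S, P.proj m ∈ U → Q.proj (g m) ∈ U'
  proj_mem_iff : ∀ m ∈ P.S, P.proj m ∈ U → (Q.proj (g m) ∈ Y ↔ P.proj m ∈ Y)
  μ_comp : Disjoint U Y ∨ ∀ m ∈ P.S, P.proj m ∈ U → Q.μ (g m) = P.μ m

lemma PoleDatum.IsLocalHom.mapsTo_offY {P : PoleDatum I M Y} {Q : PoleDatum J N Y} {U U' : Set X}
    {g : M → N} (hg : P.IsLocalHom Q U U' g) : MapsTo g (P.offY U) (Q.offY U') := fun m hm =>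
  ⟨hg.mapsTo m hm.1 hm.2.1, hg.proj_mem m hm.1 hm.2.1,
    fun h => hm.2.2 ((hg.proj_mem_iff m hm.1 hm.2.1).1 h)⟩

lemma PoleDatum.hasPoles_of_disjoint {P : PoleDatum I M Y} {U : Set X} (hU : IsOpen U)
    (hd : Disjoint U Y) {η : CovField 𝕜 V M} (hη : SmoothForm 𝕜 I (P.offY U) η) :
    P.HasPoles 𝕜 U η := by
  refine ⟨hη, fun m _ hmU => ⟨0, P.proj ⁻¹' U, η, hU.preimage P.continuous_proj, hmU,
    hη.mono fun m' hm' => (⟨hm'.2, hm'.1, disjoint_left.1 hd hm'.1⟩ : m' ∈ P.offY U),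
    fun m' _ => by simp⟩⟩

lemma PoleDatum.HasPoles.pull_of_isLocalHom {P : PoleDatum I M Y} {Q : PoleDatum J N Y}
    {U U' : Set X} (hU : IsOpen U) {g : M → N} (hg : P.IsLocalHom Q U U' g) {η : CovField 𝕜 W N}
    (hη : Q.HasPoles 𝕜 U' η) : P.HasPoles 𝕜 U (pullField 𝕜 I J g η) := by
  have hs : SmoothForm 𝕜 I (P.offY U) (pullField 𝕜 I J g η) :=
    hη.1.pull_of_contMDiffAt (fun m hm => hg.smooth m hm.1 hm.2.1) hg.mapsTo_offY
  rcases hg.μ_comp with hd | hμ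
  · exact hasPoles_of_disjoint hU hd hs
  refine ⟨hs, fun m hm hmU => ?_⟩
  obtain ⟨n, O, θ, hO, hmO, hs', he⟩ := hη.2 (g m) (hg.mapsTo m hm hmU) (hg.proj_mem m hm hmU)
  have h1 : g ⁻¹' O ∈ 𝓝 m := (hg.smooth m hm hmU).continuousAt.preimage_mem_nhds (hO.mem_nhds hmO)
  have hsub : ∀ {m'}, m' ∈ interior (g ⁻¹' O) → g m' ∈ O := fun h =>
    (interior_subset h : _ ∈ g ⁻¹' O)
  refine ⟨n, interior (g ⁻¹' O) ∩ P.proj ⁻¹' U, pullField 𝕜 I J g θ,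
    isOpen_interior.inter (hU.preimage P.continuous_proj), ⟨mem_interior_iff_mem_nhds.2 h1, hmU⟩,
    hs'.pull_of_contMDiffAt (fun m' hm' => hg.smooth m' hm'.2 hm'.1.2) (fun m' hm' =>
      (⟨hsub hm'.1.1, hg.mapsTo m' hm'.2 hm'.1.2⟩ : g m' ∈ O ∩ Q.S)), fun m' hm' => ?_⟩
  rw [pullField, he _ ⟨hsub hm'.1.1, hg.mapsTo_offY hm'.2⟩, pullField,
    hμ m' hm'.2.1 hm'.2.2.1]
  exact ((covMap 𝕜 (mder I J g m')).toLinearMap.restrictScalars ℝ).map_smul _ _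

/-- The cylinder `S × [0, 1]`. -/
def PoleDatum.cylinder (P : PoleDatum I M Y) : PoleDatum (I.prod 𝓘(ℝ, ℝ)) (M × ℝ) Y where
  S := P.S ×ˢ Icc 0 1
  proj := P.proj ∘ Prod.fst
  μ := P.μ ∘ Prod.fst
  regular := P.regular.prod_Icc zero_lt_one
  continuous_proj := P.continuous_proj.comp continuous_fst
  smooth_μ := P.smooth_μ.comp contMDiff_fst
  closed := P.closed

lemma PoleDatum.offY_cylinder (P : PoleDatum I M Y) (U : Set X) :
    P.cylinder.offY U = P.offY U ×ˢ Icc 0 1 := by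
  ext z
  simp only [PoleDatum.offY, PoleDatum.cylinder, mem_ofPred_eq, mem_prod, Function.comp_apply]
  tauto

lemma isLocallyConvex_chartSet_inter {D O : Set M} (hO : IsOpen O) {x₀ : M}
    (hD : IsLocallyConvex (chartSet I D x₀)) : IsLocallyConvex (chartSet I (O ∩ D) x₀) := by
  have h1 : chartSet I (O ∩ D) x₀ =
      chartSet I D x₀ ∩ ((extChartAt I x₀).target ∩ (extChartAt I x₀).symm ⁻¹' O) := by
    ext z; simp only [chartSet, mem_inter_iff, mem_preimage]; tauto
  rw [h1]
  exact hD.inter_open ((continuousOn_extChartAt_symm x₀).isOpen_inter_preimage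
    (isOpen_extChartAt_target x₀) hO)

/-- Fibre integration preserves forms with poles: by compactness of `[0, 1]` the interval can be
subdivided so that over each piece a single power of `μ` suffices. -/
lemma PoleDatum.HasPoles.fiberIntegral {P : PoleDatum I M Y}
    (hP : ∀ x₀, IsLocallyConvex (chartSet I P.S x₀)) {U : Set X} (hU : IsOpen U)
    {α : CovField 𝕜 (V × ℝ) (M × ℝ)} (hα : P.cylinder.HasPoles 𝕜 U α) :
    P.HasPoles 𝕜 U (fiberIntegral 0 1 α) := by
  have hs := hα.1
  rw [P.offY_cylinder] at hs
  have hcD : ∀ x₀, IsLocallyConvex (chartSet I (P.offY U) x₀) := fun x₀ => by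
    rw [P.offY_eq]; exact isLocallyConvex_chartSet_inter (P.isOpen_pre hU) (hP x₀)
  refine ⟨hs.fiberIntegral (P.regular_offY hU) hcD zero_le_one, fun m hm hmU => ?_⟩
  -- the open cover of the interval
  have hloc : ∀ s : Icc (0 : ℝ) 1, ∃ (n : ℕ) (O : Set M) (T : Set ℝ)
      (θ : CovField 𝕜 (V × ℝ) (M × ℝ)), IsOpen O ∧ m ∈ O ∧ IsOpen T ∧ (s : ℝ) ∈ T ∧
      SmoothForm 𝕜 (I.prod 𝓘(ℝ, ℝ)) ((O ×ˢ T) ∩ (P.S ×ˢ Icc 0 1)) θ ∧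
      ∀ x s', x ∈ O → s' ∈ T → x ∈ P.offY U → s' ∈ Icc (0 : ℝ) 1 →
        θ (x, s') = P.μ x ^ n • α (x, s') := fun s => by
    obtain ⟨n, Q, θ, hQ, hmQ, hsm, he⟩ := hα.2 (m, (s : ℝ)) ⟨hm, s.2⟩ hmU
    obtain ⟨O, T, hO, hT, hmO, hsT, hsub⟩ := isOpen_prod_iff.1 hQ m s hmQ
    refine ⟨n, O, T, θ, hO, hmO, hT, hsT, hsm.mono (inter_subset_inter_left _ hsub),
      fun x s' hx hs' hxU hs1 => he (x, s') ⟨hsub ⟨hx, hs'⟩, ?_⟩⟩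
    rw [P.offY_cylinder]; exact ⟨hxU, hs1⟩
  choose n O T θ hO hmO hT hsT hsm he using hloc
  obtain ⟨t, ht0, htm, ⟨K, hK⟩, ht⟩ := exists_monotone_Icc_subset_open_cover_Icc
    (zero_le_one (α := ℝ)) (c := fun s => Subtype.val ⁻¹' T s)
    (fun s => (hT s).preimage continuous_subtype_val) fun s _ => mem_iUnion.2 ⟨s, hsT s⟩
  have hcont : ∀ {x}, x ∈ P.offY U → ∀ {a b : ℝ}, 0 ≤ a → a ≤ b → b ≤ 1 →
      IntervalIntegrable (fun s => fiberContract 𝕜 V (α (x, s))) MeasureTheory.volume a b :=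
    fun hx a b ha hab hb => intervalIntegrable_fiberContract hab
      (hs.mono (prod_mono le_rfl (Icc_subset_Icc ha hb))) hx
  -- induction on the number of pieces
  have key : ∀ k, ∃ (n : ℕ) (O : Set M) (ξ : CovField 𝕜 V M), IsOpen O ∧ m ∈ O ∧
      SmoothForm 𝕜 I (O ∩ P.S) ξ ∧ ∀ x ∈ O ∩ P.offY U,
        ξ x = P.μ x ^ n • MorseBottForms.fiberIntegral 0 (t k : ℝ) α x := by
    intro k
    induction k with
    | zero =>
      refine ⟨0, univ, fun _ => 0, isOpen_univ, mem_univ _, ?_, fun x _ => ?_⟩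
      · simpa using SmoothForm.const (I := I) (D := univ ∩ P.S) (0 : 𝕜)
      · simp [MorseBottForms.fiberIntegral, ht0]
    | succ k ih =>
      obtain ⟨n₁, O₁, ξ₁, hO₁, hm₁, hs₁, he₁⟩ := ih
      obtain ⟨i, hi⟩ := ht k
      have hle : (t k : ℝ) ≤ t (k + 1) := htm (Nat.le_succ k)
      have hiT : ∀ s ∈ Icc (t k : ℝ) (t (k + 1)), s ∈ T i ∧ s ∈ Icc (0 : ℝ) 1 := fun s hs => by
        have h01 : s ∈ Icc (0 : ℝ) 1 := ⟨(t k).2.1.trans hs.1, hs.2.trans (t (k + 1)).2.2⟩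
        exact ⟨hi (show (⟨s, h01⟩ : Icc (0 : ℝ) 1) ∈ Icc (t k) (t (k + 1)) from hs), h01⟩
      have hsub : (O i ∩ P.S) ×ˢ Icc (t k : ℝ) (t (k + 1)) ⊆
          (O i ×ˢ T i) ∩ (P.S ×ˢ Icc 0 1) := fun z hz =>
        ⟨⟨hz.1.1, (hiT _ hz.2).1⟩, hz.1.2, (hiT _ hz.2).2⟩
      have hsi : SmoothForm 𝕜 I (O i ∩ P.S)
          (MorseBottForms.fiberIntegral (t k : ℝ) (t (k + 1)) (θ i)) :=
        ((hsm i).mono hsub).fiberIntegral (P.regular.inter_open (hO i))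
          (fun x₀ => isLocallyConvex_chartSet_inter (hO i) (hP x₀)) hle
      have hei : ∀ x ∈ O i ∩ P.offY U,
          MorseBottForms.fiberIntegral (t k : ℝ) (t (k + 1)) (θ i) x =
            P.μ x ^ n i • MorseBottForms.fiberIntegral (t k : ℝ) (t (k + 1)) α x := fun x hx => by
        rw [MorseBottForms.fiberIntegral, MorseBottForms.fiberIntegral,
          ← intervalIntegral.integral_smul]
        refine intervalIntegral.integral_congr fun s hs => ?_
        rw [uIcc_of_le hle] at hs
        rw [he i x s hx.1 (hiT s hs).1 hx.2 (hiT s hs).2]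
        exact ((fiberContract 𝕜 V).restrictScalars ℝ).map_smul _ _
      refine ⟨n₁ + n i, O₁ ∩ O i, fun x => P.μ x ^ n i • ξ₁ x + P.μ x ^ n₁ •
        MorseBottForms.fiberIntegral (t k : ℝ) (t (k + 1)) (θ i) x, hO₁.inter (hO i),
        ⟨hm₁, hmO i⟩, ?_, fun x hx => ?_⟩
      · exact ((hs₁.mono (inter_subset_inter_left _ inter_subset_left)).smul_fun
          (P.smooth_μ.pow _)).add ((hsi.mono (inter_subset_inter_left _
            inter_subset_right)).smul_fun (P.smooth_μ.pow _))
      · have hadd : MorseBottForms.fiberIntegral 0 (t (k + 1) : ℝ) α x =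
            MorseBottForms.fiberIntegral 0 (t k : ℝ) α x +
              MorseBottForms.fiberIntegral (t k : ℝ) (t (k + 1)) α x :=
          (intervalIntegral.integral_add_adjacent_intervals
            (hcont hx.2 le_rfl (t k).2.1 (t k).2.2)
            (hcont hx.2 (t k).2.1 hle (t (k + 1)).2.2)).symm
        beta_reduce
        rw [he₁ x ⟨hx.1.1, hx.2⟩, hei x ⟨hx.1.2, hx.2⟩, hadd, smul_add, smul_smul, smul_smul,
          pow_add, mul_comm (P.μ x ^ n i)]
  obtain ⟨n', O', ξ, hO', hmO', hsξ, heξ⟩ := key K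
  rw [hK K le_rfl] at heξ
  exact ⟨n', O', ξ, hO', hmO', hsξ, heξ⟩

end Cylinder

/-! ### Quasi-isomorphisms of complexes of sheaves -/

section SheafCriterion

universe u

variable {𝕜 : Type} [Field 𝕜] {X : TopCat.{u}}

/-- A morphism of sheaves, on sections over an open set. -/
def secMap {F G : TopCat.Sheaf (ModuleCat.{u} 𝕜) X} (f : F ⟶ G) (U : Opens X) :
    F.obj.obj (op U) →ₗ[𝕜] G.obj.obj (op U) := (f.hom.app (op U)).hom

/-- The restriction of sections. -/
def secRes (F : TopCat.Sheaf (ModuleCat.{u} 𝕜) X) {V U : Opens X} (h : V ≤ U) :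
    F.obj.obj (op U) →ₗ[𝕜] F.obj.obj (op V) := (F.obj.map (homOfLE h).op).hom

variable {F G K : TopCat.Sheaf (ModuleCat.{u} 𝕜) X}

lemma secMap_secRes (f : F ⟶ G) {V U : Opens X} (h : V ≤ U) (s : F.obj.obj (op U)) :
    secMap f V (secRes F h s) = secRes G h (secMap f U s) :=
  ConcreteCategory.congr_hom (f.hom.naturality (homOfLE h).op) s

lemma secRes_secRes {W V U : Opens X} (h' : W ≤ V) (h : V ≤ U) (s : F.obj.obj (op U)) :
    secRes F h' (secRes F h s) = secRes F (h'.trans h) s :=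
  (ConcreteCategory.congr_hom (F.obj.map_comp (homOfLE h).op (homOfLE h').op) s).symm

lemma secMap_comp (f : F ⟶ G) (g : G ⟶ K) (U : Opens X) (s : F.obj.obj (op U)) :
    secMap (f ≫ g) U s = secMap g U (secMap f U s) := rfl

lemma secMap_zero (U : Opens X) (s : F.obj.obj (op U)) : secMap (0 : F ⟶ G) U s = 0 := rfl

lemma sec_eq_of_local {U : Opens X} {s t : F.obj.obj (op U)}
    (h : ∀ x ∈ U, ∃ (V : Opens X) (hV : V ≤ U), x ∈ V ∧ secRes F hV s = secRes F hV t) :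
    s = t := by
  choose V hV hx hs using h
  exact F.eq_of_locally_eq' (fun x : U => V x.1 x.2) U (fun x => homOfLE (hV x.1 x.2))
    (fun x hxU => Opens.mem_iSup.2 ⟨⟨x, hxU⟩, hx x hxU⟩) s t fun x => hs x.1 x.2

lemma sheafHom_eq_of_local {f g : F ⟶ G} (h : ∀ (U : Opens X) (s : F.obj.obj (op U)), ∀ x ∈ U,
    ∃ (V : Opens X) (hV : V ≤ U), x ∈ V ∧
      secMap f V (secRes F hV s) = secMap g V (secRes F hV s)) : f = g := by
  refine Sheaf.hom_ext (NatTrans.ext (funext fun U => ModuleCat.hom_ext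
    (LinearMap.ext fun s => ?_)))
  refine sec_eq_of_local (F := G) (U := U.unop) fun x hx => ?_
  obtain ⟨V, hV, hxV, he⟩ := h U.unop s x hx
  refine ⟨V, hV, hxV, ?_⟩
  rw [secMap_secRes, secMap_secRes] at he
  exact he

lemma exists_local_preimage (f : F ⟶ G) [Epi f] {U : Opens X} (s : G.obj.obj (op U)) {x : X}
    (hx : x ∈ U) : ∃ (V : Opens X) (hV : V ≤ U), x ∈ V ∧
      ∃ t : F.obj.obj (op V), secMap f V t = secRes G hV s := by
  have h : Sheaf.IsLocallySurjective f :=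
    (Sheaf.isLocallySurjective_iff_epi' (ModuleCat.{u} 𝕜) (J := Opens.grothendieckTopology X)
      (F := F) (G := G) f).2 ‹_›
  obtain ⟨V, i, ⟨t, ht⟩, hxV⟩ := h.imageSieve_mem s x hx
  exact ⟨V, leOfHom i, hxV, t, ht⟩

variable (𝕜) in
/-- The functor of sections over an open set. -/
def secFunctor (U : Opens X) : TopCat.Sheaf (ModuleCat.{u} 𝕜) X ⥤ ModuleCat.{u} 𝕜 :=
  sheafToPresheaf _ _ ⋙ (evaluation _ _).obj (op U)

instance secFunctorPreservesFiniteLimits (U : Opens X) :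
    Limits.PreservesFiniteLimits (secFunctor 𝕜 U) := by
  have h1 : Limits.PreservesFiniteLimits (sheafToPresheaf (Opens.grothendieckTopology X)
    (ModuleCat.{u} 𝕜)) :=
    Limits.PreservesLimitsOfSize.preservesFiniteLimits.{0, 0} _
  have h2 : Limits.PreservesFiniteLimits ((evaluation (Opens X)ᵒᵖ (ModuleCat.{u} 𝕜)).obj (op U)) :=
    inferInstance
  exact @Limits.comp_preservesFiniteLimits _ _ _ _ _ _ _ _ h1 h2

instance secFunctorPreservesZeroMorphisms (U : Opens X) :
    (secFunctor 𝕜 U).PreservesZeroMorphisms where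
  map_zero _ _ := rfl

lemma secMap_injective (f : F ⟶ G) [Mono f] (U : Opens X) : Function.Injective (secMap f U) := by
  have h : Mono ((secFunctor 𝕜 U).map f) := inferInstance
  exact (ModuleCat.mono_iff_injective _).1 h

lemma exists_preimage_of_exact {S : ShortComplex (TopCat.Sheaf (ModuleCat.{u} 𝕜) X)} (hS : S.Exact)
    [Mono S.f] {U : Opens X} {s : S.X₂.obj.obj (op U)} (hs : secMap S.g U s = 0) :
    ∃ t, secMap S.f U t = s := by
  have h := hS.map_of_mono_of_preservesKernel (secFunctor 𝕜 U) inferInstance inferInstance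
  rw [ShortComplex.moduleCat_exact_iff] at h
  exact h s hs

lemma exists_local_preimage_of_exact {S : ShortComplex (TopCat.Sheaf (ModuleCat.{u} 𝕜) X)}
    (hS : S.Exact) {U : Opens X} {s : S.X₂.obj.obj (op U)} (hs : secMap S.g U s = 0) {x : X}
    (hx : x ∈ U) : ∃ (V : Opens X) (hV : V ≤ U), x ∈ V ∧
      ∃ t, secMap S.f V t = secRes S.X₂ hV s := by
  have h1 : Epi (Limits.kernel.lift S.g S.f S.zero) := hS.epi_kernelLift
  obtain ⟨t, ht⟩ := exists_preimage_of_exact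
    (S := ShortComplex.mk (Limits.kernel.ι S.g) S.g (Limits.kernel.condition _))
    (ShortComplex.exact_kernel S.g) hs
  obtain ⟨V, hV, hxV, r, hr⟩ := exists_local_preimage (Limits.kernel.lift S.g S.f S.zero) t hx
  refine ⟨V, hV, hxV, r, ?_⟩
  have h2 := congrArg (secMap (Limits.kernel.ι S.g) V) hr
  rw [← secMap_comp, Limits.kernel.lift_ι, secMap_secRes] at h2
  rw [h2, ← ht]

lemma exists_cycle (S : ShortComplex (TopCat.Sheaf (ModuleCat.{u} 𝕜) X)) (U : Opens X)
    (a : S.X₂.obj.obj (op U)) (ha : secMap S.g U a = 0) : ∃ t, secMap S.iCycles U t = a :=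
  exists_preimage_of_exact (S := ShortComplex.mk S.iCycles S.g S.iCycles_g)
    (ShortComplex.exact_of_f_is_kernel _ S.cyclesIsKernel) ha

variable {S T : ShortComplex (TopCat.Sheaf (ModuleCat.{u} 𝕜) X)} (φ : S ⟶ T)

/-- A morphism of complexes of sheaves is surjective on cohomology if, locally, closed sections of
the target lift to closed sections of the source. -/
lemma epi_homologyMap_of_local
    (hsurj : ∀ (U : Opens X) (y : T.X₂.obj.obj (op U)), secMap T.g U y = 0 → ∀ x ∈ U,
      ∃ (V : Opens X) (hV : V ≤ U), x ∈ V ∧ ∃ a, secMap S.g V a = 0 ∧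
        secMap φ.τ₂ V a = secRes T.X₂ hV y) :
    Epi (ShortComplex.homologyMap φ) := by
  refine ⟨fun {Z} p q hpq => ?_⟩
  rw [← cancel_epi T.homologyπ]
  refine sheafHom_eq_of_local fun U s x hx => ?_
  obtain ⟨V, hV, hxV, a, ha, hay⟩ := hsurj U (secMap T.iCycles U s)
    (by rw [← secMap_comp, T.iCycles_g, secMap_zero]) x hx
  obtain ⟨t, rfl⟩ := exists_cycle S V a ha
  refine ⟨V, hV, hxV, ?_⟩
  have h1 : secMap (ShortComplex.cyclesMap φ) V t = secRes _ hV s := by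
    refine secMap_injective T.iCycles V ?_
    rw [← secMap_comp, ShortComplex.cyclesMap_i, secMap_comp, hay, secMap_secRes]
  rw [← h1, ← secMap_comp, ← secMap_comp, ← ShortComplex.homologyπ_naturality_assoc,
    ← ShortComplex.homologyπ_naturality_assoc, hpq]

/-- A morphism of complexes of sheaves is injective on cohomology if, locally, closed sections of
the source with exact image are exact. -/
lemma mono_homologyMap_of_local
    (hinj : ∀ (U : Opens X) (a : S.X₂.obj.obj (op U)), secMap S.g U a = 0 →
      ∀ b', secMap φ.τ₂ U a = secMap T.f U b' → ∀ x ∈ U,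
        ∃ (V : Opens X) (hV : V ≤ U), x ∈ V ∧ ∃ b, secMap S.f V b = secRes S.X₂ hV a) :
    Mono (ShortComplex.homologyMap φ) := by
  refine Preadditive.mono_of_cancel_zero _ fun {Z} g hg => ?_
  refine sheafHom_eq_of_local fun U z x hx => ?_
  obtain ⟨V, hV, hxV, c, hc⟩ := exists_local_preimage S.homologyπ (secMap g U z) hx
  have h0 : secMap (g ≫ ShortComplex.homologyMap φ) U z = 0 := by rw [hg]; rfl
  have h1 : secMap T.homologyπ V (secMap (ShortComplex.cyclesMap φ) V c) = 0 := by
    have h2 : secMap (S.homologyπ ≫ ShortComplex.homologyMap φ) V c = 0 := by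
      rw [secMap_comp, hc, secMap_secRes, ← secMap_comp, h0, map_zero]
    rw [ShortComplex.homologyπ_naturality] at h2
    exact h2
  obtain ⟨V', hV', hxV', b', hb'⟩ := exists_local_preimage_of_exact
    (S := ShortComplex.mk T.toCycles T.homologyπ T.toCycles_comp_homologyπ)
    (ShortComplex.exact_of_g_is_cokernel _ T.homologyIsCokernel) h1 hxV
  have h2 : secMap T.toCycles V' b' =
      secMap (ShortComplex.cyclesMap φ) V' (secRes S.cycles hV' c) :=
    hb'.trans (secMap_secRes (ShortComplex.cyclesMap φ) hV' c).symm
  have h3 : secMap φ.τ₂ V' (secMap S.iCycles V' (secRes S.cycles hV' c)) =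
      secMap T.f V' b' := by
    rw [← T.toCycles_i, secMap_comp, h2, ← secMap_comp, ← secMap_comp, ShortComplex.cyclesMap_i]
  obtain ⟨V'', hV'', hxV'', b, hb⟩ := hinj V' (secMap S.iCycles V' (secRes S.cycles hV' c))
    (by rw [← secMap_comp, S.iCycles_g, secMap_zero]) b' h3 x hxV'
  have hVV : V'' ≤ V := le_trans hV'' hV'
  have hVU : V'' ≤ U := le_trans hVV hV
  refine ⟨V'', hVU, hxV'', ?_⟩
  have h5 : secMap S.toCycles V'' b = secRes S.cycles hVV c := by
    refine secMap_injective S.iCycles V'' ?_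
    have h6 : secMap S.iCycles V'' (secMap S.toCycles V'' b) = secMap S.f V'' b := by
      rw [← secMap_comp, S.toCycles_i]
    rw [← secRes_secRes hV'' hV', secMap_secRes S.iCycles hV'']
    exact h6.trans hb
  have h4 : secMap (S.toCycles ≫ S.homologyπ) V'' b = 0 := by
    rw [S.toCycles_comp_homologyπ]; rfl
  rw [secMap_secRes, ← secRes_secRes hVV hV, ← hc, ← secMap_secRes, ← h5,
    ← secMap_comp, h4]
  rfl

lemma shortComplex_quasiIso_of_local
    (hsurj : ∀ (U : Opens X) (y : T.X₂.obj.obj (op U)), secMap T.g U y = 0 → ∀ x ∈ U,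
      ∃ (V : Opens X) (hV : V ≤ U), x ∈ V ∧ ∃ a, secMap S.g V a = 0 ∧
        secMap φ.τ₂ V a = secRes T.X₂ hV y)
    (hinj : ∀ (U : Opens X) (a : S.X₂.obj.obj (op U)), secMap S.g U a = 0 →
      ∀ b', secMap φ.τ₂ U a = secMap T.f U b' → ∀ x ∈ U,
        ∃ (V : Opens X) (hV : V ≤ U), x ∈ V ∧ ∃ b, secMap S.f V b = secRes S.X₂ hV a) :
    ShortComplex.QuasiIso φ := by
  have := epi_homologyMap_of_local φ hsurj
  have := mono_homologyMap_of_local φ hinj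
  rw [ShortComplex.quasiIso_iff]
  exact isIso_of_mono_of_epi _

end SheafCriterion

section Complex

universe u

variable {𝕜 : Type} [RCLike 𝕜] {X : Type u} [TopologicalSpace X]

/-- A morphism of sheaves of differential graded algebras is a quasi-isomorphism if, locally, closed
sections of the target lift to closed sections of the source, and closed sections of the source
whose image is exact are exact. -/
lemma ShDGA.isQuasiIso_of_local {F F' : ShDGA 𝕜 X} (f : F ⟶ F')
    (hsurj : ∀ (k : ℕ) (U : Opens (TopCat.of X)) (y : (F'.obj.obj (op U)).carrier),
      y ∈ (F'.obj.obj (op U)).deg k → (F'.obj.obj (op U)).d y = 0 → ∀ x ∈ U,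
      ∃ (V : Opens (TopCat.of X)) (hV : V ≤ U), x ∈ V ∧
        ∃ a ∈ (F.obj.obj (op V)).deg k, (F.obj.obj (op V)).d a = 0 ∧
          (f.hom.app (op V)).toAlgHom a = (F'.obj.map (homOfLE hV).op).toAlgHom y)
    (hinj : ∀ (k : ℕ) (U : Opens (TopCat.of X)) (a : (F.obj.obj (op U)).carrier),
      a ∈ (F.obj.obj (op U)).deg (k + 1) → (F.obj.obj (op U)).d a = 0 →
      ∀ b' ∈ (F'.obj.obj (op U)).deg k,
        (f.hom.app (op U)).toAlgHom a = (F'.obj.obj (op U)).d b' → ∀ x ∈ U,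
      ∃ (V : Opens (TopCat.of X)) (hV : V ≤ U), x ∈ V ∧ ∃ b ∈ (F.obj.obj (op V)).deg k,
        (F.obj.obj (op V)).d b = (F.obj.map (homOfLE hV).op).toAlgHom a)
    (hinj0 : ∀ (U : Opens (TopCat.of X)) (a : (F.obj.obj (op U)).carrier),
      a ∈ (F.obj.obj (op U)).deg 0 → (F.obj.obj (op U)).d a = 0 →
        (f.hom.app (op U)).toAlgHom a = 0 → ∀ x ∈ U,
      ∃ (V : Opens (TopCat.of X)) (hV : V ≤ U), x ∈ V ∧
        (F.obj.map (homOfLE hV).op).toAlgHom a = 0) :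
    ShDGA.IsQuasiIso f := by
  have hd : ∀ (F : ShDGA 𝕜 X) (k : ℕ) (U : Opens (TopCat.of X))
      (a : ((F.degSheaf k).obj.obj (op U))),
      (secMap (((ShDGA.toComplex 𝕜 X).obj F).d k (k + 1)) U a).1 = (F.obj.obj (op U)).d a.1 := by
    intro F k U a
    have : ((ShDGA.toComplex 𝕜 X).obj F).d k (k + 1) = F.degSheafD k := CochainComplex.of_d _ _ _
    rw [this]; rfl
  have hf : ∀ (k : ℕ) (U : Opens (TopCat.of X)) (a : ((F.degSheaf k).obj.obj (op U))),
      (secMap (((ShDGA.toComplex 𝕜 X).map f).f k) U a).1 = (f.hom.app (op U)).toAlgHom a.1 :=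
    fun k U a => rfl
  change QuasiIso _
  rw [quasiIso_iff]
  have hs : ∀ (k : ℕ) (U : Opens (TopCat.of X)) (y : ((F'.degSheaf k).obj.obj (op U))),
      secMap (((ShDGA.toComplex 𝕜 X).obj F').d k (k + 1)) U y = 0 → ∀ x ∈ U,
      ∃ (V : Opens (TopCat.of X)) (hV : V ≤ U), x ∈ V ∧ ∃ a : ((F.degSheaf k).obj.obj (op V)),
        secMap (((ShDGA.toComplex 𝕜 X).obj F).d k (k + 1)) V a = 0 ∧
        secMap (((ShDGA.toComplex 𝕜 X).map f).f k) V a = secRes (F'.degSheaf k) hV y := by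
    intro k U y hy x hx
    obtain ⟨V, hV, hxV, a, hak, ha, he⟩ := hsurj k U y.1 y.2
      (by rw [← hd F' k U y, hy]; rfl) x hx
    exact ⟨V, hV, hxV, ⟨a, hak⟩, Subtype.ext ((hd F k V ⟨a, hak⟩).trans ha), Subtype.ext he⟩
  intro k
  rcases k with _ | k
  · rw [quasiIsoAt_iff' _ 0 0 1 (by simp) (by simp)]
    refine shortComplex_quasiIso_of_local _ (hs 0) fun U a ha b' hb' x hx => ?_
    have h0 : ((HomologicalComplex.shortComplexFunctor' _ _ 0 0 1).obj
        ((ShDGA.toComplex 𝕜 X).obj F')).f = 0 :=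
      ((ShDGA.toComplex 𝕜 X).obj F').shape 0 0 (by simp)
    have h1 : (f.hom.app (op U)).toAlgHom a.1 = 0 := by
      have := congrArg Subtype.val hb'
      rw [h0] at this
      exact this
    obtain ⟨V, hV, hxV, he⟩ := hinj0 U a.1 a.2 (by
      rw [← hd F 0 U a]; exact congrArg Subtype.val ha) h1 x hx
    exact ⟨V, hV, hxV, 0, (map_zero _).trans (Subtype.ext he.symm)⟩
  · rw [quasiIsoAt_iff' _ k (k + 1) (k + 2) (by simp) (by simp)]
    refine shortComplex_quasiIso_of_local _ (hs (k + 1)) fun U a ha b' hb' x hx => ?_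
    obtain ⟨V, hV, hxV, b, hb, he⟩ := hinj k U a.1 a.2 (by
      rw [← hd F (k + 1) U a]; exact congrArg Subtype.val ha) b'.1 b'.2 (by
      rw [← hd F' k U b']; exact congrArg Subtype.val hb') x hx
    exact ⟨V, hV, hxV, ⟨b, hb⟩, Subtype.ext ((hd F k V ⟨b, hb⟩).trans he)⟩

end Complex

/-! ### Local deformation retracts -/

section Retraction

universe u v

variable {𝕜 : Type} [RCLike 𝕜]
variable {V : Type} [NormedAddCommGroup V] [NormedSpace ℝ V] [FiniteDimensional ℝ V]
  {H : Type} [TopologicalSpace H] {I : ModelWithCorners ℝ V H} [I.Boundaryless]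
  {M : Type u} [TopologicalSpace M] [ChartedSpace H M] [IsManifold I ∞ M]
variable {W : Type} [NormedAddCommGroup W] [NormedSpace ℝ W] [FiniteDimensional ℝ W]
  {G : Type} [TopologicalSpace G] {J : ModelWithCorners ℝ W G} [J.Boundaryless]
  {N : Type u} [TopologicalSpace N] [ChartedSpace G N] [IsManifold J ∞ N]
variable {V₃ : Type} [NormedAddCommGroup V₃] [NormedSpace ℝ V₃] [FiniteDimensional ℝ V₃]
  {G₃ : Type} [TopologicalSpace G₃] {I₃ : ModelWithCorners ℝ V₃ G₃} [I₃.Boundaryless]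
  {M₃ : Type u} [TopologicalSpace M₃] [ChartedSpace G₃ M₃] [IsManifold I₃ ∞ M₃]
variable {X : Type u} [TopologicalSpace X] {Y : Set X}

/-- Two maps that agree on a regular domain have the same differential there. -/
lemma mder_congr_of_eqOn {g g' : M → N} {D : Set M} (hr : RegularDomain I D) (h : EqOn g g' D)
    {x : M} (hx : x ∈ D) (hg : MDifferentiableAt I J g x) (hg' : MDifferentiableAt I J g' x) :
    mder I J g x = mder I J g' x := by
  have hu := hr.unique x hx
  have h1 : mfderivWithin I J g D x = mfderiv I J g x := mfderivWithin_eq_mfderiv hu hg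
  have h2 : mfderivWithin I J g' D x = mfderiv I J g' x := mfderivWithin_eq_mfderiv hu hg'
  have h3 : (mfderivWithin I J g D x : V →L[ℝ] W) = mfderivWithin I J g' D x :=
    mfderivWithin_congr h (h hx)
  exact (h1.symm.trans h3).trans h2

lemma pullField_congr_of_eqOn {g g' : M → N} {D : Set M} (hr : RegularDomain I D)
    (h : EqOn g g' D) {x : M} (hx : x ∈ D) (hg : MDifferentiableAt I J g x)
    (hg' : MDifferentiableAt I J g' x) (η : CovField 𝕜 W N) :
    pullField 𝕜 I J g η x = pullField 𝕜 I J g' η x := by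
  rw [pullField, pullField, mder_congr_of_eqOn hr h hx hg hg', h hx]

lemma pullField_comp {g : M → N} {g' : N → M₃} {x : M} (hg : MDifferentiableAt I J g x)
    (hg' : MDifferentiableAt J I₃ g' (g x)) (η : CovField 𝕜 V₃ M₃) :
    pullField 𝕜 I I₃ (g' ∘ g) η x = pullField 𝕜 I J g (pullField 𝕜 J I₃ g' η) x := by
  have : mder I I₃ (g' ∘ g) x = (mder J I₃ g' (g x)) ∘L (mder I J g x) := mfderiv_comp x hg' hg
  rw [pullField, this, covMap_comp]; rfl

/-- The restriction of a pulled back form to a slice of the cylinder. -/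
lemma fiberRestrict_pullField {g : M × ℝ → N} {x : M} {s : ℝ}
    (hg : MDifferentiableAt (I.prod 𝓘(ℝ, ℝ)) J g (x, s)) (η : CovField 𝕜 W N) :
    fiberRestrict 𝕜 V (pullField 𝕜 (I.prod 𝓘(ℝ, ℝ)) J g η (x, s)) =
      pullField 𝕜 I J (fun y => g (y, s)) η x := by
  have h1 : HasMFDerivAt I (I.prod 𝓘(ℝ, ℝ)) (fun y : M => (y, s)) x
      (ContinuousLinearMap.inl ℝ V ℝ) :=
    (hasMFDerivAt_id x).prodMk (hasMFDerivAt_const s x)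
  have h2 : (mder I J (fun y => g (y, s)) x : V →L[ℝ] W) =
      (mder (I.prod 𝓘(ℝ, ℝ)) J g (x, s)).comp (ContinuousLinearMap.inl ℝ V ℝ) :=
    (hg.hasMFDerivAt.comp x h1).mfderiv
  rw [pullField, pullField, h2, covMap_comp]
  rfl

/-- Local data, over `U ⊆ U'`, exhibiting a map `v` of pole data as a deformation retract: a
retraction `r` and a homotopy `K` from `v ∘ r` to the identity. -/
structure PoleDatum.Hom.IsLocalRetract {P : PoleDatum I M Y} {Q : PoleDatum J N Y} (v : P.Hom Q)
    (U U' : Set X) (r : N → M) (K : N × ℝ → N) : Prop where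
  retraction : Q.IsLocalHom P U U' r
  homotopy : Q.cylinder.IsLocalHom Q U U' K
  comp_eq : ∀ x ∈ P.S, P.proj x ∈ U → r (v.toFun x) = x
  one_eq : ∀ z ∈ Q.S, Q.proj z ∈ U → K (z, 1) = z
  zero_eq : ∀ z ∈ Q.S, Q.proj z ∈ U → K (z, 0) = v.toFun (r z)

variable {P : PoleDatum I M Y} {Q : PoleDatum J N Y} {v : P.Hom Q} {U U' : Set X} {r : N → M}
  {K : N × ℝ → N}

lemma PoleDatum.IsLocalHom.smooth_offY {P : PoleDatum I M Y} {Q : PoleDatum J N Y} {g : M → N}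
    (hg : P.IsLocalHom Q U U' g) : ∀ m ∈ P.offY U, ContMDiffAt I J ∞ g m :=
  fun m hm => hg.smooth m hm.1 hm.2.1

lemma PoleDatum.IsLocalHom.dForm_pullField {P : PoleDatum I M Y} {Q : PoleDatum J N Y} {g : M → N}
    (hU : IsOpen U) (hU' : IsOpen U') (hg : P.IsLocalHom Q U U' g) {η : CovField 𝕜 W N}
    (hη : Q.HasPoles 𝕜 U' η) {m : M} (hm : m ∈ P.offY U) :
    dForm 𝕜 I (P.offY U) (pullField 𝕜 I J g η) m =
      pullField 𝕜 I J g (dForm 𝕜 J (Q.offY U') η) m :=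
  dForm_pull_of_contMDiffAt hg.smooth_offY (P.regular_offY hU) (Q.regular_offY hU')
    hg.mapsTo_offY hη.1 hm

/-- The pull-back along the retraction is a right inverse of the pull-back along the inclusion. -/
lemma PoleDatum.Hom.IsLocalRetract.pullField_pullField (h : v.IsLocalRetract U U' r K)
    (hU : IsOpen U) (η : CovField 𝕜 V M) {x : M} (hx : x ∈ P.offY U) :
    pullField 𝕜 I J v.toFun (pullField 𝕜 J I r η) x = η x := by
  have hv := v.mem_offY hx
  have h1 := (h.retraction.smooth_offY _ hv).mdifferentiableAt (by simp)
  have h2 := v.smooth.mdifferentiable (by simp) x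
  rw [← pullField_comp h2 h1]
  have h4 : EqOn (r ∘ v.toFun) _root_.id (P.offY U) := fun m hm => h.comp_eq m hm.1 hm.2.1
  have h3 := pullField_congr_of_eqOn (P.regular_offY hU) h4 hx (h1.comp x h2)
    mdifferentiableAt_id η
  rw [h3, pullField_id]

/-- The chain homotopy for closed forms. -/
lemma PoleDatum.Hom.IsLocalRetract.dForm_fiberIntegral (h : v.IsLocalRetract U U' r K)
    (hQ : ∀ x₀, IsLocallyConvex (chartSet J Q.S x₀)) (hU : IsOpen U) (hU' : IsOpen U')
    {α : CovField 𝕜 W N} (hα : Q.HasPoles 𝕜 U' α)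
    (hd : ∀ z ∈ Q.offY U', dForm 𝕜 J (Q.offY U') α z = 0) {z : N} (hz : z ∈ Q.offY U) :
    dForm 𝕜 J (Q.offY U) (fiberIntegral 0 1 (pullField 𝕜 (J.prod 𝓘(ℝ, ℝ)) J K α)) z =
      α z - pullField 𝕜 J I r (pullField 𝕜 I J v.toFun α) z := by
  have hK := hα.pull_of_isLocalHom hU h.homotopy
  have hs := hK.1
  rw [Q.offY_cylinder] at hs
  have hcD : ∀ x₀, IsLocallyConvex (chartSet J (Q.offY U) x₀) := fun x₀ => by
    rw [Q.offY_eq]; exact isLocallyConvex_chartSet_inter (Q.isOpen_pre hU) (hQ x₀)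
  have hmem : ∀ s ∈ Icc (0 : ℝ) 1, (z, s) ∈ Q.cylinder.offY U := fun s hs => by
    rw [Q.offY_cylinder]; exact ⟨hz, hs⟩
  have key := MorseBottForms.dForm_fiberIntegral (Q.regular_offY hU) hcD zero_lt_one hs hz
  have h0 : fiberIntegral 0 1 (dForm 𝕜 (J.prod 𝓘(ℝ, ℝ)) (Q.offY U ×ˢ Icc 0 1)
      (pullField 𝕜 (J.prod 𝓘(ℝ, ℝ)) J K α)) z = 0 := by
    refine fiberIntegral_eq_zero zero_le_one fun s hs => ?_
    have h1 := h.homotopy.dForm_pullField hU hU' hα (hmem s hs)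
    rw [Q.offY_cylinder] at h1
    rw [h1, pullField, hd _ (h.homotopy.mapsTo_offY (hmem s hs)), map_zero, map_zero]
  have hKd : ∀ s ∈ Icc (0 : ℝ) 1, ∀ {z}, z ∈ Q.offY U →
      MDifferentiableAt (J.prod 𝓘(ℝ, ℝ)) J K (z, s) :=
    fun s hs z hz => (h.homotopy.smooth (z, s) ⟨hz.1, hs⟩ hz.2.1).mdifferentiableAt (by simp)
  have hslice : ∀ s ∈ Icc (0 : ℝ) 1, MDifferentiableAt J J (fun y => K (y, s)) z :=
    fun s hs => (hKd s hs hz).comp z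
      ((mdifferentiableAt_id (I := J)).prodMk (mdifferentiableAt_const (c := s)))
  have hr := (h.retraction.smooth_offY _ hz).mdifferentiableAt (n := ∞) (by simp)
  have hv := v.smooth.mdifferentiable (by simp) (r z)
  have hone : EqOn (fun y => K (y, 1)) _root_.id (Q.offY U) := fun m hm => h.one_eq m hm.1 hm.2.1
  have hzero : EqOn (fun y => K (y, 0)) (v.toFun ∘ r) (Q.offY U) := fun m hm =>
    h.zero_eq m hm.1 hm.2.1
  rw [h0, add_zero, fiberRestrict_pullField (hKd 1 (by simp) hz),
    fiberRestrict_pullField (hKd 0 (by simp) hz),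
    pullField_congr_of_eqOn (Q.regular_offY hU) hone hz (hslice 1 (by simp)) mdifferentiableAt_id,
    pullField_congr_of_eqOn (Q.regular_offY hU) hzero hz (hslice 0 (by simp)) (hv.comp z hr),
    pullField_id, pullField_comp hr hv] at key
  exact key

end Retraction

section QuasiIso

universe u

variable {𝕜 : Type} [RCLike 𝕜]
variable {V : Type} [NormedAddCommGroup V] [NormedSpace ℝ V] [FiniteDimensional ℝ V]
  {H : Type} [TopologicalSpace H] {I : ModelWithCorners ℝ V H} [I.Boundaryless]
  {M : Type u} [TopologicalSpace M] [ChartedSpace H M] [IsManifold I ∞ M]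
variable {W : Type} [NormedAddCommGroup W] [NormedSpace ℝ W] [FiniteDimensional ℝ W]
  {G : Type} [TopologicalSpace G] {J : ModelWithCorners ℝ W G} [J.Boundaryless]
  {N : Type u} [TopologicalSpace N] [ChartedSpace G N] [IsManifold J ∞ N]
variable {X : Type u} [TopologicalSpace X] {Y : Set X}

lemma PoleDatum.zeroExt_mem {P : PoleDatum I M Y} {U : Set X} {k : ℕ} {a : P.sections 𝕜 U}
    (ha : a ∈ P.sectionsDeg 𝕜 U k) {m : M} (hm : m ∈ P.offY U) :
    zeroExt 𝕜 a.1 m ∈ ⋀[𝕜]^k (V →ₗ[ℝ] 𝕜) := by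
  rw [zeroExt_apply _ hm]; exact ha ⟨m, hm⟩

lemma PoleDatum.dForm_zeroExt_eq {P : PoleDatum I M Y} (U : Opens X)
    {a b : P.sections 𝕜 (U : Set X)}
    (h : P.sectionsD 𝕜 U a = b) {m : M} (hm : m ∈ P.offY U) :
    dForm 𝕜 I (P.offY U) (zeroExt 𝕜 a.1) m = zeroExt 𝕜 b.1 m := by
  rw [zeroExt_apply _ hm, ← h]; rfl

lemma PoleDatum.sectionsD_mk_eq {P : PoleDatum I M Y} (U : Opens X) {η : CovField 𝕜 V M}
    (hη : P.HasPoles 𝕜 U η) (m : P.offY (U : Set X)) :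
    (P.sectionsD 𝕜 U ⟨_, mem_sections hη⟩).1 m = dForm 𝕜 I (P.offY U) η m :=
  dForm_congr (fun _ hm => ((zeroExt_eqOn η) hm).symm) m.2

lemma PoleDatum.Hom.sheafMap_apply {P : PoleDatum I M Y} {Q : PoleDatum J N Y} (v : P.Hom Q)
    (U : Opens (TopCat.of X)) (a : Q.sections 𝕜 (U : Set X)) (m : P.offY (U : Set X)) :
    (((v.sheafMap (𝕜 := 𝕜)).hom.app (op U)).toAlgHom a).1 m =
      pullField 𝕜 I J v.toFun (zeroExt 𝕜 a.1) m.1 := by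
  rw [pullField, zeroExt_apply _ (v.mem_offY m.2)]
  rfl

variable {P : PoleDatum I M Y} {Q : PoleDatum J N Y} {v : P.Hom Q} {O U : Opens X} {r : N → M}
  {K : N × ℝ → N}

/-- Closed forms lift, by pull-back along the retraction. -/
lemma PoleDatum.Hom.IsLocalRetract.exists_lift (h : v.IsLocalRetract (O : Set X) U r K)
    (hOU : O ≤ U)
    {k : ℕ} {y : P.sections 𝕜 (U : Set X)} (hyk : y ∈ P.sectionsDeg 𝕜 U k)
    (hy : P.sectionsD 𝕜 U y = 0) :
    ∃ a : Q.sections 𝕜 (O : Set X), a ∈ Q.sectionsDeg 𝕜 O k ∧ Q.sectionsD 𝕜 O a = 0 ∧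
      ∀ (m) (hm : m ∈ P.offY O), pullField 𝕜 I J v.toFun (zeroExt 𝕜 a.1) m =
        y.1 ⟨m, hm.1, hOU hm.2.1, hm.2.2⟩ := by
  have hO : IsOpen (O : Set X) := O.2
  have hU : IsOpen (U : Set X) := U.2
  have hp : Q.HasPoles 𝕜 O (pullField 𝕜 J I r (zeroExt 𝕜 y.1)) :=
    y.2.pull_of_isLocalHom hO h.retraction
  refine ⟨⟨_, mem_sections hp⟩, fun m => ?_, Subtype.ext (funext fun m => ?_), fun m hm => ?_⟩
  · exact covMap_mem _ (zeroExt_mem hyk (h.retraction.mapsTo_offY m.2))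
  · rw [sectionsD_mk_eq O hp m, h.retraction.dForm_pullField hO hU y.2 m.2, pullField,
      dForm_zeroExt_eq U hy (h.retraction.mapsTo_offY m.2),
      zeroExt_apply _ (h.retraction.mapsTo_offY m.2)]
    exact map_zero _
  · have h1 : pullField 𝕜 I J v.toFun
        (zeroExt 𝕜 (fun m : Q.offY (O : Set X) => pullField 𝕜 J I r (zeroExt 𝕜 y.1) m)) m =
        pullField 𝕜 I J v.toFun (pullField 𝕜 J I r (zeroExt 𝕜 y.1)) m := by
      rw [pullField, zeroExt_apply _ (v.mem_offY hm)]; rfl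
    have hm' : m ∈ P.offY (U : Set X) := ⟨hm.1, hOU hm.2.1, hm.2.2⟩
    rw [h1, h.pullField_pullField hO _ hm, zeroExt_apply _ hm']

/-- A closed form with exact restriction is exact: a primitive is the sum of the fibre integral of
its pull-back along the homotopy and of the pull-back of a primitive along the retraction. -/
lemma PoleDatum.Hom.IsLocalRetract.exists_primitive (h : v.IsLocalRetract (O : Set X) U r K)
    (hOU : O ≤ U) (hQ : ∀ x₀, IsLocallyConvex (chartSet J Q.S x₀))
    {k : ℕ} {a : Q.sections 𝕜 (U : Set X)} (hak : a ∈ Q.sectionsDeg 𝕜 U (k + 1))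
    (ha : Q.sectionsD 𝕜 U a = 0) {b : P.sections 𝕜 (U : Set X)} (hbk : b ∈ P.sectionsDeg 𝕜 U k)
    (hab : ∀ (m) (hm : m ∈ P.offY U), pullField 𝕜 I J v.toFun (zeroExt 𝕜 a.1) m =
      (P.sectionsD 𝕜 U b).1 ⟨m, hm⟩) :
    ∃ c : Q.sections 𝕜 (O : Set X), c ∈ Q.sectionsDeg 𝕜 O k ∧
      ∀ (z) (hz : z ∈ Q.offY O), (Q.sectionsD 𝕜 O c).1 ⟨z, hz⟩ =
        a.1 ⟨z, hz.1, hOU hz.2.1, hz.2.2⟩ := by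
  have hO : IsOpen (O : Set X) := O.2
  have hU : IsOpen (U : Set X) := U.2
  have hd : ∀ z ∈ Q.offY (U : Set X), dForm 𝕜 J (Q.offY U) (zeroExt 𝕜 a.1) z = 0 := fun z hz => by
    rw [dForm_zeroExt_eq U ha hz, zeroExt_apply _ hz]; rfl
  have hK := a.2.pull_of_isLocalHom hO h.homotopy
  have hp1 := hK.fiberIntegral hQ hO
  have hp2 := b.2.pull_of_isLocalHom hO h.retraction
  have hp := hp1.add hp2
  refine ⟨⟨_, mem_sections hp⟩, fun z => ?_, fun z hz => ?_⟩
  · refine Submodule.add_mem _ (fiberIntegral_mem zero_le_one (fun s hs => ?_) ?_)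
      (covMap_mem _ (zeroExt_mem hbk (h.retraction.mapsTo_offY z.2)))
    · have hm : (z.1, s) ∈ Q.cylinder.offY O := by rw [Q.offY_cylinder]; exact ⟨z.2, hs⟩
      exact covMap_mem _ (zeroExt_mem hak (h.homotopy.mapsTo_offY hm))
    · have hs := hK.1
      rw [Q.offY_cylinder] at hs
      exact intervalIntegrable_fiberContract zero_le_one hs z.2
  · have hr := h.retraction.mapsTo_offY hz
    have h1 : pullField 𝕜 I J v.toFun (zeroExt 𝕜 a.1) (r z) =
        dForm 𝕜 I (P.offY U) (zeroExt 𝕜 b.1) (r z) := hab _ hr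
    have hz' : z ∈ Q.offY (U : Set X) := ⟨hz.1, hOU hz.2.1, hz.2.2⟩
    rw [sectionsD_mk_eq O hp ⟨z, hz⟩, dForm_add (Q.regular_offY hO) hp1.1 hp2.1 hz,
      h.dForm_fiberIntegral hQ hO hU a.2 hd hz, h.retraction.dForm_pullField hO hU b.2 hz,
      pullField, h1, ← zeroExt_apply a.1 hz']
    exact sub_add_cancel _ _

/-- A closed function with zero restriction is zero. -/
lemma PoleDatum.Hom.IsLocalRetract.eq_zero (h : v.IsLocalRetract (O : Set X) U r K)
    (hOU : O ≤ U) (hQ : ∀ x₀, IsLocallyConvex (chartSet J Q.S x₀))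
    {a : Q.sections 𝕜 (U : Set X)} (hak : a ∈ Q.sectionsDeg 𝕜 U 0)
    (ha : Q.sectionsD 𝕜 U a = 0)
    (ha0 : ∀ m ∈ P.offY (U : Set X), pullField 𝕜 I J v.toFun (zeroExt 𝕜 a.1) m = 0)
    (z) (hz : z ∈ Q.offY O) : a.1 ⟨z, hz.1, hOU hz.2.1, hz.2.2⟩ = 0 := by
  have hO : IsOpen (O : Set X) := O.2
  have hU : IsOpen (U : Set X) := U.2
  have hd : ∀ z ∈ Q.offY (U : Set X), dForm 𝕜 J (Q.offY U) (zeroExt 𝕜 a.1) z = 0 := fun z hz => by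
    rw [dForm_zeroExt_eq U ha hz, zeroExt_apply _ hz]; rfl
  have key := h.dForm_fiberIntegral hQ hO hU a.2 hd hz
  have h3 : ∀ z ∈ Q.offY (O : Set X), fiberIntegral 0 1
      (pullField 𝕜 (J.prod 𝓘(ℝ, ℝ)) J K (zeroExt 𝕜 a.1)) z = (fun _ => algebraMap 𝕜 _ 0) z := by
    intro z hz
    beta_reduce
    rw [map_zero]
    -- the contraction of a function vanishes
    refine fiberIntegral_eq_zero zero_le_one fun s hs => fiberContract_eq_zero ?_
    have hm : (z, s) ∈ Q.cylinder.offY O := by rw [Q.offY_cylinder]; exact ⟨hz, hs⟩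
    exact covMap_mem _ (zeroExt_mem hak (h.homotopy.mapsTo_offY hm))
  have hz' : z ∈ Q.offY (U : Set X) := ⟨hz.1, hOU hz.2.1, hz.2.2⟩
  rw [dForm_congr h3 hz, dForm_const, pullField, ha0 _ (h.retraction.mapsTo_offY hz), map_zero,
    sub_zero, zeroExt_apply _ hz'] at key
  exact key.symm

/-- A map of pole data that, locally over the base, is the inclusion of a deformation retract
induces a quasi-isomorphism. -/
theorem PoleDatum.Hom.isQuasiIso_sheafMap (v : P.Hom Q)
    (hQ : ∀ x₀, IsLocallyConvex (chartSet J Q.S x₀))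
    (h : ∀ (U : Opens X), ∀ x ∈ U, ∃ O ≤ U, x ∈ O ∧
      ∃ r K, v.IsLocalRetract (O : Set X) U r K) :
    ShDGA.IsQuasiIso (v.sheafMap (𝕜 := 𝕜)) := by
  refine ShDGA.isQuasiIso_of_local _ ?_ ?_ ?_
  · intro k U y hyk hy x hx
    obtain ⟨O, hOU, hxO, r, K, hrK⟩ := h U x hx
    obtain ⟨a, hak, ha, hay⟩ := hrK.exists_lift hOU hyk hy
    exact ⟨O, hOU, hxO, a, hak, ha, Subtype.ext (funext fun m =>
      (v.sheafMap_apply O a m).trans ((hay m.1 m.2).trans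
        (P.presheaf_map_apply (homOfLE hOU).op y m).symm))⟩
  · intro k U a hak ha b hbk hab x hx
    obtain ⟨O, hOU, hxO, r, K, hrK⟩ := h U x hx
    obtain ⟨c, hck, hc⟩ := hrK.exists_primitive hOU hQ hak ha hbk fun m hm =>
      (v.sheafMap_apply U a ⟨m, hm⟩).symm.trans (congrFun (congrArg Subtype.val hab) ⟨m, hm⟩)
    exact ⟨O, hOU, hxO, c, hck, Subtype.ext (funext fun m =>
      (hc m.1 m.2).trans (Q.presheaf_map_apply (homOfLE hOU).op a m).symm)⟩
  · intro U a hak ha h0 x hx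
    obtain ⟨O, hOU, hxO, r, K, hrK⟩ := h U x hx
    exact ⟨O, hOU, hxO, Subtype.ext (funext fun m =>
      (Q.presheaf_map_apply (homOfLE hOU).op a m).trans (hrK.eq_zero hOU hQ hak ha (fun m hm =>
        (v.sheafMap_apply U a ⟨m, hm⟩).symm.trans
          (congrFun (congrArg Subtype.val h0) ⟨m, hm⟩)) m.1 m.2))⟩

end QuasiIso

/-! ### Restriction to a vertex -/

section Vertex

universe u

variable {𝕜 : Type} [RCLike 𝕜] {n m : ℕ} {X : Type u} [TopologicalSpace X]
  [ChartedSpace (EuclideanSpace ℝ (Fin n)) X] [IsManifold (𝓡 n) ∞ X] {Y : Set X}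
  (hY : IsClosedSubmanifold n m Y) {p : ℕ} (σ : AffineSimplex n m Y p) (i : Fin (p + 1))

/-- A smooth family `g ((·, t), s)` of local maps of `X` that intertwines the functions
`∑ tⱼ μⱼ`, as the parameter `t` moves to a vertex, yields a local retraction onto that vertex. -/
lemma isLocalRetract_of_isotopy {O U : Set X} {g : (X × (Fin p → ℝ)) × ℝ → X}
    (hg : ∀ x ∈ O, ∀ t ∈ geomSimplex p, ∀ s ∈ Icc (0 : ℝ) 1,
      ContMDiffAt (((𝓡 n).prod 𝓘(ℝ, Fin p → ℝ)).prod 𝓘(ℝ, ℝ)) (𝓡 n) ∞ g ((x, t), s))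
    (hU : ∀ x ∈ O, ∀ t ∈ geomSimplex p, ∀ s ∈ Icc (0 : ℝ) 1, g ((x, t), s) ∈ U)
    (hgY : ∀ x ∈ O, ∀ t ∈ geomSimplex p, ∀ s ∈ Icc (0 : ℝ) 1, (g ((x, t), s) ∈ Y ↔ x ∈ Y))
    (hμ : Disjoint O Y ∨ ∀ x ∈ O, ∀ t ∈ geomSimplex p, ∀ s ∈ Icc (0 : ℝ) 1,
      ∑ j, bary (contractTo i t s) j * (σ.vertex j).1 (g ((x, t), s)) =
        ∑ j, bary t j * (σ.vertex j).1 x)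
    (hone : ∀ x ∈ O, ∀ t ∈ geomSimplex p, g ((x, t), 1) = x)
    (hvertex : ∀ x ∈ O, g ((x, geomVertex i), 0) = x) :
    (vertexHom hY σ i).IsLocalRetract O U (fun z => g (z, 0))
      (fun q => (g q, contractTo i q.1.2 q.2)) where
  retraction :=
    { smooth := fun z hz hO => (hg z.1 hO z.2 hz.2 0 (by simp)).comp z
        (contMDiffAt_id.prodMk contMDiffAt_const)
      mapsTo := fun z hz hO => mem_univ _
      proj_mem := fun z hz hO => hU z.1 hO z.2 hz.2 0 (by simp)
      proj_mem_iff := fun z hz hO => hgY z.1 hO z.2 hz.2 0 (by simp)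
      μ_comp := by
        refine hμ.imp_right fun h z hz hO => ?_
        have h1 := h z.1 hO z.2 hz.2 0 (by simp)
        rw [contractTo_zero, bary_geomVertex] at h1
        have h2 : (σ.vertex i).1 (g (z, 0)) = ∑ j, bary z.2 j * (σ.vertex j).1 z.1 := by
          simpa [Pi.single_apply] using h1
        exact h2 }
  homotopy :=
    { smooth := fun q hq hO => (hg q.1.1 hO q.1.2 hq.1.2 q.2 hq.2).prodMk
        (((contDiff_contractTo i).contMDiff.comp
          ((contMDiff_snd.comp contMDiff_fst).prodMk_space contMDiff_snd)).contMDiffAt)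
      mapsTo := fun q hq hO => ⟨mem_univ _, contractTo_mem i hq.1.2 hq.2⟩
      proj_mem := fun q hq hO => hU q.1.1 hO q.1.2 hq.1.2 q.2 hq.2
      proj_mem_iff := fun q hq hO => hgY q.1.1 hO q.1.2 hq.1.2 q.2 hq.2
      μ_comp := hμ.imp_right fun h q hq hO => h q.1.1 hO q.1.2 hq.1.2 q.2 hq.2 }
  comp_eq x _ hO := hvertex x hO
  one_eq z hz hO := Prod.ext (hone z.1 hO z.2 hz.2) (contractTo_one i z.2)
  zero_eq z _ _ := Prod.ext rfl (contractTo_zero i z.2)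

lemma isLocalRetract_of_disjoint {O : Set X} (hO : Disjoint O Y) {U : Set X} (hOU : O ⊆ U) :
    (vertexHom hY σ i).IsLocalRetract O U (fun z => z.1)
      (fun q => (q.1.1, contractTo i q.1.2 q.2)) :=
  isLocalRetract_of_isotopy hY σ i (g := fun q => q.1.1)
    (fun _ _ _ _ _ _ => (contMDiff_fst.comp contMDiff_fst).contMDiffAt)
    (fun _ hx _ _ _ _ => hOU hx) (fun _ _ _ _ _ _ => Iff.rfl) (.inl hO) (fun _ _ _ _ => rfl)
    (fun _ _ => rfl)

omit [IsManifold (𝓡 n) ∞ X] in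
/-- The convex combinations of nonnegative Morse–Bott functions vanish exactly on `Y`. -/
lemma sum_bary_mul_eq_zero_iff {t : Fin p → ℝ} (ht : t ∈ geomSimplex p) (x : X) :
    ∑ j, bary t j * (σ.vertex j).1 x = 0 ↔ x ∈ Y := by
  have ht' : bary t ∈ stdSimplex ℝ (Fin (p + 1)) := ht
  rw [Finset.sum_eq_zero_iff_of_nonneg fun j _ => mul_nonneg (ht'.1 j) ((σ.vertex j).2.2.1 x)]
  constructor
  · intro h
    by_contra hx
    have h0 : ∀ j, bary t j = 0 := fun j =>
      (mul_eq_zero.1 (h j (Finset.mem_univ _))).resolve_right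
        fun h => hx (((σ.vertex j).2.2.2.1 x).1 h)
    have := ht'.2
    simp [h0] at this
  · intro hx j _
    rw [((σ.vertex j).2.2.2.1 x).2 hx, mul_zero]

include hY in
/-- The isotopy of the parametrized Morse–Bott lemma, in a slice chart. The projection is onto the
orthogonal complement of the slice, on which all Hessians are positive definite. -/
lemma exists_chart_isotopy {φ : OpenPartialHomeomorph X (EuclideanSpace ℝ (Fin n))}
    (hφ : φ ∈ IsManifold.maximalAtlas (𝓡 n) ∞ X)
    (hs : ∀ x ∈ φ.source, x ∈ Y ↔ ∀ i : Fin n, (i : ℕ) < m → φ x i = 0)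
    {y : X} (hy : y ∈ φ.source) (hyY : y ∈ Y) {Ω : Set (EuclideanSpace ℝ (Fin n))}
    (hΩ : IsOpen Ω) (hΩφ : Ω ⊆ φ.target) (hyΩ : φ y ∈ Ω) :
    ∃ (V : Set (EuclideanSpace ℝ (Fin n))) (Q : Set ((EuclideanSpace ℝ (Fin n) × (Fin p → ℝ)) × ℝ))
      (g : (EuclideanSpace ℝ (Fin n) × (Fin p → ℝ)) × ℝ → EuclideanSpace ℝ (Fin n)),
      IsOpen V ∧ φ y ∈ V ∧ V ⊆ Ω ∧ IsOpen Q ∧ (V ×ˢ geomSimplex p) ×ˢ Icc 0 1 ⊆ Q ∧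
      ContDiffOn ℝ ∞ g Q ∧ MapsTo g Q Ω ∧
      (∀ q ∈ (V ×ˢ geomSimplex p) ×ˢ Icc (0 : ℝ) 1,
        ∑ j, bary (contractTo i q.1.2 q.2) j * (σ.vertex j).1 (φ.symm (g q)) =
          ∑ j, bary q.1.2 j * (σ.vertex j).1 (φ.symm q.1.1)) ∧
      (∀ z ∈ V, ∀ t ∈ geomSimplex p, g ((z, t), 1) = z) ∧
      (∀ z ∈ V, ∀ s ∈ Icc (0 : ℝ) 1, g ((z, geomVertex i), s) = z) := by
  let π := (sliceSubspace n m)ᗮ.starProjection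
  have hππ : π * π = π := Submodule.isIdempotentElem_starProjection _
  have hker : ∀ z, π z = 0 ↔ z ∈ sliceSubspace n m := fun z => by
    rw [Submodule.starProjection_apply_eq_zero_iff, Submodule.orthogonal_orthogonal]
  have hf : ∀ j, ContDiffOn ℝ ∞ (fun z => (σ.vertex j).1 (φ.symm z)) φ.target := fun j =>
    contDiffOn_comp_chart hφ (σ.vertex j).2.1
  have h0 : ∀ j, (σ.vertex j).1 (φ.symm (φ y)) = 0 := fun j => by
    rw [φ.left_inv hy]; exact ((σ.vertex j).2.2.2.1 y).2 hyY
  refine exists_isotopy (π := π) (isSelfAdjoint_starProjection _) hππ hΩ hyΩ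
    ((hker _).2 ((hs y hy).1 hyY)) (f := fun j z => (σ.vertex j).1 (φ.symm z))
    (fun j => (hf j).mono hΩφ) (fun j z _ => (σ.vertex j).2.2.1 _) (fun j z hz hπz => ?_)
    (fun j v hv => ?_) i
  · refine ((σ.vertex j).2.2.2.1 _).2 ((hs _ (φ.map_target (hΩφ hz))).2 ?_)
    rw [φ.right_inv (hΩφ hz)]
    exact (hker z).1 hπz
  · refine lt_of_le_of_ne (hess_nonneg φ.open_target (hf j) (φ.map_source hy)
      (fun z _ => (σ.vertex j).2.2.1 _) (h0 j) _) fun he => hv ?_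
    have h1 := (finrank_hessianAt_iff hY hφ hs hy hyY (σ.vertex j).2.1 (σ.vertex j).2.2.1
      (σ.vertex j).2.2.2.1).1 ((σ.vertex j).2.2.2.2 y hyY) _ he.symm
    rw [← hππ]
    exact (hker _).2 h1

/-- Locally on `X`, the restriction to a vertex is the restriction to a deformation retract. -/
lemma exists_isLocalRetract (U : Opens X) {x : X} (hx : x ∈ U) :
    ∃ O ≤ U, x ∈ O ∧ ∃ r K, (vertexHom hY σ i).IsLocalRetract (O : Set X) U r K := by
  -- away from `Y` there are no poles, and only the parameter `t` has to be moved
  by_cases hxY : x ∈ Y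
  swap
  · have hU : IsOpen (U : Set X) := U.2
    exact ⟨⟨U \ Y, hU.sdiff hY.isClosed⟩, fun z hz => hz.1, ⟨hx, hxY⟩, _, _,
      isLocalRetract_of_disjoint hY σ i disjoint_sdiff_left fun z hz => hz.1⟩
  obtain ⟨φ, hφ, hxφ, hs⟩ := hY.slice x hxY
  have hΩ : IsOpen (φ.target ∩ φ.symm ⁻¹' U) := φ.isOpen_inter_preimage_symm U.2
  obtain ⟨V, Q, g, hV, hxV, hVΩ, hQ, hVQ, hg, hgΩ, hsum, hone, hvertex⟩ :=
    exists_chart_isotopy hY σ i hφ hs hxφ hxY hΩ inter_subset_left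
      ⟨φ.map_source hxφ, by rw [mem_preimage, φ.left_inv hxφ]; exact hx⟩
  have hmem : ∀ z ∈ φ.source ∩ φ ⁻¹' V, ∀ t ∈ geomSimplex p, ∀ s ∈ Icc (0 : ℝ) 1,
      ((φ z, t), s) ∈ (V ×ˢ geomSimplex p) ×ˢ Icc (0 : ℝ) 1 := fun z hz t ht s hs =>
    ⟨⟨hz.2, ht⟩, hs⟩
  have hsum' : ∀ z ∈ φ.source ∩ φ ⁻¹' V, ∀ t ∈ geomSimplex p, ∀ s ∈ Icc (0 : ℝ) 1,
      ∑ j, bary (contractTo i t s) j * (σ.vertex j).1 (φ.symm (g ((φ z, t), s))) =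
        ∑ j, bary t j * (σ.vertex j).1 z := fun z hz t ht s hs => by
    have h := hsum _ (hmem z hz t ht s hs)
    rwa [φ.left_inv hz.1] at h
  refine ⟨⟨φ.source ∩ φ ⁻¹' V, φ.isOpen_inter_preimage hV⟩, fun z hz => ?_, ⟨hxφ, hxV⟩, _, _,
    isLocalRetract_of_isotopy hY σ i (g := fun q => φ.symm (g ((φ q.1.1, q.1.2), q.2)))
      (fun z hz t ht s hs => ?_) (fun z hz t ht s hs => (hgΩ (hVQ (hmem z hz t ht s hs))).2)
      (fun z hz t ht s hs => ?_) (.inr hsum') (fun z hz t ht => ?_) (fun z hz => ?_)⟩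
  · have h := (hVΩ hz.2).2
    rw [mem_preimage, φ.left_inv hz.1] at h
    exact h
  · have hq := hVQ (hmem z hz t ht s hs)
    have h1 : ContMDiffAt (((𝓡 n).prod 𝓘(ℝ, Fin p → ℝ)).prod 𝓘(ℝ, ℝ))
        𝓘(ℝ, (EuclideanSpace ℝ (Fin n) × (Fin p → ℝ)) × ℝ) ∞
        (fun q : (X × (Fin p → ℝ)) × ℝ => ((φ q.1.1, q.1.2), q.2)) ((z, t), s) :=
      (((contMDiffAt_of_mem_maximalAtlas hφ hz.1).comp ((z, t), s)
          (contMDiff_fst.comp contMDiff_fst).contMDiffAt).prodMk_space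
        (contMDiff_snd.comp contMDiff_fst).contMDiffAt).prodMk_space contMDiff_snd.contMDiffAt
    have h2 : ContMDiffAt 𝓘(ℝ, (EuclideanSpace ℝ (Fin n) × (Fin p → ℝ)) × ℝ) (𝓡 n) ∞ g
        ((φ z, t), s) := (hg.contDiffAt (hQ.mem_nhds hq)).contMDiffAt
    have h3 : ContMDiffAt (𝓡 n) (𝓡 n) ∞ φ.symm (g ((φ z, t), s)) :=
      contMDiffAt_symm_of_mem_maximalAtlas hφ (hgΩ hq).1
    have h4 := ContMDiffAt.comp (g := g)
      (f := fun q : (X × (Fin p → ℝ)) × ℝ => ((φ q.1.1, q.1.2), q.2)) ((z, t), s) h2 h1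
    exact ContMDiffAt.comp (g := φ.symm)
      (f := fun q : (X × (Fin p → ℝ)) × ℝ => g ((φ q.1.1, q.1.2), q.2)) ((z, t), s) h3 h4
  · rw [← sum_bary_mul_eq_zero_iff σ (contractTo_mem i ht hs), hsum' z hz t ht s hs,
      sum_bary_mul_eq_zero_iff σ ht]
  · exact (congrArg φ.symm (hone _ hz.2 t ht)).trans (φ.left_inv hz.1)
  · exact (congrArg φ.symm (hvertex _ hz.2 0 (by simp))).trans (φ.left_inv hz.1)

lemma isLocallyConvex_chartSet_simplex (x₀ : X × (Fin p → ℝ)) :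
    IsLocallyConvex (chartSet ((𝓡 n).prod 𝓘(ℝ, Fin p → ℝ)) (simplexPoleDatum hY σ).S x₀) := by
  have h : chartSet ((𝓡 n).prod 𝓘(ℝ, Fin p → ℝ)) (simplexPoleDatum hY σ).S x₀ =
      ((univ : Set (EuclideanSpace ℝ (Fin n))) ×ˢ geomSimplex p) ∩
        ((extChartAt (𝓡 n) x₀.1).target ×ˢ univ) := by
    ext z
    rw [chartSet, extChartAt_prod, extChartAt_model_space_eq_id]
    simp [simplexPoleDatum, and_comm]
  have h1 : Convex ℝ ((univ : Set (EuclideanSpace ℝ (Fin n))) ×ˢ geomSimplex p) :=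
    convex_univ.prod (convex_geomSimplex p)
  have h2 : IsOpen ((extChartAt (𝓡 n) x₀.1).target ×ˢ (univ : Set (Fin p → ℝ))) :=
    (isOpen_extChartAt_target x₀.1).prod isOpen_univ
  have h3 := (Convex.isLocallyConvex h1).inter_open h2
  exact h.symm ▸ h3

/-- The restriction to a vertex of the simplex is a quasi-isomorphism. -/
theorem isQuasiIso_vertexHom : ShDGA.IsQuasiIso ((vertexHom hY σ i).sheafMap (𝕜 := 𝕜)) :=
  (vertexHom hY σ i).isQuasiIso_sheafMap (isLocallyConvex_chartSet_simplex hY σ)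
    fun U _ hx => exists_isLocalRetract hY σ i U hx

end Vertex

/-! ### The canonical isomorphisms -/

section QuasiIso

universe u

variable {𝕜 : Type} [RCLike 𝕜] {X : Type u} [TopologicalSpace X]

lemma ShDGA.IsQuasiIso.isIso_cohomology_map {F F' : ShDGA 𝕜 X} {f : F ⟶ F'} (hf : IsQuasiIso f)
    (k : ℕ) : IsIso ((ShDGA.cohomology 𝕜 X k).map f) := by
  have h : QuasiIso ((ShDGA.toComplex 𝕜 X).map f) := hf
  have h1 : QuasiIsoAt ((ShDGA.toComplex 𝕜 X).map f) k := h.quasiIsoAt k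
  exact (quasiIsoAt_iff_isIso_homologyMap _ _).1 h1

lemma ShDGA.IsQuasiIso.of_comp_right {F F' F'' : ShDGA 𝕜 X} {f : F ⟶ F'} {g : F' ⟶ F''}
    (hg : IsQuasiIso g) (hfg : IsQuasiIso (f ≫ g)) : IsQuasiIso f := by
  have h1 : QuasiIso ((ShDGA.toComplex 𝕜 X).map g) := hg
  have h2 : QuasiIso ((ShDGA.toComplex 𝕜 X).map f ≫ (ShDGA.toComplex 𝕜 X).map g) := by
    rw [← Functor.map_comp]; exact hfg
  exact quasiIso_of_comp_right _ ((ShDGA.toComplex 𝕜 X).map g)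

end QuasiIso

section Cone

universe u

variable {n m : ℕ} {X : Type u} [TopologicalSpace X]
  [ChartedSpace (EuclideanSpace ℝ (Fin n)) X] [IsManifold (𝓡 n) ∞ X] {Y : Set X}
  (hY : IsClosedSubmanifold n m Y)

/-- The convex cone of nonnegative Morse–Bott functions. -/
def morseBottCone : ConvexCone ℝ (X → ℝ) where
  carrier := morseBott n m Y
  smul_mem' _ hc _ hμ := smul_mem_morseBott hY hμ hc
  add_mem' _ hμ _ hν := add_mem_morseBott hY hμ hν

/-- The affine simplex with given vertices. -/
def AffineSimplex.ofVertices {p : ℕ} (μ : Fin (p + 1) → morseBott n m Y) :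
    AffineSimplex n m Y p where
  toFun t := ∑ i, (t : Fin (p + 1) → ℝ) i • (μ i).1
  mem t := (morseBottCone hY).convex.sum_mem (fun i _ => t.2.1 i) t.2.2 fun i _ => (μ i).2
  affine s t r a b _ _ _ h := by
    simp only [h, Pi.add_apply, Pi.smul_apply, smul_eq_mul, add_smul, mul_smul,
      Finset.sum_add_distrib, Finset.smul_sum]

lemma AffineSimplex.vertex_ofVertices {p : ℕ} (μ : Fin (p + 1) → morseBott n m Y)
    (i : Fin (p + 1)) : (ofVertices hY μ).vertex i = μ i := by
  refine Subtype.ext ?_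
  change ∑ j, (stdSimplex.vertex i : Fin (p + 1) → ℝ) j • (μ j).1 = _
  simp [stdSimplex.vertex, Pi.single_apply]

/-- The affine `1`-simplex from `μ₀` to `μ₁`. -/
def AffineSimplex.edge (μ₀ μ₁ : morseBott n m Y) : AffineSimplex n m Y 1 :=
  ofVertices hY ![μ₀, μ₁]

lemma AffineSimplex.vertex_zero_edge (μ₀ μ₁ : morseBott n m Y) : (edge hY μ₀ μ₁).vertex 0 = μ₀ :=
  vertex_ofVertices hY ![μ₀, μ₁] 0

lemma AffineSimplex.vertex_one_edge (μ₀ μ₁ : morseBott n m Y) : (edge hY μ₀ μ₁).vertex 1 = μ₁ :=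
  vertex_ofVertices hY ![μ₀, μ₁] 1

end Cone

section Evaluation

universe u

variable {𝕜 : Type} [RCLike 𝕜] {n m : ℕ} {X : Type u} [TopologicalSpace X]
  [ChartedSpace (EuclideanSpace ℝ (Fin n)) X] [IsManifold (𝓡 n) ∞ X] {Y : Set X}
  (hY : IsClosedSubmanifold n m Y) {p q : ℕ} (σ : AffineSimplex n m Y p)
  (τ : AffineSimplex n m Y q)

/-- The inclusion `X → X × Δ_p` at a vertex known to be `μ`. -/
def vertexHomOfEq {i : Fin (p + 1)} {μ : morseBott n m Y} (h : σ.vertex i = μ) :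
    (basePoleDatum hY μ).Hom (simplexPoleDatum hY σ) where
  toFun x := (x, geomVertex i)
  smooth := (vertexHom hY σ i).smooth
  mapsTo := (vertexHom hY σ i).mapsTo
  proj_comp _ := rfl
  μ_comp x := by subst h; exact (vertexHom hY σ i).μ_comp x

variable (𝕜) in
/-- The evaluation of forms on `X × Δ_p` at a vertex known to be `μ`. -/
def evalAt {i : Fin (p + 1)} {μ : morseBott n m Y} (h : σ.vertex i = μ) :
    (simplexPoleDatum hY σ).sheaf 𝕜 ⟶ formsWithPoles 𝕜 hY μ :=
  (vertexHomOfEq hY σ h).sheafMap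

lemma isQuasiIso_evalAt {i : Fin (p + 1)} {μ : morseBott n m Y} (h : σ.vertex i = μ) :
    ShDGA.IsQuasiIso (evalAt 𝕜 hY σ h) := by
  subst h; exact isQuasiIso_vertexHom hY σ i

instance isIso_cohomology_map_evalAt {i : Fin (p + 1)} {μ : morseBott n m Y}
    (h : σ.vertex i = μ) (k : ℕ) :
    IsIso ((ShDGA.cohomology 𝕜 X k).map (evalAt 𝕜 hY σ h)) :=
  (isQuasiIso_evalAt hY σ h).isIso_cohomology_map k

/-- The map `X × Δ_q → X × Δ_p` given by a map of the vertices of affine simplices. -/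
def vertexMapHom {θ : Fin (q + 1) → Fin (p + 1)} (h : ∀ j, τ.vertex j = σ.vertex (θ j)) :
    (simplexPoleDatum hY τ).Hom (simplexPoleDatum hY σ) where
  toFun := Prod.map id (affMap θ)
  smooth := contMDiff_id.prodMap (contDiff_affMap _).contMDiff
  mapsTo _ h := ⟨mem_univ _, affMap_mem _ h.2⟩
  proj_comp _ := rfl
  μ_comp z := by
    change ∑ i, bary (affMap θ z.2) i * (σ.vertex i).1 z.1 =
      ∑ i, bary z.2 i * (τ.vertex i).1 z.1
    simp only [bary_affMap, h]
    exact sum_linearMap _ _ fun i => (σ.vertex i).1 z.1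

lemma affMap_geomVertex (θ : Fin (q + 1) → Fin (p + 1)) (j : Fin (q + 1)) :
    affMap θ (geomVertex j) = geomVertex (θ j) := by
  rw [affMap, bary_geomVertex, geomVertex]
  congr 1
  exact congrArg Subtype.val (stdSimplex.map_vertex (S := ℝ) θ j)

/-- The evaluations at vertices are compatible with maps of simplices. -/
lemma sheafMap_vertexMapHom_comp_evalAt {θ : Fin (q + 1) → Fin (p + 1)}
    (h : ∀ j, τ.vertex j = σ.vertex (θ j)) {j : Fin (q + 1)} {i : Fin (p + 1)} (hij : θ j = i)
    {μ : morseBott n m Y} (hτ : τ.vertex j = μ) (hσ : σ.vertex i = μ) :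
    (vertexMapHom hY σ τ h).sheafMap (𝕜 := 𝕜) ≫ evalAt 𝕜 hY τ hτ = evalAt 𝕜 hY σ hσ := by
  refine (PoleDatum.Hom.sheafMap_comp _ _).symm.trans ?_
  refine PoleDatum.Hom.sheafMap_congr (funext fun x => ?_)
  change (x, affMap θ (geomVertex j)) = (x, geomVertex i)
  rw [affMap_geomVertex, hij]

/-- All morphisms of simplices induce quasi-isomorphisms: the composition with the restriction to a
vertex is the restriction to a vertex. -/
theorem isQuasiIso_simplexFunctor_map {σ τ : SimplexCat n m Y} (f : σ ⟶ τ) :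
    ShDGA.IsQuasiIso ((simplexFunctor 𝕜 hY).map f) := by
  have hv : ∀ j, τ.simplex.vertex j = σ.simplex.vertex (SimplexCat.onVertices f j) := fun j => by
    rw [SimplexCat.simplex_eq f, AffineSimplex.vertex_reindex]
  have h1 := sheafMap_vertexMapHom_comp_evalAt (𝕜 := 𝕜) hY σ.simplex τ.simplex hv (j := 0) rfl rfl
    (hv 0).symm
  have h2 : ShDGA.IsQuasiIso ((vertexMapHom hY σ.simplex τ.simplex hv).sheafMap (𝕜 := 𝕜)) :=
    (isQuasiIso_evalAt hY τ.simplex rfl).of_comp_right (h1 ▸ isQuasiIso_evalAt hY σ.simplex _)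
  exact h2

/-- The projection `X × Δ_0 → X`. -/
def projHom (σ : AffineSimplex n m Y 0) (i : Fin 1) :
    (simplexPoleDatum hY σ).Hom (basePoleDatum hY (σ.vertex i)) where
  toFun := Prod.fst
  smooth := contMDiff_fst
  mapsTo _ _ := mem_univ _
  proj_comp _ := rfl
  μ_comp z := by
    change (σ.vertex i).1 z.1 = ∑ j : Fin 1, bary z.2 j * (σ.vertex j).1 z.1
    have h := sum_bary z.2
    rw [Fin.sum_univ_one] at h ⊢
    rw [h, one_mul, Subsingleton.elim i 0]

lemma isIso_vertexHom (hp : p = 0) (i : Fin (p + 1)) :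
    IsIso ((vertexHom hY σ i).sheafMap (𝕜 := 𝕜)) := by
  subst hp
  refine ⟨(projHom hY σ i).sheafMap, ?_, ?_⟩
  · rw [← PoleDatum.Hom.sheafMap_comp, ← PoleDatum.Hom.sheafMap_id]
    exact PoleDatum.Hom.sheafMap_congr (funext fun z => Prod.ext rfl (Subsingleton.elim _ _))
  · rw [← PoleDatum.Hom.sheafMap_comp, ← PoleDatum.Hom.sheafMap_id]
    exact PoleDatum.Hom.sheafMap_congr rfl

end Evaluation

section Transport

universe u

variable (𝕜 : Type) [RCLike 𝕜] {n m : ℕ} {X : Type u} [TopologicalSpace X]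
  [ChartedSpace (EuclideanSpace ℝ (Fin n)) X] [IsManifold (𝓡 n) ∞ X] {Y : Set X}
  (hY : IsClosedSubmanifold n m Y)

/-- The canonical isomorphism of cohomology sheaves: the zigzag of the restrictions to the vertices
of the affine `1`-simplex from `μ₀` to `μ₁`. -/
def transport (k : ℕ) (μ₀ μ₁ : morseBott n m Y) :
    (ShDGA.cohomology 𝕜 X k).obj (formsWithPoles 𝕜 hY μ₀) ≅
      (ShDGA.cohomology 𝕜 X k).obj (formsWithPoles 𝕜 hY μ₁) :=
  (asIso ((ShDGA.cohomology 𝕜 X k).map (evalAt 𝕜 hY _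
      (AffineSimplex.vertex_zero_edge hY μ₀ μ₁)))).symm ≪≫
    asIso ((ShDGA.cohomology 𝕜 X k).map (evalAt 𝕜 hY _
      (AffineSimplex.vertex_one_edge hY μ₀ μ₁)))

variable {𝕜}

/-- The transport is compatible with the restrictions to two vertices of any affine simplex, since
these factor through the edge between the vertices. -/
lemma map_evalAt_comp_transport (k : ℕ) {p : ℕ} (σ : AffineSimplex n m Y p)
    {i j : Fin (p + 1)} {μ₀ μ₁ : morseBott n m Y} (hi : σ.vertex i = μ₀) (hj : σ.vertex j = μ₁) :
    (ShDGA.cohomology 𝕜 X k).map (evalAt 𝕜 hY σ hi) ≫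
        (transport 𝕜 hY k μ₀ μ₁).hom =
      (ShDGA.cohomology 𝕜 X k).map (evalAt 𝕜 hY σ hj) := by
  have hv : ∀ l, (AffineSimplex.edge hY μ₀ μ₁).vertex l = σ.vertex (![i, j] l) := by
    intro l
    fin_cases l
    · exact (AffineSimplex.vertex_zero_edge hY μ₀ μ₁).trans hi.symm
    · exact (AffineSimplex.vertex_one_edge hY μ₀ μ₁).trans hj.symm
  have h0 := sheafMap_vertexMapHom_comp_evalAt (𝕜 := 𝕜) hY σ _ hv (j := 0) (i := i) rfl
    (AffineSimplex.vertex_zero_edge hY μ₀ μ₁) hi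
  have h1 := sheafMap_vertexMapHom_comp_evalAt (𝕜 := 𝕜) hY σ _ hv (j := 1) (i := j) rfl
    (AffineSimplex.vertex_one_edge hY μ₀ μ₁) hj
  rw [← h0, ← h1, Functor.map_comp, Functor.map_comp, Category.assoc]
  congr 1
  exact (asIso ((ShDGA.cohomology 𝕜 X k).map (evalAt 𝕜 hY _
      (AffineSimplex.vertex_zero_edge hY μ₀ μ₁)))).hom_inv_id_assoc _

/-- The cocycle condition, read off from the affine `2`-simplex with the three given vertices. -/
lemma transport_comp (k : ℕ) (μ₀ μ₁ μ₂ : morseBott n m Y) :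
    (transport 𝕜 hY k μ₀ μ₁).hom ≫ (transport 𝕜 hY k μ₁ μ₂).hom =
      (transport 𝕜 hY k μ₀ μ₂).hom := by
  let σ := AffineSimplex.ofVertices hY ![μ₀, μ₁, μ₂]
  have h0 : σ.vertex 0 = μ₀ := AffineSimplex.vertex_ofVertices hY ![μ₀, μ₁, μ₂] 0
  have h1 : σ.vertex 1 = μ₁ := AffineSimplex.vertex_ofVertices hY ![μ₀, μ₁, μ₂] 1
  have h2 : σ.vertex 2 = μ₂ := AffineSimplex.vertex_ofVertices hY ![μ₀, μ₁, μ₂] 2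
  rw [← cancel_epi ((ShDGA.cohomology 𝕜 X k).map (evalAt 𝕜 hY σ h0)),
    ← Category.assoc, map_evalAt_comp_transport hY k σ h0 h1,
    map_evalAt_comp_transport hY k σ h1 h2, map_evalAt_comp_transport hY k σ h0 h2]

include hY in
lemma exists_edge (μ₀ μ₁ : morseBott n m Y) :
    ∃ (σ : SimplexCat n m Y) (i j : Fin (σ.1.unop.len + 1)), σ.1.unop.len = 1 ∧
      σ.simplex.vertex i = μ₀ ∧ σ.simplex.vertex j = μ₁ :=
  ⟨⟨op (SimplexCategory.mk 1), AffineSimplex.edge hY μ₀ μ₁⟩, (0 : Fin 2), (1 : Fin 2),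
    rfl, AffineSimplex.vertex_zero_edge hY μ₀ μ₁,
    AffineSimplex.vertex_one_edge hY μ₀ μ₁⟩

lemma map_restrictToVertex_comp_transport (k : ℕ) (σ : SimplexCat n m Y)
    (i j : Fin (σ.1.unop.len + 1)) :
    (ShDGA.cohomology 𝕜 X k).map (restrictToVertex 𝕜 hY σ i) ≫
        (transport 𝕜 hY k (σ.simplex.vertex i) (σ.simplex.vertex j)).hom =
      (ShDGA.cohomology 𝕜 X k).map (restrictToVertex 𝕜 hY σ j) :=
  map_evalAt_comp_transport hY k σ.simplex rfl rfl

instance isIso_map_restrictToVertex (k : ℕ) (σ : SimplexCat n m Y) (i : Fin (σ.1.unop.len + 1)) :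
    IsIso ((ShDGA.cohomology 𝕜 X k).map (restrictToVertex 𝕜 hY σ i)) :=
  isIso_cohomology_map_evalAt hY σ.simplex rfl k

/-- Compatibility with the restrictions to the two vertices of an edge determines the isomorphism,
since these restrictions are isomorphisms on cohomology. -/
lemma eq_transport (k : ℕ) (I' : ∀ μ₀ μ₁ : morseBott n m Y,
      (ShDGA.cohomology 𝕜 X k).obj (formsWithPoles 𝕜 hY μ₀) ≅
        (ShDGA.cohomology 𝕜 X k).obj (formsWithPoles 𝕜 hY μ₁))
    (h : ∀ (σ : SimplexCat n m Y) (i j : Fin (σ.1.unop.len + 1)), σ.1.unop.len = 1 →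
      (ShDGA.cohomology 𝕜 X k).map (restrictToVertex 𝕜 hY σ i) ≫
          (I' (σ.simplex.vertex i) (σ.simplex.vertex j)).hom =
        (ShDGA.cohomology 𝕜 X k).map (restrictToVertex 𝕜 hY σ j)) :
    I' = transport 𝕜 hY k := by
  funext μ₀ μ₁
  obtain ⟨σ, i, j, hσ, rfl, rfl⟩ := exists_edge hY μ₀ μ₁
  refine Iso.ext ((cancel_epi ((ShDGA.cohomology 𝕜 X k).map (restrictToVertex 𝕜 hY σ i))).1 ?_)
  rw [h σ i j hσ, map_restrictToVertex_comp_transport]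

end Transport

end MorseBottForms

end

theorem mainTheorem6 {𝕜 : Type} [RCLike 𝕜] {n m : ℕ} {X : Type*} [TopologicalSpace X] [T2Space X]
    [SecondCountableTopology X] [ChartedSpace (EuclideanSpace ℝ (Fin n)) X]
    [IsManifold (𝓡 n) ∞ X] {Y : Set X} (hY : IsClosedSubmanifold n m Y) :
    -- the nonnegative Morse–Bott functions form a convex cone
    (∃ C : ConvexCone ℝ (X → ℝ), (C : Set (X → ℝ)) = morseBott n m Y) ∧
    -- on vertices the functor is given by the sheaf of forms with poles
    (∀ (σ : SimplexCat n m Y) (i : Fin (σ.1.unop.len + 1)), σ.1.unop.len = 0 →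
      IsIso (restrictToVertex 𝕜 hY σ i)) ∧
    -- the functor sends all morphisms to quasi-isomorphisms
    (∀ {σ τ : SimplexCat n m Y} (f : σ ⟶ τ),
      ShDGA.IsQuasiIso ((simplexFunctor 𝕜 hY).map f)) ∧
    -- the canonical isomorphisms of the cohomology sheaves
    ∀ k : ℕ, ∃ I : ∀ μ₀ μ₁ : morseBott n m Y,
        (ShDGA.cohomology 𝕜 X k).obj (formsWithPoles 𝕜 hY μ₀) ≅
          (ShDGA.cohomology 𝕜 X k).obj (formsWithPoles 𝕜 hY μ₁),
      (∀ (σ : SimplexCat n m Y) (i j : Fin (σ.1.unop.len + 1)),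
        (ShDGA.cohomology 𝕜 X k).map (restrictToVertex 𝕜 hY σ i) ≫
            (I (σ.simplex.vertex i) (σ.simplex.vertex j)).hom =
          (ShDGA.cohomology 𝕜 X k).map (restrictToVertex 𝕜 hY σ j)) ∧
      (∀ μ₀ μ₁ μ₂ : morseBott n m Y,
        (I μ₀ μ₁).hom ≫ (I μ₁ μ₂).hom = (I μ₀ μ₂).hom) ∧
      ∀ I' : ∀ μ₀ μ₁ : morseBott n m Y,
          (ShDGA.cohomology 𝕜 X k).obj (formsWithPoles 𝕜 hY μ₀) ≅
            (ShDGA.cohomology 𝕜 X k).obj (formsWithPoles 𝕜 hY μ₁),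
        (∀ (σ : SimplexCat n m Y) (i j : Fin (σ.1.unop.len + 1)), σ.1.unop.len = 1 →
          (ShDGA.cohomology 𝕜 X k).map (restrictToVertex 𝕜 hY σ i) ≫
              (I' (σ.simplex.vertex i) (σ.simplex.vertex j)).hom =
            (ShDGA.cohomology 𝕜 X k).map (restrictToVertex 𝕜 hY σ j)) → I' = I := by
  refine ⟨⟨morseBottCone hY, rfl⟩, fun σ i hσ => isIso_vertexHom hY σ.simplex hσ i,
    fun f => isQuasiIso_simplexFunctor_map hY f, fun k => ⟨transport 𝕜 hY k,
      map_restrictToVertex_comp_transport hY k, transport_comp hY k,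
      fun I' => eq_transport hY k I'⟩⟩
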